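/- Let $\lambda\in\mathbb C$ with $\mathrm{Re}\,\lambda\ge 1$. For $N\ge 1$ put $\mathcal A_N=\{t\in\mathbb C^N : |\mathrm{Im}(t_j-t_k)|<\pi \text{ for all } j,k\}$ and, for $t\in\mathbb C^N$, $\phi_N(t)=\tfrac12(\max_j\mathrm{Im}\,t_j+\min_j\mathrm{Im}\,t_j)$. Define $$W_N(\lambda;t)=\prod_{1\le j<k\le N}[4\sinh^2(t_j-t_k)]^\lambda,\qquad \mathcal K_N^\sharp(\lambda;t,s)=\prod_{j=1}^N\prod_{k=1}^{N-1}[2\cosh(t_j-s_k)]^{-\lambda},$$ and recursively, for $u\in\mathbb R^N$ and $t\in\mathcal A_N$, $F_1(\lambda;t,u)=e^{itu}$ and, for $N\ge2$, $$F_N(\lambda;t,u)=\frac{e^{iu_N(t_1+\cdots+t_N)}}{(N-1)!}\int_{(\mathbb R+i\phi_N(t))^{N-1}}W_{N-1}(\lambda;s)\,\mathcal K_N^\sharp(\lambda;t,s)\,F_{N-1}\big(\lambda;s,(u_1-u_N,\ldots,u_{N-1}-u_N)\big)\,ds$$ (for real $t$ the integral is over $\mathbb R^{N-1}$; on the contours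 the bases of the powers in $W_{N-1}$ are nonnegative, those in $\mathcal K_N^\sharp$ have positive real part, and the powers are principal). For a matrix $M$ let $\Sigma_k(M)$ be the sum of its principal $k\times k$ minors, and let $S_k$ be the $k$th elementary symmetric function of $N$ variables. Let $$\mathcal L(t,u)_{jk}=\delta_{jk}u_j+(1-\delta_{jk})\frac{i\lambda}{\sinh(t_j-t_k)},\qquad \mathcal E(t)=\mathrm{diag}(w_1(t),\ldots,w_N(t)),\quad w_j(t)=-i\lambda\sum_{k\ne j}\coth(t_j-t_k),$$ and let $:\!\hat\Sigma_k(\mathcal L+\mathcal E)(t)\!:$ be the partial differential operator obtained from $\Sigma_k(\mathcal L(t,u)+\mathcal E(t))$ by substituting $u_j\to-i\partial_{t_j}$, with all $t$-dependent coefficients to the left of the derivatives. Then for all $N\ge1$, $u\in\mathbb R^N$ and $t\in\mathcal A_N$ the integrals above converge absolutely, $F_N(\lambda;t,u)$ is holomorphic in $t\in\mathcal A_N$, and $$:\!\hat\Sigma_k(\mathcal L+\mathcal E)(t)\!:F_N(\lambda;t,u)=S_k(u)\,F_N(\lambda;t,u),\qquad k=1,\ldots,N,\quad t\in\mathcal A_N,$$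 where at points with $t_j=t_k$ for some $j\ne k$, at which the coefficients are singular, the left-hand side is understood as its limit from points of $\mathcal A_N$ with pairwise distinct coordinates. Equivalently, in terms of the hyperbolic Calogero–Moser Hamiltonians: let $\hbar,\mu>0$, $g=\hbar\lambda$, and for $x\in\mathbb R^N$ let $$L(x,p)_{jk}=\delta_{jk}p_j+(1-\delta_{jk})\frac{i\mu g}{2\sinh(\mu(x_j-x_k)/2)},\qquad E(x)=\mathrm{diag}(z_1(x),\ldots,z_N(x)),\quad z_j(x)=-\frac{i\mu g}{2}\sum_{k\neq j}\coth(\mu(x_j-x_k)/2),$$ $$\mathcal W(x)^{1/2}=\prod_{1\le j<k\le N}[4\sinh^2(\mu(x_j-x_k)/2)]^{g/2\hbar},\qquad H_k=\mathcal W(x)^{1/2}:\!\hat\Sigma_k(L+E)(x)\!:\mathcal W(x)^{-1/2},$$ where now $p_j\to-i\hbar\partial_{x_j}$, again in normal order. Then for all $p\in\mathbb R^N$ the function $$\Psi_N(x,p)=\mathcal W(x)^{1/2}\,F_N\big(\lambda;\mu x/2,\,2p/(\hbar\mu)\big)$$ satisfies $H_k\Psi_N(x,p)=S_k(p)\,\Psi_N(x,p)$,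 $k=1,\ldots,N$, for all $x\in\mathbb R^N$ with pairwise distinct coordinates. -/

import Mathlib

namespace CalogeroMoser

noncomputable section

/-! ### Normal-ordered partial differential operators -/

/-- The partial derivative `∂_j f` of a function of `N` (real or complex) variables. -/
def partialD {𝕜 : Type} [NontriviallyNormedField 𝕜] [NormedSpace 𝕜 ℂ] {N : ℕ} (j : Fin N)
    (f : (Fin N → 𝕜) → ℂ) : (Fin N → 𝕜) → ℂ :=
  fun t => deriv (fun z : 𝕜 => f (Function.update t j z)) (t j)

/-- The iterated partial derivative `∂₁^{m₁} ⋯ ∂_N^{m_N} f`. -/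
def multiD {𝕜 : Type} [NontriviallyNormedField 𝕜] [NormedSpace 𝕜 ℂ] {N : ℕ} (m : Fin N →₀ ℕ)
    (f : (Fin N → 𝕜) → ℂ) : (Fin N → 𝕜) → ℂ :=
  (List.finRange N).foldr (fun j h => (partialD j)^[m j] h) f

/-- Normal-ordered quantization. A symbol `σ` is, at every point `t`, a polynomial in the momenta
`X_1, …, X_N`. The operator is obtained by the substitution `X_j ↦ c ∂_j`, all coefficients being
put to the left of the derivatives. -/
def normalOrdered {𝕜 : Type} [NontriviallyNormedField 𝕜] [NormedSpace 𝕜 ℂ] {N : ℕ} (c : ℂ)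
    (σ : (Fin N → 𝕜) → MvPolynomial (Fin N) ℂ) (f : (Fin N → 𝕜) → ℂ) : (Fin N → 𝕜) → ℂ :=
  fun t => ∑ m ∈ (σ t).support, (σ t).coeff m * c ^ (∑ j, m j) * multiD m f t

/-- The `k`-th symmetric function `Σ_k(M)` of a matrix: the sum of its principal `k × k` minors. -/
def symMat {R : Type*} [CommRing R] {N : ℕ} (k : ℕ) (M : Matrix (Fin N) (Fin N) R) : R :=
  ∑ S ∈ Finset.powersetCard k (Finset.univ : Finset (Fin N)),
    (M.submatrix (fun j : {j // j ∈ S} => j.1) (fun j : {j // j ∈ S} => j.1)).det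

/-- The elementary symmetric function `S_k(a_1, …, a_N)`. -/
def elemSymm {N : ℕ} (k : ℕ) (a : Fin N → ℝ) : ℝ :=
  ((Finset.univ : Finset (Fin N)).val.map a).esymm k

def coth (z : ℂ) : ℂ := Complex.cosh z / Complex.sinh z

/-! ### The dimensionless operators `:Σ̂_k(𝓛+𝓔)(t):` -/

/-- The matrix `𝓛(t,u)_{jk} = δ_{jk} u_j + (1-δ_{jk}) iλ / sinh(t_j - t_k)`, with the momenta
`u_j` as polynomial variables. -/
def laxDimless {N : ℕ} (lam : ℂ) (t : Fin N → ℂ) :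
    Matrix (Fin N) (Fin N) (MvPolynomial (Fin N) ℂ) :=
  Matrix.of fun j k => if j = k then MvPolynomial.X j
    else MvPolynomial.C (Complex.I * lam / Complex.sinh (t j - t k))

/-- The matrix `𝓔(t) = diag(w_1(t), …, w_N(t))`, `w_j(t) = -iλ ∑_{k ≠ j} coth(t_j - t_k)`. -/
def diagDimless {N : ℕ} (lam : ℂ) (t : Fin N → ℂ) :
    Matrix (Fin N) (Fin N) (MvPolynomial (Fin N) ℂ) :=
  Matrix.diagonal fun j =>
    MvPolynomial.C (-Complex.I * lam * ∑ k ∈ Finset.univ.erase j, coth (t j - t k))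

/-- The normal-ordered operator `:Σ̂_k(𝓛+𝓔)(t):`, where `u_j ↦ -i ∂_{t_j}`. -/
def sigmaHat {N : ℕ} (lam : ℂ) (k : ℕ) (f : (Fin N → ℂ) → ℂ) : (Fin N → ℂ) → ℂ :=
  normalOrdered (-Complex.I) (fun t => symMat k (laxDimless lam t + diagDimless lam t)) f

/-! ### The functions `F_N` -/

/-- The domain `𝒜_N = {t ∈ ℂ^N : |Im(t_j - t_k)| < π}`. -/
def domainA (N : ℕ) : Set (Fin N → ℂ) :=
  {t | ∀ j k, |(t j - t k).im| < Real.pi}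

/-- The weight function `W_N(λ;t) = ∏_{j<k} [4 sinh²(t_j - t_k)]^λ`. It is only evaluated where
all `t_j - t_k` are real. -/
def weightW {N : ℕ} (lam : ℂ) (t : Fin N → ℂ) : ℂ :=
  ∏ j, ∏ k ∈ Finset.Ioi j, (4 * Complex.sinh (t j - t k) ^ 2) ^ lam

/-- The kernel function `𝒦_N^♯(λ;t,s) = ∏_{j=1}^N ∏_{k=1}^{N-1} [2 cosh(t_j - s_k)]^{-λ}`. It is
only evaluated where `|Im(t_j - s_k)| < π/2`, so that `2 cosh(t_j - s_k)` has positive real part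
and the power is the principal one. -/
def kernelK {n : ℕ} (lam : ℂ) (t : Fin (n + 1) → ℂ) (s : Fin n → ℂ) : ℂ :=
  ∏ j, ∏ k, (2 * Complex.cosh (t j - s k)) ^ (-lam)

/-- The height `φ_N(t) = (max_j Im t_j + min_j Im t_j) / 2` of the integration contours. -/
def phi {n : ℕ} (t : Fin (n + 1) → ℂ) : ℝ :=
  ((⨆ j, (t j).im) + (⨅ j, (t j).im)) / 2

/-- The integrand `W_{N-1}(λ;s) 𝒦_N^♯(λ;t,s) F_{N-1}(λ;s,(u_1-u_N,…,u_{N-1}-u_N))`, `N = n + 1`,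
at the point `s = r + iφ_N(t)` of the shifted contours, parametrized by `r ∈ ℝ^{N-1}`. -/
def integrandI {n : ℕ} (lam : ℂ) (F : (Fin n → ℂ) → (Fin n → ℝ) → ℂ)
    (t : Fin (n + 1) → ℂ) (u : Fin (n + 1) → ℝ) (r : Fin n → ℝ) : ℂ :=
  let s : Fin n → ℂ := fun j => (r j : ℂ) + (phi t : ℂ) * Complex.I
  weightW lam s * kernelK lam t s * F s (fun j => u j.castSucc - u (Fin.last n))

/-- The recursively defined functions `F_N(λ;t,u)`: `F_1` is the plane wave `exp(itu)`, and
`F_N(λ;t,u) = exp(i u_N (t_1+⋯+t_N)) / (N-1)! · ∫_{(ℝ+iφ_N(t))^{N-1}} ds W_{N-1}(λ;s)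
𝒦_N^♯(λ;t,s) F_{N-1}(λ;s,(u_1-u_N,…,u_{N-1}-u_N))`. For real `t` the contours are real. The value
for `N = 0` plays no role. -/
def eigenF (lam : ℂ) : (N : ℕ) → (Fin N → ℂ) → (Fin N → ℝ) → ℂ
  | 0, _, _ => 1
  | 1, t, u => Complex.exp (Complex.I * t 0 * u 0)
  | n + 2, t, u =>
      Complex.exp (Complex.I * u (Fin.last (n + 1)) * ∑ j, t j) / (Nat.factorial (n + 1) : ℂ) *
        ∫ r : Fin (n + 1) → ℝ, integrandI lam (eigenF lam (n + 1)) t u r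

/-! ### The hyperbolic Calogero–Moser Hamiltonians -/

/-- The Lax matrix `L(x,p)_{jk} = δ_{jk} p_j + (1-δ_{jk}) iμg / (2 sinh(μ(x_j-x_k)/2))`, with the
momenta `p_j` as polynomial variables. -/
def laxL {N : ℕ} (mu : ℝ) (g : ℂ) (x : Fin N → ℝ) :
    Matrix (Fin N) (Fin N) (MvPolynomial (Fin N) ℂ) :=
  Matrix.of fun j k => if j = k then MvPolynomial.X j
    else MvPolynomial.C
      (Complex.I * mu * g / (2 * Complex.sinh ((mu * (x j - x k) / 2 : ℝ) : ℂ)))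

/-- The matrix `E(x) = diag(z_1(x), …, z_N(x))`,
`z_j(x) = -(iμg/2) ∑_{k ≠ j} coth(μ(x_j-x_k)/2)`. -/
def diagE {N : ℕ} (mu : ℝ) (g : ℂ) (x : Fin N → ℝ) :
    Matrix (Fin N) (Fin N) (MvPolynomial (Fin N) ℂ) :=
  Matrix.diagonal fun j =>
    MvPolynomial.C (-(Complex.I * mu * g / 2) *
      ∑ k ∈ Finset.univ.erase j, coth ((mu * (x j - x k) / 2 : ℝ) : ℂ))

/-- The square root `𝒲(g;x)^{1/2} = ∏_{j<k} [4 sinh²(μ(x_j-x_k)/2)]^{g/(2ħ)}` (all bases are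
nonnegative reals), which is the positive square root when `g > 0`. -/
def sqrtWeight {N : ℕ} (hbar mu : ℝ) (g : ℂ) (x : Fin N → ℝ) : ℂ :=
  weightW (g / hbar / 2) (fun j => ((mu * x j / 2 : ℝ) : ℂ))

/-- The Hamiltonian `H_k = 𝒲(x)^{1/2} :Σ̂_k(L+E)(x): 𝒲(x)^{-1/2}`, where `p_j ↦ -iħ ∂_{x_j}`. -/
def hamiltonian {N : ℕ} (hbar mu : ℝ) (g : ℂ) (k : ℕ) (f : (Fin N → ℝ) → ℂ) :
    (Fin N → ℝ) → ℂ :=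
  fun x => sqrtWeight hbar mu g x *
    normalOrdered (-Complex.I * hbar) (fun y => symMat k (laxL mu g y + diagE mu g y))
      (fun y => (sqrtWeight hbar mu g y)⁻¹ * f y) x

/-- The function `Ψ_N(g;x,p) = W(g/ħ;μx/2)^{1/2} F_N(g/ħ;μx/2,2p/(ħμ))`. -/
def eigenPsi {N : ℕ} (hbar mu : ℝ) (g : ℂ) (x p : Fin N → ℝ) : ℂ :=
  sqrtWeight hbar mu g x *
    eigenF (g / hbar) N (fun j => ((mu * x j / 2 : ℝ) : ℂ)) (fun j => 2 * p j / (hbar * mu))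

end

end CalogeroMoser

/-! The functions `eigenF` arise from an integral transform whose kernel intertwines the operators
in N and in N - 1 variables, so the eigenvalue equations are proved by induction on N. Four
ingredients carry the argument.

Algebra. The functions 1/sinh satisfy an addition formula, which makes every principal minor of the
Lax matrix a sum over matchings (`minor_eq_pairSum`). The symbols are therefore multi-affine in the
momenta: each variable is differentiated at most once, and it suffices to follow families of
derivatives indexed by sets of variables (`DerivFamily`, `opValue`). On a product of functions of
one variable, such as plane wave times kernel, the operator multiplies by its symbol at the
logarithmic derivatives (`opValue_prodFam`). The Lax matrices obtained in this way in the variables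
t and s are intertwined by the Cauchy matrix 1/cosh(t_j - s_k), which has full rank
(`kernelLax_intertwining`, `exists_isUnit_cauchy`), and their traces differ by u_N. The spectrum in
t is thus the spectrum in s together with u_N, which matches the recursion of the elementary
symmetric functions (`symMat_kernelLax`, `elemSymm_succ`).

Transposition. In the variables s the kernel carries the operator with -𝓔 in place of 𝓔 and i∂ in
place of -i∂. This is the transpose with respect to W (`integral_weight_opValue`), found by
integrating by parts in one variable at a time: ∂_j W = 2i w_j W reverses the sign of w_j, while the
derivatives of the other w_l are collected in the intermediate pair weights `pairWP`. The
coefficients have poles where variables collide, bounded by one product of |coth| per variable;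
since Re λ ≥ 1, the weight absorbs them and no boundary terms remain.

Growth. The induction carries the bound exp(-(Re λ/2) ∑|s_j - s_k| + δ ∑|s_k|), for every δ > 0, on
the function and its derivatives (`HasGrowth`). The transform preserves it because of an inequality
between the mutual distances of n + 1 and n points (`spread_add_spread_le`). Its strict form for
remote s (`spread_add_spread_add_le`) gives absolute convergence, differentiation under the integral
and the integrations by parts.

Contours. No contour is ever deformed. From its definition `eigenF` is covariant under simultaneous
complex translations, since the contour moves along with t (`eigenF_add`). The transform over real
contours is holomorphic for |Im t_j| < π/2 and has the same covariance by the identity theorem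
(`covariant_of_differentiableOn`), so the two agree on this strip (`eigenF_eq_of_mem_strip`).
Translation by iφ_N(t) carries every point of 𝒜_N into the strip. The Hamiltonians follow by
conjugation and rescaling (`hamiltonian_eigenPsi`). -/

namespace CalogeroMoser

noncomputable section

/-! ### Sums over matchings -/

/-- The sum over all partitions of `U` into pairs and singletons of the product of the weights
`v i j` of the pairs and `x j` of the singletons. -/
def pairSum {ι R : Type*} [DecidableEq ι] [CommRing R] (v : ι → ι → R) (x : ι → R)
    (U : Finset ι) : R :=
  open Classical in
  if h : U.Nonempty then
    x h.choose * pairSum v x (U.erase h.choose) +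
      ∑ i ∈ (U.erase h.choose).attach,
        v h.choose i * pairSum v x ((U.erase h.choose).erase i)
  else 1
termination_by U.card
decreasing_by
  · exact Finset.card_erase_lt_of_mem h.choose_spec
  · exact lt_of_le_of_lt (Finset.card_erase_le) (Finset.card_erase_lt_of_mem h.choose_spec)

section pairSum

variable {ι R : Type*} [DecidableEq ι] [CommRing R] {v : ι → ι → R}

@[simp] lemma pairSum_empty (v : ι → ι → R) (x : ι → R) : pairSum v x ∅ = 1 := by
  rw [pairSum]; simp

lemma exists_pairSum_eq (v : ι → ι → R) (x : ι → R) {U : Finset ι} (hU : U.Nonempty) :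
    ∃ j ∈ U, pairSum v x U = x j * pairSum v x (U.erase j) +
      ∑ i ∈ U.erase j, v j i * pairSum v x ((U.erase j).erase i) := by
  refine ⟨hU.choose, hU.choose_spec, ?_⟩
  conv_lhs => rw [pairSum]
  rw [dif_pos hU]
  congr 1
  exact Finset.sum_attach _ (fun i => v hU.choose i * pairSum v x ((U.erase hU.choose).erase i))

/-- Expansion of `pairSum` along an arbitrary element. -/
lemma pairSum_eq (hv : ∀ i j, v i j = v j i) (x : ι → R) {U : Finset ι} {j : ι} (hj : j ∈ U) :
    pairSum v x U = x j * pairSum v x (U.erase j) +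
      ∑ i ∈ U.erase j, v j i * pairSum v x ((U.erase j).erase i) := by
  induction U using Finset.strongInduction generalizing j with
  | H U ih =>
    obtain ⟨k, hk, h⟩ := exists_pairSum_eq v x ⟨j, hj⟩
    by_cases hjk : j = k
    · subst hjk; exact h
    have hkj : k ∈ U.erase j := Finset.mem_erase.2 ⟨Ne.symm hjk, hk⟩
    have hjk' : j ∈ U.erase k := Finset.mem_erase.2 ⟨hjk, hj⟩
    have e1 : ∀ i ∈ (U.erase k).erase j, pairSum v x ((U.erase k).erase i) =
        x j * pairSum v x (((U.erase k).erase j).erase i) +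
        ∑ l ∈ ((U.erase k).erase j).erase i,
          v j l * pairSum v x ((((U.erase k).erase j).erase i).erase l) := by
      intro i hi
      have hi' := Finset.mem_erase.1 hi
      rw [ih ((U.erase k).erase i) (lt_of_le_of_lt (Finset.erase_subset _ _)
        (Finset.erase_ssubset hk)) (j := j) (Finset.mem_erase.2 ⟨hi'.1.symm, hjk'⟩)]
      rw [Finset.erase_right_comm (a := i)]
    have e2 : ∀ i ∈ (U.erase k).erase j, pairSum v x ((U.erase j).erase i) =
        x k * pairSum v x (((U.erase k).erase j).erase i) +
        ∑ l ∈ ((U.erase k).erase j).erase i,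
          v k l * pairSum v x ((((U.erase k).erase j).erase i).erase l) := by
      intro i hi
      rw [Finset.erase_right_comm] at hi
      have hi' := Finset.mem_erase.1 hi
      rw [ih ((U.erase j).erase i) (lt_of_le_of_lt (Finset.erase_subset _ _)
        (Finset.erase_ssubset hj)) (j := k) (Finset.mem_erase.2 ⟨hi'.1.symm, hkj⟩)]
      rw [Finset.erase_right_comm (a := i), Finset.erase_right_comm (a := j)]
    rw [h, ih _ (Finset.erase_ssubset hk) hjk', ih _ (Finset.erase_ssubset hj) hkj,
      ← Finset.add_sum_erase _ _ hjk', ← Finset.add_sum_erase (U.erase j) _ hkj,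
      Finset.erase_right_comm (a := j) (b := k), hv j k]
    rw [Finset.sum_congr rfl (fun i hi => congrArg (v k i * ·) (e1 i hi)),
      Finset.sum_congr rfl (fun i hi => congrArg (v j i * ·) (e2 i hi))]
    -- Matchings in which j and k have different partners: exchanging the names of the two partners
    -- identifies the double sums.
    have hsw : ∑ i ∈ (U.erase k).erase j, v k i * ∑ l ∈ ((U.erase k).erase j).erase i,
        (v j l * pairSum v x ((((U.erase k).erase j).erase i).erase l)) =
        ∑ i ∈ (U.erase k).erase j, v j i * ∑ l ∈ ((U.erase k).erase j).erase i,
        (v k l * pairSum v x ((((U.erase k).erase j).erase i).erase l)) := by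
      simp only [Finset.mul_sum]
      rw [Finset.sum_comm' (t' := (U.erase k).erase j)
        (s' := fun l => ((U.erase k).erase j).erase l)]
      · refine Finset.sum_congr rfl fun i _ => Finset.sum_congr rfl fun l _ => ?_
        rw [Finset.erase_right_comm (a := l)]; ring
      · intro a b
        simp only [Finset.mem_erase]
        tauto
    simp only [mul_add, Finset.sum_add_distrib, hsw]
    have h1 : ∀ (q : R) (f g : ι → R), ∑ i ∈ (U.erase k).erase j, f i * (q * g i) =
        q * ∑ i ∈ (U.erase k).erase j, f i * g i := by
      intro q f g
      rw [Finset.mul_sum]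
      exact Finset.sum_congr rfl fun i _ => by ring
    rw [h1, h1]
    ring

lemma pairSum_congr {v' : ι → ι → R} {x x' : ι → R} {U : Finset ι}
    (hv : ∀ i ∈ U, ∀ j ∈ U, i ≠ j → v i j = v' i j) (hx : ∀ i ∈ U, x i = x' i)
    (hs : ∀ i j, v i j = v j i) (hs' : ∀ i j, v' i j = v' j i) :
    pairSum v x U = pairSum v' x' U := by
  induction U using Finset.strongInduction with
  | H U ih =>
    rcases U.eq_empty_or_nonempty with rfl | ⟨j, hj⟩
    · simp
    have hsub : ∀ i, (U.erase j).erase i ⊂ U := fun i => lt_of_le_of_lt (Finset.erase_subset _ _)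
        (Finset.erase_ssubset hj)
    rw [pairSum_eq hs x hj, pairSum_eq hs' x' hj, hx j hj, ih _ (Finset.erase_ssubset hj)
      (fun a ha b hb => hv a (Finset.mem_of_mem_erase ha) b (Finset.mem_of_mem_erase hb))
      (fun a ha => hx a (Finset.mem_of_mem_erase ha))]
    congr 1
    refine Finset.sum_congr rfl fun i hi => ?_
    rw [hv j hj i (Finset.mem_of_mem_erase hi) (Finset.ne_of_mem_erase hi).symm,
      ih _ (hsub i) (fun a ha b hb => hv a ((hsub i).1 ha) b ((hsub i).1 hb))
      (fun a ha => hx a ((hsub i).1 ha))]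

lemma sum_powerset_of_mem {M : Type*} [AddCommMonoid M] {U : Finset ι} {j : ι} (hj : j ∈ U)
    (f : Finset ι → M) : ∑ B ∈ U.powerset, f B =
      ∑ B ∈ (U.erase j).powerset, f B + ∑ B ∈ (U.erase j).powerset, f (insert j B) := by
  conv_lhs => rw [← Finset.insert_erase hj]
  exact Finset.sum_powerset_insert (Finset.notMem_erase j U) f

lemma sum_powerset_sum_sdiff {M : Type*} [AddCommMonoid M] (U : Finset ι)
    (f : Finset ι → ι → M) : ∑ B ∈ U.powerset, ∑ i ∈ U \ B, f B i =
      ∑ i ∈ U, ∑ B ∈ (U.erase i).powerset, f B i := by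
  refine Finset.sum_comm' ?_
  intro B i
  simp only [Finset.mem_powerset, Finset.mem_sdiff, Finset.subset_erase]
  tauto

/-- `pairSum` is multi-affine in the singleton weights. -/
lemma pairSum_add (hv : ∀ i j, v i j = v j i) (x y : ι → R) (U : Finset ι) :
    pairSum v (fun i => x i + y i) U =
      ∑ B ∈ U.powerset, (∏ i ∈ B, x i) * pairSum v y (U \ B) := by
  induction U using Finset.strongInduction with
  | H U ih =>
    rcases U.eq_empty_or_nonempty with rfl | ⟨j, hj⟩
    · simp
    have hsub : ∀ i, (U.erase j).erase i ⊂ U := fun i => lt_of_le_of_lt (Finset.erase_subset _ _)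
        (Finset.erase_ssubset hj)
    rw [pairSum_eq hv _ hj, sum_powerset_of_mem hj, ih _ (Finset.erase_ssubset hj),
      Finset.sum_congr rfl (fun i _ => congrArg (v j i * ·) (ih _ (hsub i)))]
    have e1 : ∑ B ∈ (U.erase j).powerset, (∏ i ∈ insert j B, x i) * pairSum v y (U \ insert j B)
        = x j * ∑ B ∈ (U.erase j).powerset, (∏ i ∈ B, x i) * pairSum v y (U.erase j \ B) := by
      rw [Finset.mul_sum]
      refine Finset.sum_congr rfl fun B hB => ?_
      have : j ∉ B := fun h => (Finset.notMem_erase j U) (Finset.mem_powerset.1 hB h)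
      rw [Finset.prod_insert this, Finset.erase_sdiff_comm, ← Finset.sdiff_insert]; ring
    have e2 : ∑ B ∈ (U.erase j).powerset, (∏ i ∈ B, x i) * pairSum v y (U \ B) =
        y j * ∑ B ∈ (U.erase j).powerset, (∏ i ∈ B, x i) * pairSum v y (U.erase j \ B) +
        ∑ B ∈ (U.erase j).powerset, ∑ i ∈ U.erase j \ B,
          v j i * ((∏ i ∈ B, x i) * pairSum v y ((U.erase j).erase i \ B)) := by
      rw [Finset.mul_sum, ← Finset.sum_add_distrib]
      refine Finset.sum_congr rfl fun B hB => ?_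
      have hjB : j ∉ B := fun h => (Finset.notMem_erase j U) (Finset.mem_powerset.1 hB h)
      rw [pairSum_eq hv y (Finset.mem_sdiff.2 ⟨hj, hjB⟩), mul_add, Finset.mul_sum,
        ← Finset.erase_sdiff_comm]
      congr 1
      · ring
      · refine Finset.sum_congr rfl fun i _ => ?_
        rw [Finset.erase_sdiff_comm (U.erase j)]; ring
    rw [e1, e2, sum_powerset_sum_sdiff]
    simp only [← Finset.mul_sum]
    ring

/-- Homogeneity: a singleton carries one factor z and a pair carries two, so every matching of U
carries one per element. -/
lemma pairSum_smul (hv : ∀ i j, v i j = v j i) (z : R) (x : ι → R) (U : Finset ι) :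
    pairSum (fun i j => z ^ 2 * v i j) (fun i => z * x i) U = z ^ U.card * pairSum v x U := by
  induction U using Finset.strongInduction with
  | H U ih =>
    rcases U.eq_empty_or_nonempty with rfl | ⟨j, hj⟩
    · simp
    have hsub : ∀ i, (U.erase j).erase i ⊂ U := fun i => lt_of_le_of_lt (Finset.erase_subset _ _)
        (Finset.erase_ssubset hj)
    have hc := Finset.card_erase_add_one hj
    rw [pairSum_eq (fun a b => by rw [hv]) _ hj, pairSum_eq hv x hj, ih _ (Finset.erase_ssubset hj)]
    rw [mul_add, Finset.mul_sum]
    congr 1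
    · rw [← hc]; ring
    · refine Finset.sum_congr rfl fun i hi => ?_
      rw [ih _ (hsub i), ← hc, ← Finset.card_erase_add_one hi]; ring

lemma map_pairSum {S : Type*} [CommRing S] (f : R →+* S) (hv : ∀ i j, v i j = v j i) (x : ι → R)
    (U : Finset ι) : f (pairSum v x U) = pairSum (fun i j => f (v i j)) (fun i => f (x i)) U := by
  induction U using Finset.strongInduction with
  | H U ih =>
    rcases U.eq_empty_or_nonempty with rfl | ⟨j, hj⟩
    · simp
    have hsub : ∀ i, (U.erase j).erase i ⊂ U := fun i => lt_of_le_of_lt (Finset.erase_subset _ _)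
        (Finset.erase_ssubset hj)
    rw [pairSum_eq (v := fun i j => f (v i j)) (fun a b => by rw [hv]) _ hj, pairSum_eq hv x hj,
      map_add, map_mul, map_sum, ih _ (Finset.erase_ssubset hj)]
    congr 1
    exact Finset.sum_congr rfl fun i hi => by rw [map_mul, ih _ (hsub i)]

/-- Since the sum is affine in each singleton weight, differentiating in the weight of l just
deletes l from U. -/
lemma hasDerivAt_pairSum {𝕜 : Type*} [NontriviallyNormedField 𝕜] [NormedAlgebra 𝕜 ℂ]
    {v : ι → ι → ℂ} (hv : ∀ i j, v i j = v j i) {x : 𝕜 → ι → ℂ} {x' : ι → ℂ} {τ : 𝕜}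
    {U : Finset ι} (hx : ∀ i ∈ U, HasDerivAt (fun z => x z i) (x' i) τ) :
    HasDerivAt (fun z => pairSum v (x z) U)
      (∑ l ∈ U, x' l * pairSum v (x τ) (U.erase l)) τ := by
  induction U using Finset.strongInduction with
  | H U ih =>
    rcases U.eq_empty_or_nonempty with rfl | ⟨j, hj⟩
    · simpa using hasDerivAt_const τ (1 : ℂ)
    have hsub : ∀ i, (U.erase j).erase i ⊂ U := fun i => lt_of_le_of_lt (Finset.erase_subset _ _)
        (Finset.erase_ssubset hj)
    have e : (fun z => pairSum v (x z) U) = fun z => x z j * pairSum v (x z) (U.erase j) +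
      ∑ i ∈ U.erase j, v j i * pairSum v (x z) ((U.erase j).erase i) := by
      ext z; exact pairSum_eq hv _ hj
    rw [e]
    have h1 := (hx j hj).mul (ih _ (Finset.erase_ssubset hj)
      (fun i hi => hx i (Finset.mem_of_mem_erase hi)))
    have h2 := HasDerivAt.fun_sum (u := U.erase j) (x := τ)
      (A := fun i z => v j i * pairSum v (x z) ((U.erase j).erase i)) (A' := fun i => v j i *
        ∑ l ∈ (U.erase j).erase i, x' l * pairSum v (x τ) (((U.erase j).erase i).erase l))
      (fun i _ => (ih _ (hsub i) (fun a ha => hx a ((hsub i).1 ha))).const_mul (v j i))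
    refine (h1.add h2).congr_deriv ?_
    rw [← Finset.add_sum_erase _ _ hj, add_assoc]
    congr 1
    have e3 : ∀ l ∈ U.erase j, x' l * pairSum v (x τ) (U.erase l) =
        x τ j * (x' l * pairSum v (x τ) ((U.erase j).erase l)) +
        ∑ i ∈ (U.erase j).erase l,
          v j i * (x' l * pairSum v (x τ) (((U.erase j).erase i).erase l)) := by
      intro l hl
      have hl' := Finset.mem_erase.1 hl
      rw [pairSum_eq hv _ (Finset.mem_erase.2 ⟨hl'.1.symm, hj⟩ : j ∈ U.erase l),
        Finset.erase_right_comm (a := l), mul_add, Finset.mul_sum]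
      congr 1
      · ring
      · exact Finset.sum_congr rfl fun i _ => by rw [Finset.erase_right_comm (a := l)]; ring
    rw [Finset.sum_congr rfl e3, Finset.sum_add_distrib, Finset.mul_sum]
    congr 1
    simp only [Finset.mul_sum]
    refine Finset.sum_comm' ?_
    intro a b
    simp only [Finset.mem_erase]
    tauto

end pairSum

end

end CalogeroMoser

namespace CalogeroMoser

noncomputable section

/-! ### Determinants as sums over matchings -/

section det

variable {R : Type*} [CommRing R]

-- Multiplying on the right by a block triangular matrix with first column (det M, -adj(M) c) clears
-- the border column. Taking determinants gives the formula times det M, which regularity cancels.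
open Matrix in
lemma det_bordered_of_isRegular {m : Type*} [Fintype m] [DecidableEq m] (x : R) (r c : m → R)
    (M : Matrix m m R) (hM : IsRegular M.det) :
    (fromBlocks (of fun (_ _ : Unit) => x) (of fun _ k => r k) (of fun k _ => c k) M).det =
      x * M.det - r ⬝ᵥ (M.adjugate *ᵥ c) := by
  have h : fromBlocks (of fun (_ _ : Unit) => x) (of fun _ k => r k) (of fun k _ => c k) M *
      fromBlocks (of fun (_ _ : Unit) => M.det) 0 (of fun k _ => -(M.adjugate *ᵥ c) k) 1 =
      fromBlocks (of fun (_ _ : Unit) => x * M.det - r ⬝ᵥ (M.adjugate *ᵥ c))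
        (of fun _ k => r k) 0 M := by
    rw [fromBlocks_multiply]
    congr 1
    · ext i j
      simp [Matrix.mul_apply, dotProduct, sub_eq_add_neg]
    · simp
    · ext i j
      have h2 : M *ᵥ (M.adjugate *ᵥ c) = M.det • c := by
        rw [mulVec_mulVec, mul_adjugate, smul_mulVec, one_mulVec]
      have h3 := congrFun h2 i
      simp only [mulVec, dotProduct, Pi.smul_apply, smul_eq_mul] at h3
      simp only [Matrix.add_apply, Matrix.mul_apply, of_apply, Finset.univ_unique, 
        Finset.sum_const, Finset.card_singleton, one_smul, mul_neg, Finset.sum_neg_distrib,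
        Matrix.zero_apply, mulVec, dotProduct]
      rw [h3]; ring
    · simp
  have h2 := congrArg Matrix.det h
  rw [det_mul, det_fromBlocks_zero₁₂, det_fromBlocks_zero₂₁] at h2
  simp only [det_unique, of_apply, det_one, mul_one] at h2
  exact hM.right h2

-- Regularity is removed by deforming M to X + M over R[X]: its determinant is monic, hence regular,
-- and X = 0 gives back M.
open Matrix Polynomial in
lemma det_bordered {m : Type*} [Fintype m] [DecidableEq m] (x : R) (r c : m → R)
    (M : Matrix m m R) :
    (fromBlocks (of fun (_ _ : Unit) => x) (of fun _ k => r k) (of fun k _ => c k) M).det =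
      x * M.det - r ⬝ᵥ (M.adjugate *ᵥ c) := by
  set N : Matrix m m R[X] := (-M).charmatrix with hN
  have hreg : IsRegular N.det := (Matrix.charpoly_monic (-M)).isRegular
  have hev : N.map (evalRingHom (0 : R)) = M := by
    ext i j
    simp only [hN, map_apply, charmatrix_apply, coe_evalRingHom, Matrix.neg_apply, map_neg,
      sub_neg_eq_add]
    by_cases h : i = j <;> simp [h]
  have h := det_bordered_of_isRegular (C x) (fun k => C (r k)) (fun k => C (c k)) N hreg
  have h2 := congrArg (evalRingHom (0 : R)) h
  rw [RingHom.map_det, map_sub, map_mul, RingHom.map_det, RingHom.mapMatrix_apply,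
    RingHom.mapMatrix_apply, hev] at h2
  convert h2 using 1
  · congr 1
    rw [fromBlocks_map, hev]
    congr 1 <;> ext <;> simp
  · congr 1
    · simp
    · have h3 : (N.adjugate).map (evalRingHom (0 : R)) = M.adjugate := by
        have := RingHom.map_adjugate (evalRingHom (0 : R)) N
        rw [RingHom.mapMatrix_apply, RingHom.mapMatrix_apply, hev] at this
        exact this
      simp only [dotProduct, mulVec, map_sum, map_mul]
      simp only [← h3, map_apply, coe_evalRingHom, eval_C]

variable {ι : Type*} [DecidableEq ι]

/-- The principal minor of `M` with rows and columns in `U`. -/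
def minor (M : Matrix ι ι R) (U : Finset ι) : R :=
  (M.submatrix (fun j : {j // j ∈ U} => j.1) (fun j : {j // j ∈ U} => j.1)).det

lemma symMat_eq_sum_minor {N : ℕ} (k : ℕ) (M : Matrix (Fin N) (Fin N) R) :
    symMat k M = ∑ S ∈ Finset.powersetCard k (Finset.univ : Finset (Fin N)), minor M S := rfl

/-- Separating one element of a finite set. -/
def eraseEquiv {U : Finset ι} {j : ι} (hj : j ∈ U) :
    Unit ⊕ {k // k ∈ U.erase j} ≃ {k // k ∈ U} where
  toFun := Sum.elim (fun _ => ⟨j, hj⟩) fun k => ⟨k.1, Finset.mem_of_mem_erase k.2⟩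
  invFun k := if h : k.1 = j then Sum.inl () else Sum.inr ⟨k.1, Finset.mem_erase.2 ⟨h, k.2⟩⟩
  left_inv := by
    rintro (_ | ⟨k, hk⟩)
    · simp
    · simp [Finset.ne_of_mem_erase hk]
  right_inv := by
    rintro ⟨k, hk⟩
    by_cases h : k = j
    · subst h; simp
    · simp [h]

open Matrix in
lemma minor_eq_det_fromBlocks (M : Matrix ι ι R) {U : Finset ι} {j : ι} (hj : j ∈ U) :
    minor M U = (fromBlocks (of fun (_ _ : Unit) => M j j)
      (of fun _ (k : {k // k ∈ U.erase j}) => M j k) (of fun (k : {k // k ∈ U.erase j}) _ => M k j)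
      (M.submatrix (fun k : {k // k ∈ U.erase j} => k.1)
        (fun k : {k // k ∈ U.erase j} => k.1))).det := by
  rw [minor, ← det_submatrix_equiv_self (eraseEquiv hj)]
  congr 1
  ext a b
  rcases a with a | a <;> rcases b with b | b <;> rfl

open Matrix in
lemma adjugate_submatrix_diag (M : Matrix ι ι R) {U : Finset ι} {i : ι} (hi : i ∈ U) :
    (M.submatrix (fun k : {k // k ∈ U} => k.1) (fun k => k.1)).adjugate ⟨i, hi⟩ ⟨i, hi⟩ =
      minor M (U.erase i) := by
  rw [adjugate_apply, ← det_submatrix_equiv_self (eraseEquiv hi), minor]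
  have : ((M.submatrix (fun k : {k // k ∈ U} => k.1) (fun k => k.1)).updateRow ⟨i, hi⟩
      (Pi.single ⟨i, hi⟩ 1)).submatrix (eraseEquiv hi) (eraseEquiv hi) =
      fromBlocks (of fun (_ _ : Unit) => (1 : R)) 0 (of fun (k : {k // k ∈ U.erase i}) _ => M k i)
      (M.submatrix (fun k : {k // k ∈ U.erase i} => k.1)
        (fun k : {k // k ∈ U.erase i} => k.1)) := by
    ext a b
    rcases a with a | ⟨a, ha⟩ <;> rcases b with b | ⟨b, hb⟩
    · simp [eraseEquiv]
    · simp [eraseEquiv, Subtype.ext_iff, Finset.ne_of_mem_erase hb]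
    · simp [eraseEquiv, updateRow_apply, Subtype.ext_iff, Finset.ne_of_mem_erase ha]
    · simp [eraseEquiv, updateRow_apply, Subtype.ext_iff, Finset.ne_of_mem_erase ha]
  rw [this, det_fromBlocks_zero₁₂]
  simp

open Matrix in
/-- If the off-diagonal entries of a matrix satisfy the addition formula
`a i j * a j k = (c i j - c k j) * a i k` of the functions `1 / sinh`, then its principal minors are
sums over matchings. -/
lemma minor_eq_pairSum {a : ι → ι → R} (c : ι → ι → R)
    (hac : ∀ i j k, i ≠ j → j ≠ k → i ≠ k → a i j * a j k = (c i j - c k j) * a i k)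
    (x : ι → R) (U : Finset ι) :
    minor (of fun i j => if i = j then x i else a i j) U =
      pairSum (fun i j => -(a i j * a j i)) x U := by
  set M : Matrix ι ι R := of fun i j => if i = j then x i else a i j with hM
  induction U using Finset.strongInduction with
  | H U ih =>
    rcases U.eq_empty_or_nonempty with rfl | ⟨j, hj⟩
    · simp [minor]
    have hsub : ∀ i, (U.erase j).erase i ⊂ U := fun i => lt_of_le_of_lt (Finset.erase_subset _ _)
        (Finset.erase_ssubset hj)
    rw [pairSum_eq (fun a b => by ring) x hj, minor_eq_det_fromBlocks M hj, det_bordered,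
      ← ih _ (Finset.erase_ssubset hj)]
    set N := M.submatrix (fun k : {k // k ∈ U.erase j} => k.1)
      (fun k : {k // k ∈ U.erase j} => k.1) with hN
    set D : Matrix {k // k ∈ U.erase j} {k // k ∈ U.erase j} R := diagonal fun k => c k.1 j with hD
    -- The key use of the addition formula: off the diagonal, the rank-one product of border column
    -- and border row is a commutator with the diagonal matrix D.
    have hcomm : (of fun (i k : {k // k ∈ U.erase j}) => M i j * M j k) =
        D * N - N * D + diagonal (fun i : {k // k ∈ U.erase j} => a i j * a j i) := by
      ext i k
      have hi := Finset.ne_of_mem_erase i.2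
      have hk := Finset.ne_of_mem_erase k.2
      by_cases hik : i = k
      · subst hik
        simp [hM, hN, hD, hi, hi.symm, diagonal_mul, mul_diagonal]; ring
      · have hik' : i.1 ≠ k.1 := fun h => hik (Subtype.ext h)
        simp [hM, hN, hD, hi, hk.symm, hik, hik', diagonal_mul, mul_diagonal]
        rw [hac i j k hi hk.symm hik']; ring
    have htr : (fun k : {k // k ∈ U.erase j} => M j k) ⬝ᵥ (N.adjugate *ᵥ fun k => M k j) =
        trace (N.adjugate * of fun (i k : {k // k ∈ U.erase j}) => M i j * M j k) := by
      simp only [dotProduct, mulVec, trace, diag, Matrix.mul_apply, of_apply, Finset.mul_sum]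
      exact Finset.sum_congr rfl fun i _ => Finset.sum_congr rfl fun k _ => by ring
    -- The adjugate commutes with N, so the commutator has trace zero against it. Only the diagonal
    -- cofactors survive, and these are the smaller principal minors in the matching recursion.
    have h0 : trace (N.adjugate * (D * N - N * D)) = 0 := by
      rw [Matrix.mul_sub, trace_sub, ← Matrix.mul_assoc, ← Matrix.mul_assoc, adjugate_mul,
        Matrix.trace_mul_comm, ← Matrix.mul_assoc, mul_adjugate]
      simp
    rw [htr, hcomm, Matrix.mul_add, trace_add, h0, zero_add, sub_eq_add_neg]
    congr 1
    · simp [hM, minor, hN]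
    · simp only [trace, diag, mul_diagonal]
      rw [← Finset.sum_attach (U.erase j), ← Finset.sum_neg_distrib]
      refine Finset.sum_congr rfl fun i _ => ?_
      rw [hN, adjugate_submatrix_diag M i.2, ih _ (hsub i)]
      ring

open Matrix in
lemma det_eq_minor_univ [Fintype ι] (M : Matrix ι ι R) : M.det = minor M Finset.univ := by
  rw [minor, ← det_submatrix_equiv_self (Equiv.subtypeUnivEquiv (fun x => Finset.mem_univ x))]
  rfl

end det

end

end CalogeroMoser

namespace CalogeroMoser

noncomputable section

/-! ### Symmetric functions of matrices, and matrices related by an intertwiner. -/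

section symMat

variable {R : Type*} [CommRing R] {N : ℕ}

/-- The matrix with diagonal entries `x` and off-diagonal entries `a`. -/
def diagOff {ι : Type*} [DecidableEq ι] (x : ι → R) (a : ι → ι → R) : Matrix ι ι R :=
  Matrix.of fun i j => if i = j then x i else a i j

lemma symMat_eq_sum_pairSum {a : Fin N → Fin N → R} (c : Fin N → Fin N → R)
    (hac : ∀ i j k, i ≠ j → j ≠ k → i ≠ k → a i j * a j k = (c i j - c k j) * a i k)
    (x : Fin N → R) (k : ℕ) :
    symMat k (diagOff x a) = ∑ U ∈ Finset.powersetCard k (Finset.univ : Finset (Fin N)),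
      pairSum (fun i j => -(a i j * a j i)) x U := by
  rw [symMat_eq_sum_minor]
  exact Finset.sum_congr rfl fun U _ => minor_eq_pairSum c hac x U

lemma symMat_eq_zero {k : ℕ} (hk : N < k) (M : Matrix (Fin N) (Fin N) R) : symMat k M = 0 := by
  rw [symMat, Finset.powersetCard_eq_empty.2 (by simpa using hk), Finset.sum_empty]

/-- The matrix 1 + zM is again of the form covered by `minor_eq_pairSum`, with a and c multiplied by
z. Splitting the diagonal as 1 + z x by `pairSum_add` and using homogeneity collects the powers of
z. -/
lemma det_one_add_smul_eq_sum_symMat {a : Fin N → Fin N → R} (c : Fin N → Fin N → R)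
    (hac : ∀ i j k, i ≠ j → j ≠ k → i ≠ k → a i j * a j k = (c i j - c k j) * a i k)
    (x : Fin N → R) (z : R) :
    (1 + z • diagOff x a).det = ∑ k ∈ Finset.range (N + 1), z ^ k * symMat k (diagOff x a) := by
  have h1 : 1 + z • diagOff x a =
      Matrix.of fun i j => if i = j then 1 + z * x i else z * a i j := by
    ext i j
    by_cases h : i = j
    · subst h; simp [diagOff]
    · simp [diagOff, h]
  rw [h1, det_eq_minor_univ, minor_eq_pairSum (fun i j => z * c i j)
    (fun i j k hij hjk hik => by linear_combination z ^ 2 * hac i j k hij hjk hik)]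
  have h2 : (fun i j => -(z * a i j * (z * a j i))) =
      fun i j => z ^ 2 * (-(a i j * a j i)) := by ext i j; ring
  have hs : ∀ i j, -(a i j * a j i) = -(a j i * a i j) := fun i j => by ring
  rw [h2, pairSum_add (v := fun i j => z ^ 2 * (-(a i j * a j i)))
    (fun i j => by rw [hs]) (fun _ => 1) (fun i => z * x i)]
  have h3 : ∑ B ∈ (Finset.univ : Finset (Fin N)).powerset, (∏ _i ∈ B, (1 : R)) *
      pairSum (fun i j => z ^ 2 * (-(a i j * a j i))) (fun i => z * x i) (Finset.univ \ B) =
      ∑ B ∈ (Finset.univ : Finset (Fin N)).powerset,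
        z ^ B.card * pairSum (fun i j => -(a i j * a j i)) x B := by
    refine Finset.sum_nbij' (fun B => Finset.univ \ B) (fun B => Finset.univ \ B) ?_ ?_ ?_ ?_ ?_
    · simp
    · simp
    · simp
    · simp
    · intro B _
      rw [Finset.prod_const_one, one_mul, pairSum_smul hs]
  rw [h3, Finset.sum_powerset, Finset.card_univ, Fintype.card_fin]
  refine Finset.sum_congr rfl fun k _ => ?_
  rw [symMat_eq_sum_pairSum c hac, Finset.mul_sum]
  refine Finset.sum_congr rfl fun U hU => ?_
  rw [(Finset.mem_powersetCard.1 hU).2]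

open Matrix in
/-- If `P * T = T * Q` with `T` of full rank, then the spectrum of `P` consists of that of `Q` and
of the difference of the traces. -/
lemma det_one_add_smul_of_intertwining {K : Type*} [Field K] {n : ℕ}
    {P : Matrix (Fin (n + 1)) (Fin (n + 1)) K} {Q : Matrix (Fin n) (Fin n) K}
    {T : Matrix (Fin (n + 1)) (Fin n) K} (h : P * T = T * Q)
    (hT : IsUnit (T.submatrix Fin.castSucc id).det) {u : K} (htr : P.trace = Q.trace + u) (z : K) :
    (1 + z • P).det = (1 + z * u) * (1 + z • Q).det := by
  set e : Fin n ⊕ Fin 1 ≃ Fin (n + 1) := finSumFinEquiv with he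
  set P' := P.submatrix e e with hP'
  set T' := T.submatrix e id with hT'
  have h' : P' * T' = T' * Q := by
    rw [hP', hT', submatrix_mul_equiv, h]
    ext i j; simp [Matrix.mul_apply]
  have hrow1 : T'.toRows₁ = T.submatrix Fin.castSucc id := by
    ext i j; rfl
  set R1 := T'.toRows₁ with hR1
  set R2 := T'.toRows₂ with hR2
  rw [← hrow1] at hT
  set A := P'.toBlocks₁₁
  set B := P'.toBlocks₁₂
  set C := P'.toBlocks₂₁
  set D := P'.toBlocks₂₂
  have hP2 : P' = fromBlocks A B C D := (fromBlocks_toBlocks P').symm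
  have hT2 : T' = fromRows R1 R2 := (fromRows_toRows T').symm
  have hA : A * R1 + B * R2 = R1 * Q ∧ C * R1 + D * R2 = R2 * Q := by
    rw [hP2, hT2, fromBlocks_mul_fromRows, fromRows_mul] at h'
    exact fromRows_inj h'
  -- T is completed to an invertible square matrix by one unit column; in this basis P is block
  -- upper triangular with diagonal blocks Q and a 1 × 1 block c.
  set S := fromBlocks R1 0 R2 (1 : Matrix (Fin 1) (Fin 1) K) with hS
  have hSdet : IsUnit S.det := by
    rw [hS, det_fromBlocks_zero₁₂, det_one, mul_one]; exact hT
  set b := R1⁻¹ * B with hb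
  set c := D - R2 * b with hc
  have hPS : P' * S = S * fromBlocks Q b 0 c := by
    rw [hP2, hS, fromBlocks_multiply, fromBlocks_multiply]
    congr 1
    · simpa using hA.1
    · simp [hb, mul_nonsing_inv_cancel_left _ _ hT]
    · simpa using hA.2
    · simp [hc]
  -- The remaining eigenvalue is known only through the trace.
  have htrc : c.trace = u := by
    have h1 : P'.trace = (fromBlocks Q b 0 c).trace := by
      have : P' = S * fromBlocks Q b 0 c * S⁻¹ := by
        rw [← hPS, mul_nonsing_inv_cancel_right _ _ hSdet]
      rw [this, trace_mul_comm, nonsing_inv_mul_cancel_left _ _ hSdet]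
    have h2 : P'.trace = P.trace := by
      simp only [trace, diag, hP', submatrix_apply]
      exact Equiv.sum_comp e (fun i => P i i)
    rw [h2, htr] at h1
    have h3 : (fromBlocks Q b 0 c).trace = Q.trace + c.trace := by
      simp [trace, Fintype.sum_sum_type]
    rw [h3] at h1
    exact (add_left_cancel h1).symm
  have hdet : (1 + z • P).det = (1 + z • P').det := by
    rw [← det_submatrix_equiv_self e (1 + z • P)]
    congr 1
    ext i j
    simp [hP', one_apply]
  have hfin : (1 + z • P') * S = S * (1 + z • fromBlocks Q b 0 c) := by
    rw [Matrix.add_mul, Matrix.mul_add, Matrix.smul_mul, hPS, Matrix.mul_smul]; simp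
  have h3 := congrArg det hfin
  rw [det_mul, det_mul, mul_comm] at h3
  have h4 := hSdet.mul_left_cancel h3
  have h5 : (1 : Matrix (Fin n ⊕ Fin 1) (Fin n ⊕ Fin 1) K) + z • fromBlocks Q b 0 c =
      fromBlocks (1 + z • Q) (z • b) 0 (1 + z • c) := by
    rw [← fromBlocks_one, fromBlocks_smul, fromBlocks_add]; simp
  rw [hdet, h4, h5, det_fromBlocks_zero₂₁, mul_comm]
  congr 1
  rw [← htrc]
  simp [trace]

end symMat

/-! ### The hyperbolic Lax matrices and the kernel identity. -/

section hyperbolic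

open Complex

lemma sinh_mul_inv_aux {x y : ℂ} (hx : sinh x ≠ 0) (hy : sinh y ≠ 0) (hxy : sinh (x + y) ≠ 0) :
    (1 / sinh x) * (1 / sinh y) = (coth x + coth y) * (1 / sinh (x + y)) := by
  rw [coth, coth]
  field_simp
  rw [sinh_add]; ring

lemma coth_neg (x : ℂ) : coth (-x) = -coth x := by
  rw [coth, coth, cosh_neg, sinh_neg, div_neg]

/-- The off-diagonal entries of the Lax matrix. -/
def laxOff {N : ℕ} (lam : ℂ) (t : Fin N → ℂ) (j k : Fin N) : ℂ := I * lam / sinh (t j - t k)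

/-- This is the addition formula for 1/sinh, in the shape required by `minor_eq_pairSum`, with iλ
coth as the auxiliary function c. -/
lemma laxOff_mul_laxOff {N : ℕ} (lam : ℂ) {t : Fin N → ℂ}
    (ht : ∀ j k, j ≠ k → sinh (t j - t k) ≠ 0) (i j k : Fin N) (hij : i ≠ j) (hjk : j ≠ k)
    (hik : i ≠ k) :
    laxOff lam t i j * laxOff lam t j k =
      (I * lam * coth (t i - t j) - I * lam * coth (t k - t j)) * laxOff lam t i k := by
  have h := sinh_mul_inv_aux (ht i j hij) (ht j k hjk) (by simpa using ht i k hik)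
  rw [sub_add_sub_cancel] at h
  rw [← neg_sub (t j) (t k), coth_neg]
  simp only [laxOff]
  linear_combination (I * lam) ^ 2 * h

/-- The pair weights of the normal-ordered operators. -/
def pairW {N : ℕ} (lam : ℂ) (t : Fin N → ℂ) (j k : Fin N) : ℂ := -lam ^ 2 / sinh (t j - t k) ^ 2

lemma pairW_symm {N : ℕ} (lam : ℂ) (t : Fin N → ℂ) (j k : Fin N) :
    pairW lam t j k = pairW lam t k j := by
  rw [pairW, pairW, ← neg_sub (t j) (t k), sinh_neg, neg_sq]

lemma neg_laxOff_mul {N : ℕ} (lam : ℂ) (t : Fin N → ℂ) (j k : Fin N) :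
    -(laxOff lam t j k * laxOff lam t k j) = pairW lam t j k := by
  rw [pairW, laxOff, laxOff, ← neg_sub (t j) (t k), sinh_neg, div_mul_div_comm, mul_neg, div_neg,
    neg_neg, mul_mul_mul_comm, I_mul_I]
  ring

/-- The diagonal entries `w_j` of `𝓔`. -/
def diagW {N : ℕ} (lam : ℂ) (t : Fin N → ℂ) (j : Fin N) : ℂ :=
  -I * lam * ∑ k ∈ Finset.univ.erase j, coth (t j - t k)

lemma symMat_diagOff_laxOff {N : ℕ} (lam : ℂ) {t : Fin N → ℂ}
    (ht : ∀ j k, j ≠ k → sinh (t j - t k) ≠ 0) (x : Fin N → ℂ) (k : ℕ) :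
    symMat k (diagOff x (laxOff lam t)) =
      ∑ U ∈ Finset.powersetCard k (Finset.univ : Finset (Fin N)), pairSum (pairW lam t) x U := by
  rw [symMat_eq_sum_pairSum (fun i j => I * lam * coth (t i - t j)) (laxOff_mul_laxOff lam ht)]
  simp only [neg_laxOff_mul]

/-- Up to row and column factors this is the Cauchy matrix 1/(x_j - y_k) with x = e^{2t}, y =
-e^{2s}. A null vector, cleared of denominators, gives a polynomial of degree below n with the n
distinct roots x_j. It vanishes, and evaluating it at y_k isolates the k-th coefficient. -/
lemma exists_isUnit_cauchy {n : ℕ} {t s : Fin n → ℂ}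
    (ht : ∀ j k, j ≠ k → sinh (t j - t k) ≠ 0) (hs : ∀ j k, j ≠ k → sinh (s j - s k) ≠ 0)
    (hts : ∀ j k, cosh (t j - s k) ≠ 0) :
    IsUnit (Matrix.of fun j k => 1 / cosh (t j - s k)).det := by
  set x : Fin n → ℂ := fun j => exp (2 * t j) with hx
  set y : Fin n → ℂ := fun k => -exp (2 * s k) with hy
  have hcosh : ∀ j k, x j - y k = 2 * exp (t j) * exp (s k) * cosh (t j - s k) := by
    intro j k
    have h1 : exp (2 * t j) = exp (t j) ^ 2 := by rw [← exp_nat_mul]; norm_num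
    have h2 : exp (2 * s k) = exp (s k) ^ 2 := by rw [← exp_nat_mul]; norm_num
    simp only [hx, hy, cosh, exp_sub, h1, h2, neg_sub]
    field_simp [exp_ne_zero]; ring
  have hsinh : ∀ a b : ℂ, exp (2 * a) - exp (2 * b) = 2 * exp a * exp b * sinh (a - b) := by
    intro a b
    have h1 : exp (2 * a) = exp a ^ 2 := by rw [← exp_nat_mul]; norm_num
    have h2 : exp (2 * b) = exp b ^ 2 := by rw [← exp_nat_mul]; norm_num
    simp only [sinh, exp_sub, h1, h2, neg_sub]
    field_simp [exp_ne_zero]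
  have hxinj : Function.Injective x := by
    intro j k h
    by_contra hjk
    have := hsinh (t j) (t k)
    rw [sub_eq_zero.2 h] at this
    simp [exp_ne_zero, ht j k hjk] at this
  have hyinj : ∀ j k, j ≠ k → y k - y j ≠ 0 := by
    intro j k hjk
    have h1 : y k - y j = exp (2 * s j) - exp (2 * s k) := by simp only [hy]; ring
    rw [h1, hsinh]
    simp [exp_ne_zero, hs j k hjk]
  rw [← Matrix.isUnit_iff_isUnit_det, ← Matrix.mulVec_injective_iff_isUnit]
  refine (injective_iff_map_eq_zero (Matrix.mulVecLin _)).2 ?_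
  intro f hf
  have hf' : ∀ j, ∑ k, 1 / cosh (t j - s k) * f k = 0 := fun j => congrFun hf j
  set g : Fin n → ℂ := fun k => f k * exp (s k) with hg
  open Polynomial in
  set p : ℂ[X] := ∑ k, C (g k) * ∏ l ∈ Finset.univ.erase k, (X - C (y l)) with hp
  have hxy : ∀ j k, x j - y k ≠ 0 := fun j k => by
    rw [hcosh]; simp [exp_ne_zero, hts]
  have hroot : ∀ j, p.eval (x j) = 0 := by
    intro j
    have h1 : p.eval (x j) = (∏ l, (x j - y l)) * ∑ k, g k / (x j - y k) := by
      rw [hp, Polynomial.eval_finsetSum, Finset.mul_sum]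
      refine Finset.sum_congr rfl fun k _ => ?_
      rw [← Finset.mul_prod_erase _ _ (Finset.mem_univ k), Polynomial.eval_mul, Polynomial.eval_C,
        Polynomial.eval_prod]
      simp only [Polynomial.eval_sub, Polynomial.eval_X, Polynomial.eval_C]
      have := hxy j k
      field_simp
    have h2 : ∑ k, g k / (x j - y k) = 1 / (2 * exp (t j)) * ∑ k, 1 / cosh (t j - s k) * f k := by
      rw [Finset.mul_sum]
      refine Finset.sum_congr rfl fun k _ => ?_
      have := hts j k
      rw [hcosh, hg]
      field_simp [exp_ne_zero]
    rw [h1, h2, hf', mul_zero, mul_zero]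
  have hp0 : p = 0 := by
    -- The degree bound n - 1 is below n only for positive n.
    by_cases hn : n = 0
    · subst hn; simp [hp]
    refine Polynomial.eq_zero_of_natDegree_lt_card_of_eval_eq_zero p hxinj hroot ?_
    rw [Fintype.card_fin]
    refine lt_of_le_of_lt (Polynomial.natDegree_sum_le_of_forall_le (n := n - 1) _ _ ?_) (by omega)
    intro k _
    refine (Polynomial.natDegree_C_mul_le _ _).trans ?_
    rw [Polynomial.natDegree_prod_of_monic _ _ (fun l _ => Polynomial.monic_X_sub_C _)]
    simp
  ext k
  have h3 : p.eval (y k) = g k * ∏ l ∈ Finset.univ.erase k, (y k - y l) := by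
    rw [hp, Polynomial.eval_finsetSum, Finset.sum_eq_single k]
    · simp [Polynomial.eval_prod]
    · intro l _ hl
      rw [Polynomial.eval_mul, Polynomial.eval_prod,
        Finset.prod_eq_zero (Finset.mem_erase.2 ⟨hl.symm, Finset.mem_univ k⟩) (by simp), mul_zero]
    · simp
  rw [hp0, Polynomial.eval_zero] at h3
  have h4 : ∏ l ∈ Finset.univ.erase k, (y k - y l) ≠ 0 :=
    Finset.prod_ne_zero_iff.2 fun l hl => hyinj l k (Finset.ne_of_mem_erase hl)
  have h5 : g k = 0 := by
    rcases mul_eq_zero.1 h3.symm with h | h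
    · exact h
    · exact absurd h h4
  simpa [hg, exp_ne_zero] using h5

lemma tanh_add_coth_mul {x y : ℂ} (hx : sinh x ≠ 0) (hy : cosh y ≠ 0) (hxy : cosh (x + y) ≠ 0) :
    (1 / sinh x) * (1 / cosh y) = (coth x + tanh y) * (1 / cosh (x + y)) := by
  rw [coth, tanh_eq_sinh_div_cosh]
  field_simp
  rw [cosh_add]; ring

/-- The Lax matrix in the variables `t`, evaluated at the logarithmic derivatives of the kernel. -/
def kernelLaxT {n : ℕ} (lam u : ℂ) (t : Fin (n + 1) → ℂ) (s : Fin n → ℂ) :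
    Matrix (Fin (n + 1)) (Fin (n + 1)) ℂ :=
  diagOff (fun j => (u + I * lam * ∑ k, tanh (t j - s k)) + diagW lam t j) (laxOff lam t)

/-- The Lax matrix in the variables `s`, evaluated at the logarithmic derivatives of the kernel. -/
def kernelLaxS {n : ℕ} (lam u : ℂ) (t : Fin (n + 1) → ℂ) (s : Fin n → ℂ) :
    Matrix (Fin n) (Fin n) ℂ :=
  diagOff (fun k => (u + I * lam * ∑ j, tanh (t j - s k)) + -diagW lam s k) (laxOff lam s)

lemma sum_diagW {N : ℕ} (lam : ℂ) (t : Fin N → ℂ) : ∑ j, diagW lam t j = 0 := by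
  have h : ∑ j, ∑ k ∈ Finset.univ.erase j, coth (t j - t k) = 0 := by
    have h1 : ∑ j, ∑ k ∈ Finset.univ.erase j, coth (t j - t k) =
        ∑ k, ∑ j ∈ Finset.univ.erase k, coth (t j - t k) := by
      refine Finset.sum_comm' ?_
      intro a b; simp [eq_comm]
    have h2 : ∑ k, ∑ j ∈ Finset.univ.erase k, coth (t j - t k) =
        -∑ k, ∑ j ∈ Finset.univ.erase k, coth (t k - t j) := by
      rw [← Finset.sum_neg_distrib]
      refine Finset.sum_congr rfl fun k _ => ?_
      rw [← Finset.sum_neg_distrib]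
      refine Finset.sum_congr rfl fun j _ => ?_
      rw [← coth_neg, neg_sub]
    exact self_eq_neg.1 (h1.trans h2)
  simp only [diagW, ← Finset.mul_sum, h, mul_zero]

/-- By the addition formula for (1/sinh)(1/cosh), every entry of either product is a multiple of
1/cosh(t_j - s_k). The coth sums cancel the diagonal terms w_j(t) and -w_k(s), and both sides are
left with u plus iλ times the sum of tanh over row j and column k, the common entry being counted
once. -/
lemma kernelLax_intertwining {n : ℕ} (lam u : ℂ) {t : Fin (n + 1) → ℂ} {s : Fin n → ℂ}
    (ht : ∀ j k, j ≠ k → sinh (t j - t k) ≠ 0) (hs : ∀ j k, j ≠ k → sinh (s j - s k) ≠ 0)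
    (hts : ∀ j k, cosh (t j - s k) ≠ 0) :
    kernelLaxT lam u t s * Matrix.of (fun j k => 1 / cosh (t j - s k)) =
      Matrix.of (fun j k => 1 / cosh (t j - s k)) * kernelLaxS lam u t s := by
  ext j k
  simp only [Matrix.mul_apply, Matrix.of_apply, kernelLaxT, kernelLaxS, diagOff]
  rw [← Finset.add_sum_erase _ _ (Finset.mem_univ j),
    ← Finset.add_sum_erase Finset.univ (fun l => 1 / cosh (t j - s l) * if l = k then
      u + I * lam * ∑ j, tanh (t j - s l) + -diagW lam s l else laxOff lam s l k)
      (Finset.mem_univ k)]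
  simp only [if_true]
  have e1 : ∑ l ∈ Finset.univ.erase j,
      (if j = l then u + I * lam * ∑ k, tanh (t j - s k) + diagW lam t j else laxOff lam t j l) *
        (1 / cosh (t l - s k)) = ∑ l ∈ Finset.univ.erase j,
        I * lam * ((coth (t j - t l) + tanh (t l - s k)) * (1 / cosh (t j - s k))) := by
    refine Finset.sum_congr rfl fun l hl => ?_
    have hl' := (Finset.ne_of_mem_erase hl).symm
    have h := tanh_add_coth_mul (ht j l hl') (hts l k) (by simpa using hts j k)
    rw [sub_add_sub_cancel] at h
    rw [if_neg hl', ← h, laxOff]; ring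
  have e2 : ∑ l ∈ Finset.univ.erase k,
      1 / cosh (t j - s l) * (if l = k then
        u + I * lam * ∑ j, tanh (t j - s l) + -diagW lam s l else laxOff lam s l k) =
        ∑ l ∈ Finset.univ.erase k,
        I * lam * ((-coth (s k - s l) + tanh (t j - s l)) * (1 / cosh (t j - s k))) := by
    refine Finset.sum_congr rfl fun l hl => ?_
    have hl' := (Finset.ne_of_mem_erase hl)
    have h := tanh_add_coth_mul (hs l k hl') (hts j l)
      (by rw [add_comm, sub_add_sub_cancel]; exact hts j k)
    rw [add_comm (s l - s k), sub_add_sub_cancel] at h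
    rw [if_neg hl', ← coth_neg, neg_sub, ← h, laxOff]; ring
  rw [e1, e2, ← Finset.mul_sum, ← Finset.mul_sum, ← Finset.sum_mul, ← Finset.sum_mul,
    Finset.sum_add_distrib, Finset.sum_add_distrib, Finset.sum_neg_distrib, diagW, diagW,
    ← Finset.add_sum_erase Finset.univ (fun l => tanh (t j - s l)) (Finset.mem_univ k),
    ← Finset.add_sum_erase Finset.univ (fun l => tanh (t l - s k)) (Finset.mem_univ j)]
  ring

/-- In the traces the w's sum to zero because coth is odd, and the double sums of tanh agree. Only
the multiples (n + 1)u and nu differ, so the additional eigenvalue is u. -/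
lemma det_one_add_smul_kernelLax {n : ℕ} (lam u : ℂ) {t : Fin (n + 1) → ℂ} {s : Fin n → ℂ}
    (ht : ∀ j k, j ≠ k → sinh (t j - t k) ≠ 0) (hs : ∀ j k, j ≠ k → sinh (s j - s k) ≠ 0)
    (hts : ∀ j k, cosh (t j - s k) ≠ 0) (z : ℂ) :
    (1 + z • kernelLaxT lam u t s).det = (1 + z * u) * (1 + z • kernelLaxS lam u t s).det := by
  refine det_one_add_smul_of_intertwining (kernelLax_intertwining lam u ht hs hts) ?_ ?_ z
  · refine exists_isUnit_cauchy (t := fun j => t j.castSucc) (s := s) ?_ hs (fun j k => hts _ _)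
    exact fun j k hjk => ht _ _ (fun h => hjk (Fin.castSucc_injective n h))
  · have h1 := sum_diagW lam t
    have h2 := sum_diagW lam s
    simp only [Matrix.trace, Matrix.diag, kernelLaxT, kernelLaxS, diagOff, Matrix.of_apply, if_true,
      Finset.sum_add_distrib, Finset.sum_neg_distrib, h1, h2, ← Finset.mul_sum]
    rw [Finset.sum_comm]
    simp
    ring

/-- The kernel identity for the symmetric functions of the Lax matrices. -/
lemma symMat_kernelLax {n : ℕ} (lam u : ℂ) {t : Fin (n + 1) → ℂ} {s : Fin n → ℂ}
    (ht : ∀ j k, j ≠ k → sinh (t j - t k) ≠ 0) (hs : ∀ j k, j ≠ k → sinh (s j - s k) ≠ 0)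
    (hts : ∀ j k, cosh (t j - s k) ≠ 0) (k : ℕ) :
    symMat (k + 1) (kernelLaxT lam u t s) =
      symMat (k + 1) (kernelLaxS lam u t s) + u * symMat k (kernelLaxS lam u t s) := by
  open Polynomial in
  have hpoly : ∑ k ∈ Finset.range (n + 2), C (symMat k (kernelLaxT lam u t s)) * X ^ k =
      (1 + C u * X) * ∑ k ∈ Finset.range (n + 1), C (symMat k (kernelLaxS lam u t s)) * X ^ k := by
    refine Polynomial.funext fun z => ?_
    have h := det_one_add_smul_kernelLax lam u ht hs hts z
    rw [kernelLaxT, kernelLaxS, det_one_add_smul_eq_sum_symMat _ (laxOff_mul_laxOff lam ht),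
      det_one_add_smul_eq_sum_symMat _ (laxOff_mul_laxOff lam hs)] at h
    simp only [eval_mul, eval_finsetSum, eval_add, eval_one, eval_C, eval_X, eval_pow, kernelLaxT,
      kernelLaxS]
    rw [Finset.sum_congr rfl fun k _ => mul_comm _ _, h, mul_comm z u]
    congr 1
    exact Finset.sum_congr rfl fun k _ => mul_comm _ _
  have hc : ∀ (m : ℕ) (M : Matrix (Fin m) (Fin m) ℂ) (i : ℕ),
      (∑ k ∈ Finset.range (m + 1), Polynomial.C (symMat k M) * Polynomial.X ^ k).coeff i =
        symMat i M := by
    intro m M i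
    simp only [Polynomial.finsetSum_coeff, Polynomial.coeff_C_mul_X_pow]
    rw [Finset.sum_ite_eq]
    split_ifs with h
    · rfl
    · rw [symMat_eq_zero (by simpa using h)]
  have h := congrArg (fun p => p.coeff (k + 1)) hpoly
  simp only [add_mul, one_mul, Polynomial.coeff_add, mul_assoc, Polynomial.coeff_C_mul,
    Polynomial.coeff_X_mul, hc] at h
  exact h

end hyperbolic

end

end CalogeroMoser

namespace CalogeroMoser

noncomputable section

open Filter Topology

/-! ### Normal-ordered operators acting on derivative families. -/

section families

variable {𝕜 : Type} [NontriviallyNormedField 𝕜] {N : ℕ}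

/-- A family `g` of functions indexed by sets of variables such that, on `D`, the function
`c * g (insert j S)` is the `j`-th partial derivative of `g S`. -/
def DerivFamily [NormedAlgebra 𝕜 ℂ] (D : Set (Fin N → 𝕜)) (c : ℂ)
    (g : Finset (Fin N) → (Fin N → 𝕜) → ℂ) : Prop :=
  ∀ S j, j ∉ S → ∀ t ∈ D,
    HasDerivAt (fun z => g S (Function.update t j z)) (c * g (insert j S) t) (t j)

lemma eventually_update_mem {D : Set (Fin N → 𝕜)} (hD : IsOpen D) {t : Fin N → 𝕜} (ht : t ∈ D)
    (j : Fin N) : ∀ᶠ z in 𝓝 (t j), Function.update t j z ∈ D := by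
  have hc : Continuous fun z : 𝕜 => Function.update t j z := continuous_const.update j continuous_id
  refine hc.continuousAt.eventually_mem (hD.mem_nhds ?_)
  simpa using ht

/-- Induction on the list of variables still to be differentiated. Openness of D matters because an
outer derivative needs the inner ones on a neighbourhood. -/
lemma DerivFamily.multiD_eq [NormedAlgebra 𝕜 ℂ] {D : Set (Fin N → 𝕜)} {c : ℂ}
    {g : Finset (Fin N) → (Fin N → 𝕜) → ℂ} (hg : DerivFamily D c g) (hD : IsOpen D)
    {f : (Fin N → 𝕜) → ℂ} (hf : ∀ t ∈ D, f t = g ∅ t) {m : Fin N →₀ ℕ} {B : Finset (Fin N)}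
    (hm : ∀ j, m j = if j ∈ B then 1 else 0) {t : Fin N → 𝕜} (ht : t ∈ D) :
    multiD m f t = c ^ B.card * g B t := by
  have key : ∀ L : List (Fin N), L.Nodup → ∀ t ∈ D,
      L.foldr (fun j h => (partialD j)^[m j] h) f t =
        c ^ (B ∩ L.toFinset).card * g (B ∩ L.toFinset) t := by
    intro L
    induction L with
    | nil => intro _ t ht; simp [hf t ht]
    | cons j L ih =>
      intro hL t ht
      have hL' := List.nodup_cons.1 hL
      have hjL : j ∉ L.toFinset := by simpa using hL'.1
      rw [List.foldr_cons, hm]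
      by_cases hj : j ∈ B
      · rw [if_pos hj, Function.iterate_one, partialD]
        have hev : (fun z : 𝕜 => L.foldr (fun j h => (partialD j)^[m j] h) f
            (Function.update t j z)) =ᶠ[𝓝 (t j)] fun z => c ^ (B ∩ L.toFinset).card *
              g (B ∩ L.toFinset) (Function.update t j z) := by
          filter_upwards [eventually_update_mem hD ht j] with z hz using ih hL'.2 _ hz
        have hnot : j ∉ B ∩ L.toFinset := fun h => hjL (Finset.mem_inter.1 h).2
        rw [hev.deriv_eq, ((hg _ j hnot t ht).const_mul _).deriv, List.toFinset_cons,
          Finset.inter_insert_of_mem hj, Finset.card_insert_of_notMem hnot]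
        ring
      · rw [if_neg hj, Function.iterate_zero, id, ih hL'.2 t ht, List.toFinset_cons,
          Finset.inter_insert_of_notMem hj]
  have h := key (List.finRange N) (List.nodup_finRange N) t ht
  have hu : (List.finRange N).toFinset = Finset.univ := by ext; simp
  rw [hu, Finset.inter_univ] at h
  exact h

/-- The functional `p ↦ ∑ coeff m p * b m` on polynomials. -/
def coeffFunctional (b : (Fin N →₀ ℕ) → ℂ) : MvPolynomial (Fin N) ℂ →ₗ[ℂ] ℂ :=
  (MvPolynomial.basisMonomials (Fin N) ℂ).constr ℂ b

lemma coeffFunctional_apply (b : (Fin N →₀ ℕ) → ℂ) (p : MvPolynomial (Fin N) ℂ) :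
    coeffFunctional b p = ∑ m ∈ p.support, p.coeff m * b m := by
  conv_lhs => rw [p.as_sum]
  rw [map_sum]
  refine Finset.sum_congr rfl fun m _ => ?_
  have h : MvPolynomial.monomial m (p.coeff m) =
      p.coeff m • (MvPolynomial.basisMonomials (Fin N) ℂ) m := by
    rw [MvPolynomial.coe_basisMonomials, MvPolynomial.smul_monomial, smul_eq_mul, mul_one]
  rw [h, map_smul, coeffFunctional, Module.Basis.constr_basis, smul_eq_mul]

lemma coeffFunctional_monomial (b : (Fin N →₀ ℕ) → ℂ) (m : Fin N →₀ ℕ) (r : ℂ) :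
    coeffFunctional b (MvPolynomial.monomial m r) = r * b m := by
  have h : MvPolynomial.monomial m r = r • (MvPolynomial.basisMonomials (Fin N) ℂ) m := by
    rw [MvPolynomial.coe_basisMonomials, MvPolynomial.smul_monomial, smul_eq_mul, mul_one]
  rw [h, map_smul, coeffFunctional, Module.Basis.constr_basis, smul_eq_mul]

lemma prod_X_eq_monomial (B : Finset (Fin N)) (r : ℂ) :
    (∏ i ∈ B, (MvPolynomial.X i : MvPolynomial (Fin N) ℂ)) * MvPolynomial.C r =
      MvPolynomial.monomial (∑ i ∈ B, Finsupp.single i 1) r := by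
  induction B using Finset.induction_on with
  | empty => rw [Finset.prod_empty, Finset.sum_empty, one_mul, MvPolynomial.C_apply]
  | insert j B hj ih =>
    rw [Finset.prod_insert hj, mul_assoc, ih, Finset.sum_insert hj, MvPolynomial.X,
      MvPolynomial.monomial_mul, one_mul]

/-- The link between the polynomial definition of the operators and `opValue`. It is stated over a
general field, since it serves both complex t and the real variables x of the Hamiltonians, and for
general constants with c' * c = 1, so that each substitution c'∂_j just inserts j into the index
set. -/
lemma normalOrdered_symMat [NormedAlgebra 𝕜 ℂ] {D : Set (Fin N → 𝕜)} {c c' : ℂ}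
    {g : Finset (Fin N) → (Fin N → 𝕜) → ℂ} (hg : DerivFamily D c g) (hD : IsOpen D)
    {f : (Fin N → 𝕜) → ℂ} (hf : ∀ t ∈ D, f t = g ∅ t) (hc : c' * c = 1)
    {σ : (Fin N → 𝕜) → MvPolynomial (Fin N) ℂ} {d : Fin N → ℂ} {a e : Fin N → Fin N → ℂ}
    (hae : ∀ i j k, i ≠ j → j ≠ k → i ≠ k → a i j * a j k = (e i j - e k j) * a i k) (k : ℕ)
    {t : Fin N → 𝕜} (ht : t ∈ D)
    (hσ : σ t = symMat k (diagOff (fun j => MvPolynomial.X j + MvPolynomial.C (d j))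
      fun i j => MvPolynomial.C (a i j))) :
    normalOrdered c' σ f t =
      ∑ U ∈ Finset.powersetCard k (Finset.univ : Finset (Fin N)), ∑ B ∈ U.powerset,
        pairSum (fun i j => -(a i j * a j i)) d (U \ B) * g B t := by
  -- Written over the support of the symbol the sum is not visibly additive; as a value of a linear
  -- functional it can be split along the matching expansion.
  have h0 : normalOrdered c' σ f t =
      coeffFunctional (fun m => c' ^ (∑ j, m j) * multiD m f t) (σ t) := by
    rw [coeffFunctional_apply, normalOrdered]
    exact Finset.sum_congr rfl fun m _ => mul_assoc _ _ _
  rw [h0, hσ, symMat_eq_sum_pairSum (fun i j => MvPolynomial.C (e i j))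
    (fun i j k hij hjk hik => by rw [← map_sub, ← map_mul, ← map_mul, hae i j k hij hjk hik]),
    map_sum]
  refine Finset.sum_congr rfl fun U _ => ?_
  rw [pairSum_add (fun i j => by ring), map_sum]
  refine Finset.sum_congr rfl fun B _ => ?_
  have h1 : pairSum (fun i j => -((MvPolynomial.C (a i j) : MvPolynomial (Fin N) ℂ) *
      MvPolynomial.C (a j i))) (fun j => MvPolynomial.C (d j)) (U \ B) =
      MvPolynomial.C (pairSum (fun i j => -(a i j * a j i)) d (U \ B)) := by
    rw [map_pairSum MvPolynomial.C (v := fun i j => -(a i j * a j i)) (fun i j => by ring)]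
    simp
  have hm : ∀ j, (∑ i ∈ B, Finsupp.single i 1 : Fin N →₀ ℕ) j = if j ∈ B then 1 else 0 := by
    intro j
    simp [Finsupp.finsetSum_apply, Finsupp.single_apply]
  have hcard : ∑ j, (∑ i ∈ B, Finsupp.single i 1 : Fin N →₀ ℕ) j = B.card := by
    simp only [hm]; simp
  rw [h1, prod_X_eq_monomial, coeffFunctional_monomial, hcard, hg.multiD_eq hD hf hm ht,
    ← mul_assoc (c' ^ _), ← mul_pow, hc, one_pow, one_mul]

end families

/-- The value of the normal-ordered operator in terms of a derivative family. -/
def opValue {N : ℕ} (k : ℕ) (v : Fin N → Fin N → ℂ) (x : Fin N → ℂ) (g : Finset (Fin N) → ℂ) : ℂ :=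
  ∑ U ∈ Finset.powersetCard k (Finset.univ : Finset (Fin N)), ∑ B ∈ U.powerset,
    pairSum v x (U \ B) * g B

lemma laxDimless_add_diagDimless {N : ℕ} (lam : ℂ) (t : Fin N → ℂ) :
    laxDimless lam t + diagDimless lam t =
      diagOff (fun j => MvPolynomial.X j + MvPolynomial.C (diagW lam t j))
        fun i j => MvPolynomial.C (laxOff lam t i j) := by
  ext1 i j
  by_cases h : i = j
  · subst h; simp [laxDimless, diagDimless, diagOff, diagW]
  · simp [laxDimless, diagDimless, diagOff, laxOff, h]

lemma sigmaHat_eq {N : ℕ} (lam : ℂ) (k : ℕ) {D : Set (Fin N → ℂ)} (hD : IsOpen D)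
    {g : Finset (Fin N) → (Fin N → ℂ) → ℂ} (hg : DerivFamily D Complex.I g)
    {f : (Fin N → ℂ) → ℂ} (hf : ∀ t ∈ D, f t = g ∅ t) {t : Fin N → ℂ} (ht : t ∈ D)
    (hsinh : ∀ j k, j ≠ k → Complex.sinh (t j - t k) ≠ 0) :
    sigmaHat lam k f t = opValue k (pairW lam t) (diagW lam t) (fun B => g B t) := by
  rw [sigmaHat, normalOrdered_symMat hg hD hf (by rw [neg_mul, Complex.I_mul_I, neg_neg])
    (laxOff_mul_laxOff lam hsinh) k ht (by rw [laxDimless_add_diagDimless])]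
  simp only [neg_laxOff_mul]
  rfl

end

end CalogeroMoser

namespace CalogeroMoser

noncomputable section

open Filter Topology MeasureTheory

/-! ### Integrals of partial derivatives -/

/-- The integral of f' over (-x, x) equals f(x) - f(-x). This difference is integrable in x and has
a limit as x → ∞, so the limit is zero; decay of f need not be assumed. -/
lemma integral_deriv_eq_zero_of_off_countable {f f' : ℝ → ℂ} {s : Set ℝ} (hs : s.Countable)
    (hc : Continuous f) (hd : ∀ x, x ∉ s → HasDerivAt f (f' x) x) (hf : Integrable f)
    (hf' : Integrable f') : ∫ x, f' x = 0 := by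
  have h1 : Tendsto (fun x : ℝ => ∫ y in (-x)..x, f' y) atTop (𝓝 (∫ y, f' y)) :=
    intervalIntegral_tendsto_integral hf' tendsto_neg_atTop_atBot tendsto_id
  have h2 : ∀ x : ℝ, ∫ y in (-x)..x, f' y = f x - f (-x) := by
    intro x
    refine MeasureTheory.integral_eq_of_hasDerivAt_off_countable f f' hs hc.continuousOn
      (fun y hy => hd y hy.2) hf'.intervalIntegrable
  simp only [h2] at h1
  have h3 : Integrable (fun x => f x - f (-x)) := hf.sub hf.comp_neg
  refine IntegrableAtFilter.eq_zero_of_tendsto (l := atTop) (μ := volume)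
    (h3.integrableAtFilter _) ?_ h1
  intro t ht
  obtain ⟨b, hb⟩ := mem_atTop_sets.1 ht
  exact measure_mono_top (fun x hx => hb x hx) (Real.volume_Ici (a := b))

/-- The diagonals, where the coefficients are singular, are proper subspaces and hence null. -/
lemma ae_injective (n : ℕ) : ∀ᵐ s : Fin n → ℝ, Function.Injective s := by
  have h : ∀ i j : Fin n, i ≠ j → ∀ᵐ s : Fin n → ℝ, s i ≠ s j := by
    intro i j hij
    let p : Submodule ℝ (Fin n → ℝ) :=
      LinearMap.ker ((LinearMap.proj i : (Fin n → ℝ) →ₗ[ℝ] ℝ) - LinearMap.proj j)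
    have hp : p ≠ ⊤ := by
      intro hp
      have : (Pi.single i 1 : Fin n → ℝ) ∈ p := hp ▸ Submodule.mem_top
      rw [LinearMap.mem_ker] at this
      simp [hij.symm] at this
    have h0 := Measure.addHaar_submodule volume p hp
    rw [ae_iff]
    refine measure_mono_null (fun s hs => ?_) h0
    have hs' : s i = s j := not_not.1 hs
    simp [p, LinearMap.mem_ker, hs']
  have h2 : ∀ᵐ s : Fin n → ℝ, ∀ i j, i ≠ j → s i ≠ s j := by
    rw [ae_all_iff]; intro i
    rw [ae_all_iff]; intro j
    by_cases hij : i = j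
    · simp [hij]
    · filter_upwards [h i j hij] with s hs _ using hs
  filter_upwards [h2] with s hs i j hij
  by_contra hne
  exact hs i j hne hij

/-- Fubini with the j-th variable innermost. For almost every choice of the others, which are then
distinct, the line meets the diagonals in finitely many points, where continuity is enough. -/
lemma integral_partial_eq_zero {n : ℕ} (j : Fin n) {G G' : (Fin n → ℝ) → ℂ} (hG : Integrable G)
    (hG' : Integrable G')
    (hc : ∀ s : Fin n → ℝ, (∀ k l, k ≠ j → l ≠ j → k ≠ l → s k ≠ s l) →
      Continuous fun x => G (Function.update s j x))
    (hd : ∀ s : Fin n → ℝ, Function.Injective s →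
      HasDerivAt (fun x => G (Function.update s j x)) (G' s) (s j)) :
    ∫ s, G' s = 0 := by
  obtain ⟨m, rfl⟩ : ∃ m, n = m + 1 := ⟨n - 1, by have := j.2; omega⟩
  set e := (MeasurableEquiv.piFinSuccAbove (fun _ : Fin (m + 1) => ℝ) j).symm with he
  have hmp : MeasurePreserving e volume volume :=
    (volume_preserving_piFinSuccAbove (fun _ : Fin (m + 1) => ℝ) j).symm _
  have hev : ∀ x y, e (x, y) = Function.update (e (0, y)) j x := by
    intro x y
    exact (Fin.update_insertNth (α := fun _ => ℝ) j 0 x y).symm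
  have hej : ∀ x y, e (x, y) j = x := fun x y => by rw [hev]; simp
  have hek : ∀ x y k, e (x, y) (j.succAbove k) = y k := by
    intro x y k
    exact Fin.insertNth_apply_succAbove (α := fun _ => ℝ) j x y k
  have hGe : Integrable (fun z => G (e z)) := (hmp.integrable_comp_emb e.measurableEmbedding).2 hG
  have hGe' : Integrable (fun z => G' (e z)) :=
    (hmp.integrable_comp_emb e.measurableEmbedding).2 hG'
  rw [← hmp.integral_comp e.measurableEmbedding]
  change ∫ z : ℝ × (Fin m → ℝ), G' (e z) ∂(volume.prod volume) = 0
  rw [integral_prod_symm _ hGe']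
  refine integral_eq_zero_of_ae ?_
  filter_upwards [ae_injective m, hGe.prod_left_ae, hGe'.prod_left_ae] with y hy h1 h2
  refine integral_deriv_eq_zero_of_off_countable (f := fun x => G (e (x, y))) (s := Set.range y)
    (Set.countable_range y) ?_ ?_ h1 h2
  · have hfun : (fun x => G (e (x, y))) = fun x => G (Function.update (e (0, y)) j x) :=
      funext fun x => by rw [hev x y]
    rw [hfun]
    refine hc _ ?_
    intro k l hk hl hkl
    obtain ⟨k, rfl⟩ := Fin.exists_succAbove_eq hk
    obtain ⟨l, rfl⟩ := Fin.exists_succAbove_eq hl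
    rw [hek, hek]
    exact fun h => hkl (congrArg _ (hy h))
  · intro x hx
    have hinj : Function.Injective (e (x, y)) := by
      intro k l hkl
      rcases Fin.eq_self_or_eq_succAbove j k with hk | ⟨k, rfl⟩ <;>
        rcases Fin.eq_self_or_eq_succAbove j l with h | ⟨l, rfl⟩
      · rw [hk, h]
      · rw [hk, hej, hek] at hkl; exact absurd ⟨l, hkl.symm⟩ hx
      · rw [h, hej, hek] at hkl; exact absurd ⟨k, hkl⟩ hx
      · rw [hek, hek] at hkl; rw [hy hkl]
    have h := hd _ hinj
    rw [hej] at h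
    refine h.congr_of_eventuallyEq (Eventually.of_forall fun z => ?_)
    simp only
    rw [hev z y, hev x y, Function.update_idem]

/-! ### The weight function at real points -/

section weight

/-- `2 |sinh x|`. -/
def rs (x : ℝ) : ℝ := |2 * Real.sinh x|

/-- `|coth x|`. -/
def rc (x : ℝ) : ℝ := Real.cosh x / |Real.sinh x|

lemma rc_nonneg (x : ℝ) : 0 ≤ rc x := div_nonneg (Real.cosh_pos x).le (abs_nonneg _)

lemma one_le_rc {x : ℝ} (hx : x ≠ 0) : 1 ≤ rc x := by
  rw [rc, one_le_div (abs_pos.2 (by rwa [Ne, Real.sinh_eq_zero]))]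
  rw [abs_le]
  constructor
  · have := Real.exp_pos x
    have h := Real.cosh_add_sinh x
    linarith
  · exact (Real.sinh_lt_cosh x).le

lemma rc_neg (x : ℝ) : rc (-x) = rc x := by simp [rc]

lemma rs_neg (x : ℝ) : rs (-x) = rs x := by simp [rs]

lemma rs_nonneg (x : ℝ) : 0 ≤ rs x := abs_nonneg _

lemma continuous_rs : Continuous rs := (continuous_const.mul Real.continuous_sinh).abs

lemma rs_mul_rc {x : ℝ} (hx : x ≠ 0) : rs x * rc x = 2 * Real.cosh x := by
  have : |Real.sinh x| ≠ 0 := abs_ne_zero.2 (by rwa [Ne, Real.sinh_eq_zero])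
  rw [rs, rc, abs_mul, abs_two]
  field_simp

lemma cosh_le_exp_abs (x : ℝ) : Real.cosh x ≤ Real.exp |x| := by
  rw [← Real.cosh_abs, Real.cosh_eq]
  have : Real.exp (-|x|) ≤ Real.exp |x| := Real.exp_le_exp.2 (by linarith [abs_nonneg x])
  linarith

lemma rs_le (x : ℝ) : rs x ≤ 2 * Real.cosh x := by
  by_cases hx : x = 0
  · subst hx; simp [rs]
  · rw [← rs_mul_rc hx]
    exact le_mul_of_one_le_right (rs_nonneg x) (one_le_rc hx)

/-- One factor 2|sinh x| cancels the pole of |coth x|; for a ≥ 1 the remaining power a - 1 is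
nonnegative, so 2|sinh x| may be replaced by 2 cosh x. -/
lemma rs_rpow_mul_rc_le {a : ℝ} (ha : 1 ≤ a) {x : ℝ} (hx : x ≠ 0) :
    rs x ^ a * rc x ≤ 2 ^ a * Real.exp (a * |x|) := by
  have hpos : 0 < rs x := abs_pos.2 (mul_ne_zero two_ne_zero (by rwa [Ne, Real.sinh_eq_zero]))
  have h1 : rs x ^ a * rc x = rs x ^ (a - 1) * (2 * Real.cosh x) := by
    rw [← rs_mul_rc hx, ← mul_assoc, ← Real.rpow_add_one hpos.ne', sub_add_cancel]
  have hc : 0 < 2 * Real.cosh x := by have := Real.cosh_pos x; linarith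
  calc rs x ^ a * rc x = rs x ^ (a - 1) * (2 * Real.cosh x) := h1
    _ ≤ (2 * Real.cosh x) ^ (a - 1) * (2 * Real.cosh x) := by
        exact mul_le_mul_of_nonneg_right (Real.rpow_le_rpow (rs_nonneg x) (rs_le x)
          (by linarith)) hc.le
    _ = (2 * Real.cosh x) ^ a := by rw [← Real.rpow_add_one hc.ne', sub_add_cancel]
    _ ≤ (2 * Real.exp |x|) ^ a := by
        gcongr
        exact cosh_le_exp_abs x
    _ = 2 ^ a * Real.exp (a * |x|) := by
        rw [Real.mul_rpow (by norm_num) (Real.exp_pos _).le, ← Real.exp_mul, mul_comm a]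

/-- The canonical embedding of real points. -/
def toC {n : ℕ} (s : Fin n → ℝ) : Fin n → ℂ := fun j => (s j : ℂ)

@[simp] lemma toC_apply {n : ℕ} (s : Fin n → ℝ) (j : Fin n) : toC s j = (s j : ℂ) := rfl

lemma toC_update {n : ℕ} (s : Fin n → ℝ) (j : Fin n) (x : ℝ) :
    toC (Function.update s j x) = Function.update (toC s) j (x : ℂ) := by
  ext k
  by_cases h : k = j
  · subst h; simp
  · simp [h]

lemma continuous_toC {n : ℕ} : Continuous (toC : (Fin n → ℝ) → Fin n → ℂ) :=
  continuous_pi fun j => Complex.continuous_ofReal.comp (continuous_apply j)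

lemma sinh_sub_ofReal_ne {x y : ℝ} (h : x ≠ y) : Complex.sinh ((x : ℂ) - y) ≠ 0 := by
  rw [← Complex.ofReal_sub, ← Complex.ofReal_sinh, Complex.ofReal_ne_zero, Ne, Real.sinh_eq_zero]
  exact sub_ne_zero.2 h

lemma norm_coth_ofReal (x y : ℝ) : ‖coth ((x : ℂ) - y)‖ = rc (x - y) := by
  rw [coth, ← Complex.ofReal_sub, ← Complex.ofReal_sinh, ← Complex.ofReal_cosh, norm_div,
    Complex.norm_real, Complex.norm_real, rc, Real.norm_eq_abs, Real.norm_eq_abs,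
    abs_of_pos (Real.cosh_pos _)]

lemma four_mul_sinh_sq_ofReal (x y : ℝ) : 4 * Complex.sinh ((x : ℂ) - y) ^ 2 =
    ((4 * Real.sinh (x - y) ^ 2 : ℝ) : ℂ) := by push_cast; rfl

lemma norm_weight_factor {lam : ℂ} (hlam : lam.re ≠ 0) (x y : ℝ) :
    ‖(4 * Complex.sinh ((x : ℂ) - y) ^ 2) ^ lam‖ = rs (x - y) ^ lam.re * rs (y - x) ^ lam.re := by
  rw [four_mul_sinh_sq_ofReal, Complex.norm_cpow_eq_rpow_re_of_nonneg (by positivity) hlam,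
    ← neg_sub x y, rs_neg, ← Real.mul_rpow (rs_nonneg _) (rs_nonneg _), rs, abs_mul_abs_self]
  congr 1; ring

lemma norm_weightW {n : ℕ} {lam : ℂ} (hlam : lam.re ≠ 0) (s : Fin n → ℝ) :
    ‖weightW lam (toC s)‖ = ∏ j, ∏ k ∈ Finset.univ.erase j, rs (s j - s k) ^ lam.re := by
  simp only [weightW, norm_prod, toC_apply, norm_weight_factor hlam]
  rw [Finset.prod_prod_Ioi_mul_eq_prod_prod_off_diag (fun j i => rs (s i - s j) ^ lam.re)]
  refine Finset.prod_congr rfl fun j _ => Finset.prod_congr ?_ fun _ _ => rfl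
  ext; simp

lemma continuous_weightW {n : ℕ} {lam : ℂ} (hlam : 0 < lam.re) :
    Continuous fun s : Fin n → ℝ => weightW lam (toC s) := by
  unfold weightW
  refine continuous_finsetProd _ fun j _ => continuous_finsetProd _ fun k _ => ?_
  simp only [toC_apply, four_mul_sinh_sq_ofReal]
  refine (Complex.continuous_ofReal_cpow_const hlam).comp ?_
  fun_prop

lemma weightW_eq_zero {n : ℕ} {lam : ℂ} (hlam : lam ≠ 0) {t : Fin n → ℂ} {j k : Fin n}
    (hjk : j ≠ k) (h : t j = t k) : weightW lam t = 0 := by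
  wlog hlt : j < k generalizing j k
  · exact this hjk.symm h.symm (lt_of_le_of_ne (not_lt.1 hlt) hjk.symm)
  rw [weightW, Finset.prod_eq_zero (Finset.mem_univ j)]
  refine Finset.prod_eq_zero (Finset.mem_Ioi.2 hlt) ?_
  simp [h, hlam]

lemma hasDerivAt_prod_of_mul {ι 𝕜 : Type*} [NontriviallyNormedField 𝕜] [NormedAlgebra 𝕜 ℂ]
    (A : Finset ι) {f : ι → 𝕜 → ℂ} {c : ι → ℂ} {x : 𝕜}
    (h : ∀ i ∈ A, HasDerivAt (f i) (c i * f i x) x) :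
    HasDerivAt (fun y => ∏ i ∈ A, f i y) ((∑ i ∈ A, c i) * ∏ i ∈ A, f i x) x := by
  classical
  induction A using Finset.induction_on with
  | empty => simpa using hasDerivAt_const x (1 : ℂ)
  | insert i A hi ih =>
    simp only [Finset.prod_insert hi, Finset.sum_insert hi]
    refine ((h i (Finset.mem_insert_self i A)).mul
      (ih fun k hk => h k (Finset.mem_insert_of_mem hk))).congr_deriv ?_
    ring

lemma hasDerivAt_weight_factor (lam : ℂ) {x y : ℝ} (h : x ≠ y) :
    HasDerivAt (fun z : ℝ => (4 * Complex.sinh ((z : ℂ) - y) ^ 2) ^ lam)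
      (2 * lam * coth ((x : ℂ) - y) * (4 * Complex.sinh ((x : ℂ) - y) ^ 2) ^ lam) x := by
  have hs := sinh_sub_ofReal_ne h
  have h1 : HasDerivAt (fun z : ℂ => 4 * Complex.sinh (z - y) ^ 2)
      (4 * (2 * Complex.sinh ((x : ℂ) - y) * Complex.cosh ((x : ℂ) - y))) (x : ℂ) := by
    have := (((hasDerivAt_id (x : ℂ)).sub_const (y : ℂ)).csinh.pow 2).const_mul (4 : ℂ)
    refine this.congr_deriv ?_
    simp
  have hslit : 4 * Complex.sinh ((x : ℂ) - y) ^ 2 ∈ Complex.slitPlane := by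
    rw [four_mul_sinh_sq_ofReal, Complex.ofReal_mem_slitPlane]
    have : Real.sinh (x - y) ≠ 0 := by rw [Ne, Real.sinh_eq_zero]; exact sub_ne_zero.2 h
    positivity
  have h2 := (h1.cpow_const (c := lam) hslit).comp_ofReal
  refine h2.congr_deriv ?_
  rw [Complex.cpow_sub _ _ (by simpa using hs), Complex.cpow_one, coth]
  field_simp

lemma hasDerivAt_weightW {n : ℕ} (lam : ℂ) {s : Fin n → ℝ} (hs : Function.Injective s)
    (j : Fin n) : HasDerivAt (fun x : ℝ => weightW lam (toC (Function.update s j x)))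
      (2 * Complex.I * diagW lam (toC s) j * weightW lam (toC s)) (s j) := by
  -- The logarithmic derivative of each factor. Since sinh² is even, factors having j as their
  -- second index may be treated as if j came first.
  set c : Fin n → Fin n → ℂ := fun a b => if a = j then 2 * lam * coth ((s j : ℂ) - s b)
    else if b = j then 2 * lam * coth ((s j : ℂ) - s a) else 0 with hc
  have hfac : ∀ a, ∀ b ∈ Finset.Ioi a, HasDerivAt (fun x : ℝ =>
      (4 * Complex.sinh (toC (Function.update s j x) a - toC (Function.update s j x) b) ^ 2) ^ lam)
      (c a b * (4 * Complex.sinh (toC (Function.update s j (s j)) a -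
        toC (Function.update s j (s j)) b) ^ 2) ^ lam) (s j) := by
    intro a b hab
    have hne : a ≠ b := (Finset.mem_Ioi.1 hab).ne
    rw [Function.update_eq_self]
    by_cases ha : a = j
    · subst ha
      have hb : b ≠ a := hne.symm
      simp only [toC_apply, Function.update_self, Function.update_of_ne hb, hc, if_true]
      exact hasDerivAt_weight_factor lam (hs.ne hne)
    · by_cases hb : b = j
      · subst hb
        have h := hasDerivAt_weight_factor lam (hs.ne hne.symm)
        have hsq : ∀ p q : ℂ, Complex.sinh (p - q) ^ 2 = Complex.sinh (q - p) ^ 2 := by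
          intro p q; rw [← neg_sub, Complex.sinh_neg, neg_sq]
        simp only [toC_apply, Function.update_self, Function.update_of_ne ha, hc, if_true,
          if_neg ha]
        simp only [hsq (s a : ℂ)]
        exact h
      · simp only [toC_apply, Function.update_of_ne ha, Function.update_of_ne hb, hc, if_neg ha,
          if_neg hb, zero_mul]
        exact hasDerivAt_const _ _
  have h1 := hasDerivAt_prod_of_mul Finset.univ (fun a _ =>
    hasDerivAt_prod_of_mul (Finset.Ioi a) (hfac a))
  unfold weightW
  refine h1.congr_deriv ?_
  rw [Function.update_eq_self]
  congr 1
  have hsum : ∑ a, ∑ b ∈ Finset.Ioi a, c a b = ∑ a, ∑ b ∈ Finset.Ioi a,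
      ((if a = j then 2 * lam * coth ((s j : ℂ) - s b) else 0) +
        if b = j then 2 * lam * coth ((s j : ℂ) - s a) else 0) := by
    refine Finset.sum_congr rfl fun a _ => Finset.sum_congr rfl fun b hb => ?_
    have hne := (Finset.mem_Ioi.1 hb).ne
    simp only [hc]
    by_cases ha : a = j
    · subst ha; simp [hne.symm]
    · simp [ha]
  have h2 : ∑ a, ∑ b ∈ Finset.Ioi a, (if a = j then 2 * lam * coth ((s j : ℂ) - s b) else 0) =
      ∑ b ∈ Finset.Ioi j, 2 * lam * coth ((s j : ℂ) - s b) := by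
    rw [Finset.sum_eq_single j]
    · simp
    · intro a _ ha; simp [ha]
    · simp
  have h3 : ∑ a, ∑ b ∈ Finset.Ioi a, (if b = j then 2 * lam * coth ((s j : ℂ) - s a) else 0) =
      ∑ a ∈ Finset.Iio j, 2 * lam * coth ((s j : ℂ) - s a) := by
    rw [← Finset.sum_filter_add_sum_filter_not Finset.univ (fun a => a < j)]
    rw [Finset.sum_eq_zero (s := Finset.univ.filter fun a => ¬ a < j), add_zero]
    · refine Finset.sum_congr ?_ fun a ha => ?_
      · ext; simp
      · rw [Finset.sum_ite_eq', if_pos]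
        simpa using ha
    · intro a ha
      rw [Finset.sum_ite_eq', if_neg]
      simpa using ha
  have h4 : Finset.univ.erase j = Finset.Iio j ∪ Finset.Ioi j := by
    ext a; simp [lt_or_lt_iff_ne]
  have h5 : Disjoint (Finset.Iio j) (Finset.Ioi j) := by
    rw [Finset.disjoint_left]; intro a h h'
    exact absurd (Finset.mem_Iio.1 h) (not_lt.2 (Finset.mem_Ioi.1 h').le)
  simp only [hsum, Finset.sum_add_distrib]
  rw [h2, h3, diagW, h4, Finset.sum_union h5, ← Finset.mul_sum, ← Finset.mul_sum]
  simp only [toC_apply]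
  linear_combination (2 * lam * (∑ i ∈ Finset.Iio j, coth ((s j : ℂ) - s i) +
    ∑ i ∈ Finset.Ioi j, coth ((s j : ℂ) - s i))) * Complex.I_sq

end weight

/-! ### Bounds on the weight and on the singular coefficients. -/

lemma integrable_exp_neg_mul_abs {c : ℝ} (hc : 0 < c) :
    Integrable fun x : ℝ => Real.exp (-c * |x|) := by
  have h1 : IntegrableOn (fun x : ℝ => Real.exp (-c * |x|)) (Set.Iic 0) :=
    (integrableOn_exp_mul_Iic hc 0).congr_fun (fun x hx => by
      simp only; rw [abs_of_nonpos hx]; ring_nf) measurableSet_Iic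
  have h2 : IntegrableOn (fun x : ℝ => Real.exp (-c * |x|)) (Set.Ioi 0) :=
    (integrableOn_exp_mul_Ioi (neg_neg_iff_pos.2 hc) 0).congr_fun (fun x hx => by
      simp only; rw [abs_of_pos hx]) measurableSet_Ioi
  rw [← integrableOn_univ, ← Set.Iic_union_Ioi (a := (0 : ℝ))]
  exact h1.union h2

lemma integrable_exp_neg_mul_sum_abs (n : ℕ) {c : ℝ} (hc : 0 < c) :
    Integrable fun s : Fin n → ℝ => Real.exp (-c * ∑ k, |s k|) := by
  have h := Integrable.fintype_prod (ι := Fin n) (𝕜 := ℝ) (E := ℝ) (μ := fun _ => volume)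
    (f := fun _ x => Real.exp (-c * |x|)) (fun _ => integrable_exp_neg_mul_abs hc)
  refine h.congr (Eventually.of_forall fun s => ?_)
  simp only
  rw [Finset.mul_sum, Real.exp_sum]

/-- The sum of all distances between the coordinates. -/
def spread {n : ℕ} (s : Fin n → ℝ) : ℝ := ∑ j, ∑ k, |s j - s k|

lemma spread_nonneg {n : ℕ} (s : Fin n → ℝ) : 0 ≤ spread s :=
  Finset.sum_nonneg fun _ _ => Finset.sum_nonneg fun _ _ => abs_nonneg _

/-- The factor controlling the singularities of the coefficients in the variable `s j`. -/
def rprod {n : ℕ} (s : Fin n → ℝ) (j : Fin n) : ℝ := ∏ k ∈ Finset.univ.erase j, rc (s j - s k)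

lemma one_le_rprod {n : ℕ} {s : Fin n → ℝ} (hs : Function.Injective s) (j : Fin n) :
    1 ≤ rprod s j :=
  Finset.one_le_prod fun _ hk => one_le_rc
    (sub_ne_zero.2 (hs.ne (Finset.ne_of_mem_erase hk).symm))

lemma rc_le_rprod {n : ℕ} {s : Fin n → ℝ} (hs : Function.Injective s) {j k : Fin n} (hjk : k ≠ j) :
    rc (s j - s k) ≤ rprod s j := by
  have h := Finset.prod_le_prod_of_subset_of_one_le (f := fun k => rc (s j - s k))
    (Finset.singleton_subset_iff.2 (Finset.mem_erase.2 ⟨hjk, Finset.mem_univ k⟩))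
    (fun _ _ => rc_nonneg _) (fun i hi _ => one_le_rc
      (sub_ne_zero.2 (hs.ne (Finset.ne_of_mem_erase hi).symm)))
  rwa [Finset.prod_singleton] at h

/-- The constant in the bound on the weight function. -/
def weightConst (n : ℕ) (a : ℝ) : ℝ := ∏ j : Fin n, ∏ _k ∈ Finset.univ.erase j, (2 : ℝ) ^ a

lemma weightConst_nonneg (n : ℕ) (a : ℝ) : 0 ≤ weightConst n a :=
  Finset.prod_nonneg fun _ _ => Finset.prod_nonneg fun _ _ => by positivity

/-- Each unordered pair contributes 2|sinh| to the power 2 Re λ. Splitting this between the two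
orders of the pair leaves one power Re λ against each |coth| in the product. -/
lemma norm_weightW_mul_prod_rprod_le {n : ℕ} {lam : ℂ} (hlam : 1 ≤ lam.re) {s : Fin n → ℝ}
    (hs : Function.Injective s) :
    ‖weightW lam (toC s)‖ * ∏ j, rprod s j ≤
      weightConst n lam.re * Real.exp (lam.re * spread s) := by
  rw [norm_weightW (by linarith), ← Finset.prod_mul_distrib]
  have h1 : Real.exp (lam.re * spread s) =
      ∏ j, ∏ k ∈ Finset.univ.erase j, Real.exp (lam.re * |s j - s k|) := by
    rw [spread, Finset.mul_sum, Real.exp_sum]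
    refine Finset.prod_congr rfl fun j _ => ?_
    rw [Finset.mul_sum, ← Finset.sum_erase Finset.univ (a := j) (by simp), Real.exp_sum]
  rw [h1, weightConst, ← Finset.prod_mul_distrib]
  refine Finset.prod_le_prod (fun j _ => mul_nonneg (Finset.prod_nonneg fun k _ =>
    Real.rpow_nonneg (rs_nonneg _) _) (Finset.prod_nonneg fun k _ => rc_nonneg _)) fun j _ => ?_
  rw [rprod, ← Finset.prod_mul_distrib, ← Finset.prod_mul_distrib]
  refine Finset.prod_le_prod (fun k _ => mul_nonneg (Real.rpow_nonneg (rs_nonneg _) _)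
    (rc_nonneg _)) fun k hk => ?_
  exact rs_rpow_mul_rc_le hlam (sub_ne_zero.2 (hs.ne (Finset.ne_of_mem_erase hk).symm))

lemma norm_weightW_le {n : ℕ} {lam : ℂ} (hlam : 1 ≤ lam.re) (s : Fin n → ℝ) :
    ‖weightW lam (toC s)‖ ≤ weightConst n lam.re * Real.exp (lam.re * spread s) := by
  by_cases hs : Function.Injective s
  · refine le_trans ?_ (norm_weightW_mul_prod_rprod_le hlam hs)
    exact le_mul_of_one_le_right (norm_nonneg _)
      (Finset.one_le_prod fun j _ => one_le_rprod hs j)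
  · obtain ⟨j, k, h, hjk⟩ : ∃ j k, s j = s k ∧ j ≠ k := by
      simpa [Function.Injective] using hs
    have h0 : weightW lam (toC s) = 0 := weightW_eq_zero (by rintro rfl; norm_num at hlam) hjk
      (by simp [h])
    rw [h0, norm_zero]
    exact mul_nonneg (weightConst_nonneg _ _) (Real.exp_pos _).le

/-- In a matching each element occurs exactly once, so each r_i enters to the first power; the
constant accounts for at most 1 + K choices at every expansion. -/
lemma norm_pairSum_le {ι : Type*} [DecidableEq ι] {v : ι → ι → ℂ} (hsymm : ∀ i j, v i j = v j i)
    {x : ι → ℂ} {r : ι → ℝ} {M K : ℝ} (hr : ∀ i, 0 ≤ r i) (hM : 1 ≤ M) {U : Finset ι}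
    (hK : (U.card : ℝ) ≤ K) (hv : ∀ i ∈ U, ∀ j ∈ U, i ≠ j → ‖v i j‖ ≤ M * (r i * r j))
    (hx : ∀ i ∈ U, ‖x i‖ ≤ M * r i) :
    ‖pairSum v x U‖ ≤ (M * (1 + K)) ^ U.card * ∏ i ∈ U, r i := by
  induction U using Finset.strongInduction with
  | H U ih =>
    rcases U.eq_empty_or_nonempty with rfl | ⟨j, hj⟩
    · simp
    have hK0 : (0 : ℝ) ≤ K := le_trans (Nat.cast_nonneg _) hK
    have hC : 1 ≤ M * (1 + K) := by nlinarith
    have hC0 : 0 ≤ M * (1 + K) := by linarith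
    have hsub : ∀ i, (U.erase j).erase i ⊂ U := fun i => lt_of_le_of_lt (Finset.erase_subset _ _)
        (Finset.erase_ssubset hj)
    have hcard : ∀ {V : Finset ι}, V ⊂ U → (V.card : ℝ) ≤ K := fun hV =>
      le_trans (by exact_mod_cast Finset.card_le_card hV.1) hK
    have hc1 : (U.erase j).card + 1 = U.card := Finset.card_erase_add_one hj
    set P := ∏ i ∈ U, r i with hP
    have hP0 : 0 ≤ P := Finset.prod_nonneg fun i _ => hr i
    have hPj : r j * ∏ i ∈ U.erase j, r i = P := Finset.mul_prod_erase U r hj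
    set q := (M * (1 + K)) ^ (U.erase j).card with hq
    have hq0 : 0 ≤ q := pow_nonneg hC0 _
    have t1 : ‖x j * pairSum v x (U.erase j)‖ ≤ M * q * P := by
      rw [norm_mul]
      calc ‖x j‖ * ‖pairSum v x (U.erase j)‖
          ≤ (M * r j) * (q * ∏ i ∈ U.erase j, r i) := by
            refine mul_le_mul (hx j hj) (ih _ (Finset.erase_ssubset hj)
              (hcard (Finset.erase_ssubset hj))
              (fun a ha b hb => hv a (Finset.mem_of_mem_erase ha) b (Finset.mem_of_mem_erase hb))
              (fun a ha => hx a (Finset.mem_of_mem_erase ha))) (norm_nonneg _)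
              (mul_nonneg (by linarith) (hr j))
        _ = M * q * P := by rw [← hPj]; ring
    have t2 : ∀ i ∈ U.erase j, ‖v j i * pairSum v x ((U.erase j).erase i)‖ ≤ M * q * P := by
      intro i hi
      have hi' := Finset.mem_erase.1 hi
      rw [norm_mul]
      have hPi : r i * ∏ l ∈ (U.erase j).erase i, r l = ∏ l ∈ U.erase j, r l :=
        Finset.mul_prod_erase _ r hi
      have hle : (M * (1 + K)) ^ ((U.erase j).erase i).card ≤ q :=
        pow_le_pow_right₀ hC (Finset.card_le_card (Finset.erase_subset _ _))
      calc ‖v j i‖ * ‖pairSum v x ((U.erase j).erase i)‖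
          ≤ (M * (r j * r i)) * (q * ∏ l ∈ (U.erase j).erase i, r l) := by
            refine mul_le_mul (hv j hj i hi'.2 hi'.1.symm) ((ih _ (hsub i) (hcard (hsub i))
              (fun a ha b hb => hv a ((hsub i).1 ha) b ((hsub i).1 hb))
              (fun a ha => hx a ((hsub i).1 ha))).trans ?_) (norm_nonneg _)
              (mul_nonneg (by linarith) (mul_nonneg (hr j) (hr i)))
            exact mul_le_mul_of_nonneg_right hle (Finset.prod_nonneg fun i _ => hr i)
        _ = M * q * P := by rw [← hPj, ← hPi]; ring
    rw [pairSum_eq hsymm x hj]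
    refine (norm_add_le _ _).trans ?_
    have t3 := norm_sum_le_of_le _ t2
    rw [Finset.sum_const, nsmul_eq_mul] at t3
    have hck : ((U.erase j).card : ℝ) ≤ K := hcard (Finset.erase_ssubset hj)
    have hMqP : 0 ≤ M * q * P := mul_nonneg (mul_nonneg (by linarith) hq0) hP0
    calc _ ≤ M * q * P + K * (M * q * P) :=
          add_le_add t1 (t3.trans (mul_le_mul_of_nonneg_right hck hMqP))
      _ = (M * (1 + K)) ^ U.card * P := by rw [← hc1, pow_succ]; ring

/-! ### Partially transposed coefficients -/

/-- The pair weights after integration by parts in the variables in `P`. -/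
def pairWP {n : ℕ} (lam : ℂ) (P : Finset (Fin n)) (s : Fin n → ℝ) (j k : Fin n) : ℂ :=
  pairW lam (toC s) j k +
    if (j ∈ P ↔ k ∈ P) then 0 else lam / Complex.sinh (toC s j - toC s k) ^ 2

/-- The singleton weights after integration by parts in the variables in `P`. -/
def diagWP {n : ℕ} (lam : ℂ) (P : Finset (Fin n)) (s : Fin n → ℝ) (j : Fin n) : ℂ :=
  if j ∈ P then -diagW lam (toC s) j else diagW lam (toC s) j

lemma sinh_sub_sq_comm (x y : ℂ) : Complex.sinh (x - y) ^ 2 = Complex.sinh (y - x) ^ 2 := by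
  rw [← neg_sub, Complex.sinh_neg, neg_sq]

lemma pairWP_symm {n : ℕ} (lam : ℂ) (P : Finset (Fin n)) (s : Fin n → ℝ) (j k : Fin n) :
    pairWP lam P s j k = pairWP lam P s k j := by
  rw [pairWP, pairWP, pairW_symm, sinh_sub_sq_comm]
  congr 1
  simp only [iff_comm]

section bounds

variable {n : ℕ} {lam : ℂ} {s : Fin n → ℝ}

lemma norm_div_sinh_sq_le (c : ℂ) (hs : Function.Injective s) {j k : Fin n} (hjk : j ≠ k) :
    ‖c / Complex.sinh (toC s j - toC s k) ^ 2‖ ≤ ‖c‖ * (rprod s j * rprod s k) := by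
  have h1 : 1 ≤ Real.cosh (s j - s k) := Real.one_le_cosh _
  have h2 : ‖c / Complex.sinh (toC s j - toC s k) ^ 2‖ ≤
      ‖c‖ * (rc (s j - s k) * rc (s j - s k)) := by
    rw [norm_div, norm_pow, toC_apply, toC_apply, ← Complex.ofReal_sub, ← Complex.ofReal_sinh,
      Complex.norm_real, Real.norm_eq_abs, rc, div_mul_div_comm, ← sq, ← sq, mul_div_assoc']
    gcongr
    have : 1 ≤ Real.cosh (s j - s k) ^ 2 := one_le_pow₀ h1
    nlinarith [norm_nonneg c]
  refine h2.trans (mul_le_mul_of_nonneg_left ?_ (norm_nonneg c))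
  refine mul_le_mul (rc_le_rprod hs hjk.symm) ?_ (rc_nonneg _)
    (le_trans zero_le_one (one_le_rprod hs j))
  rw [← rc_neg, neg_sub]
  exact rc_le_rprod hs hjk

lemma norm_pairWP_le (P : Finset (Fin n)) (hs : Function.Injective s) {j k : Fin n} (hjk : j ≠ k) :
    ‖pairWP lam P s j k‖ ≤ (‖lam‖ ^ 2 + ‖lam‖) * (rprod s j * rprod s k) := by
  have hr : 0 ≤ rprod s j * rprod s k := mul_nonneg (le_trans zero_le_one (one_le_rprod hs j))
    (le_trans zero_le_one (one_le_rprod hs k))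
  refine (norm_add_le _ _).trans ?_
  rw [add_mul]
  refine add_le_add ?_ ?_
  · have := norm_div_sinh_sq_le (-lam ^ 2) hs hjk
    rwa [norm_neg, norm_pow] at this
  · split_ifs
    · rw [norm_zero]; exact mul_nonneg (norm_nonneg _) hr
    · exact norm_div_sinh_sq_le lam hs hjk

lemma norm_diagW_le (hs : Function.Injective s) (j : Fin n) :
    ‖diagW lam (toC s) j‖ ≤ ‖lam‖ * n * rprod s j := by
  rw [diagW, norm_mul, norm_mul, norm_neg, Complex.norm_I, one_mul, mul_assoc]
  refine mul_le_mul_of_nonneg_left ?_ (norm_nonneg _)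
  have h := norm_sum_le_of_le (f := fun k => coth (toC s j - toC s k)) (Finset.univ.erase j)
    (n := fun _ => rprod s j) (fun k hk => by
      rw [toC_apply, toC_apply, norm_coth_ofReal]
      exact rc_le_rprod hs (Finset.ne_of_mem_erase hk))
  refine h.trans ?_
  rw [Finset.sum_const, nsmul_eq_mul]
  refine mul_le_mul_of_nonneg_right ?_ (le_trans zero_le_one (one_le_rprod hs j))
  exact_mod_cast (Finset.card_le_univ _).trans (by simp)

lemma norm_diagWP (P : Finset (Fin n)) (j : Fin n) :
    ‖diagWP lam P s j‖ = ‖diagW lam (toC s) j‖ := by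
  rw [diagWP]; split_ifs <;> simp

/-- The constant in the bound on the coefficients. -/
def coeffConst (n : ℕ) (lam : ℂ) : ℝ := (‖lam‖ ^ 2 + ‖lam‖ + ‖lam‖ * n + 1) * (1 + n)

lemma one_le_coeffConst (n : ℕ) (lam : ℂ) : 1 ≤ coeffConst n lam := by
  have h1 : 0 ≤ ‖lam‖ ^ 2 + ‖lam‖ + ‖lam‖ * n := by positivity
  have h2 : (0 : ℝ) ≤ n := Nat.cast_nonneg n
  rw [coeffConst]; nlinarith

lemma norm_pairSum_pairWP_le (P V : Finset (Fin n)) (hs : Function.Injective s) :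
    ‖pairSum (pairWP lam P s) (diagWP lam P s) V‖ ≤
      coeffConst n lam ^ n * ∏ i ∈ V, rprod s i := by
  have h1 : 0 ≤ ‖lam‖ ^ 2 + ‖lam‖ := by positivity
  have h2 : 0 ≤ ‖lam‖ * n := by positivity
  have hr : ∀ i, 0 ≤ rprod s i := fun i => le_trans zero_le_one (one_le_rprod hs i)
  have hcard : V.card ≤ n := (Finset.card_le_univ _).trans (by simp)
  refine (norm_pairSum_le (pairWP_symm lam P s) (r := rprod s)
    (M := ‖lam‖ ^ 2 + ‖lam‖ + ‖lam‖ * n + 1) (K := n) hr (by linarith) (by exact_mod_cast hcard)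
    ?_ ?_).trans ?_
  · intro i _ j _ hij
    refine (norm_pairWP_le P hs hij).trans (mul_le_mul_of_nonneg_right (by linarith)
      (mul_nonneg (hr i) (hr j)))
  · intro i _
    rw [norm_diagWP]
    exact (norm_diagW_le hs i).trans (mul_le_mul_of_nonneg_right (by linarith) (hr i))
  · exact mul_le_mul_of_nonneg_right (pow_le_pow_right₀ (one_le_coeffConst n lam) hcard)
      (Finset.prod_nonneg fun i _ => hr i)

lemma prod_rprod_le_univ (hs : Function.Injective s) (V : Finset (Fin n)) :
    ∏ i ∈ V, rprod s i ≤ ∏ i, rprod s i :=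
  Finset.prod_le_prod_of_subset_of_one_le (Finset.subset_univ V)
    (fun i _ => le_trans zero_le_one (one_le_rprod hs i)) fun i _ _ => one_le_rprod hs i

end bounds

/-! ### Measurability of the coefficients. -/

section measurability

variable {n : ℕ} (lam : ℂ)

lemma measurable_sinh_sub (j k : Fin n) :
    Measurable fun s : Fin n → ℝ => Complex.sinh (toC s j - toC s k) := by
  refine Continuous.measurable ?_
  exact Complex.continuous_sinh.comp (((continuous_apply j).comp continuous_toC).sub
    ((continuous_apply k).comp continuous_toC))

lemma measurable_coth_sub (j k : Fin n) :
    Measurable fun s : Fin n → ℝ => coth (toC s j - toC s k) := by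
  refine Measurable.div ?_ (measurable_sinh_sub j k)
  refine Continuous.measurable ?_
  exact Complex.continuous_cosh.comp (((continuous_apply j).comp continuous_toC).sub
    ((continuous_apply k).comp continuous_toC))

lemma measurable_diagW (j : Fin n) : Measurable fun s : Fin n → ℝ => diagW lam (toC s) j :=
  (Finset.measurable_sum _ fun k _ => measurable_coth_sub j k).const_mul _

lemma measurable_diagWP (P : Finset (Fin n)) (j : Fin n) :
    Measurable fun s : Fin n → ℝ => diagWP lam P s j := by
  by_cases h : j ∈ P
  · simp only [diagWP, if_pos h]; exact (measurable_diagW lam j).neg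
  · simpa [diagWP, h] using measurable_diagW lam j

lemma measurable_pairWP (P : Finset (Fin n)) (j k : Fin n) :
    Measurable fun s : Fin n → ℝ => pairWP lam P s j k := by
  refine Measurable.add (((measurable_sinh_sub j k).pow_const 2).const_div _) ?_
  by_cases h : (j ∈ P ↔ k ∈ P)
  · simp only [if_pos h]; exact measurable_const
  · simp only [if_neg h]; exact ((measurable_sinh_sub j k).pow_const 2).const_div _

lemma measurable_pairSum {α ι : Type*} [MeasurableSpace α] [DecidableEq ι] {v : α → ι → ι → ℂ}
    {x : α → ι → ℂ} (hsymm : ∀ a i j, v a i j = v a j i) (hv : ∀ i j, Measurable fun a => v a i j)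
    (hx : ∀ i, Measurable fun a => x a i) (U : Finset ι) :
    Measurable fun a => pairSum (v a) (x a) U := by
  induction U using Finset.strongInduction with
  | H U ih =>
    rcases U.eq_empty_or_nonempty with rfl | ⟨j, hj⟩
    · simp
    have hsub : ∀ i, (U.erase j).erase i ⊂ U := fun i => lt_of_le_of_lt (Finset.erase_subset _ _)
        (Finset.erase_ssubset hj)
    simp only [fun a => pairSum_eq (hsymm a) (x a) hj]
    exact ((hx j).mul (ih _ (Finset.erase_ssubset hj))).add
      (Finset.measurable_sum _ fun i _ => (hv j i).mul (ih _ (hsub i)))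

lemma measurable_pairSum_pairWP (P V : Finset (Fin n)) :
    Measurable fun s : Fin n → ℝ => pairSum (pairWP lam P s) (diagWP lam P s) V :=
  measurable_pairSum (fun s => pairWP_symm lam P s) (measurable_pairWP lam P)
    (measurable_diagWP lam P) V

end measurability

/-- The weight absorbs the singularities of f at the price of exp(Re λ · spread), which the assumed
decay of g cancels. What remains is an integrable exponential. -/
lemma integrable_weight_mul {n : ℕ} {lam : ℂ} (hlam : 1 ≤ lam.re) {f g : (Fin n → ℝ) → ℂ}
    {M C c : ℝ} (hc : 0 < c) (hf : Measurable f)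
    (hfM : ∀ s, Function.Injective s → ‖f s‖ ≤ M * ∏ j, rprod s j) (hg : Continuous g)
    (hgC : ∀ s, ‖g s‖ ≤ C * (Real.exp (-lam.re * spread s) * Real.exp (-c * ∑ k, |s k|))) :
    Integrable fun s => weightW lam (toC s) * (f s * g s) := by
  have hW := (continuous_weightW (n := n) (lam := lam) (by linarith)).measurable
  refine ((integrable_exp_neg_mul_sum_abs n hc).const_mul (M * weightConst n lam.re * C)).mono'
    ((hW.mul (hf.mul hg.measurable)).aestronglyMeasurable) ?_
  filter_upwards [ae_injective n] with s hs
  have hr : ∀ i, 0 ≤ rprod s i := fun i => le_trans zero_le_one (one_le_rprod hs i)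
  have h1 := norm_weightW_mul_prod_rprod_le hlam hs
  have hR : 1 ≤ ∏ j, rprod s j := Finset.one_le_prod fun j _ => one_le_rprod hs j
  have hM : 0 ≤ M := by
    by_contra hM
    have := (norm_nonneg _).trans (hfM s hs)
    nlinarith
  rw [norm_mul, norm_mul]
  calc ‖weightW lam (toC s)‖ * (‖f s‖ * ‖g s‖)
      ≤ ‖weightW lam (toC s)‖ * ((M * ∏ j, rprod s j) *
        (C * (Real.exp (-lam.re * spread s) * Real.exp (-c * ∑ k, |s k|)))) := by
        refine mul_le_mul_of_nonneg_left (mul_le_mul (hfM s hs) (hgC s) (norm_nonneg _)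
          (mul_nonneg hM (by linarith))) (norm_nonneg _)
    _ = M * (‖weightW lam (toC s)‖ * ∏ j, rprod s j) *
        (C * (Real.exp (-lam.re * spread s) * Real.exp (-c * ∑ k, |s k|))) := by ring
    _ ≤ M * (weightConst n lam.re * Real.exp (lam.re * spread s)) *
        (C * (Real.exp (-lam.re * spread s) * Real.exp (-c * ∑ k, |s k|))) := by
        refine mul_le_mul_of_nonneg_right (mul_le_mul_of_nonneg_left h1 hM)
          ((norm_nonneg _).trans (hgC s))
    _ = M * weightConst n lam.re * C * Real.exp (-c * ∑ k, |s k|) *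
        (Real.exp (lam.re * spread s) * Real.exp (-lam.re * spread s)) := by ring
    _ = M * weightConst n lam.re * C * Real.exp (-c * ∑ k, |s k|) := by
        rw [← Real.exp_add, neg_mul lam.re, add_neg_cancel, Real.exp_zero, mul_one]

/-! ### Integration by parts -/

lemma hasDerivAt_coth_const_sub {y x : ℝ} (h : y ≠ x) :
    HasDerivAt (fun z : ℝ => coth ((y : ℂ) - z)) (1 / Complex.sinh ((y : ℂ) - x) ^ 2) x := by
  have hs := sinh_sub_ofReal_ne h
  have h1 : HasDerivAt (fun z : ℂ => (y : ℂ) - z) (-1) (x : ℂ) := by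
    simpa using (hasDerivAt_id (x : ℂ)).const_sub (y : ℂ)
  have h2 := (h1.ccosh.fun_div h1.csinh hs).comp_ofReal
  refine h2.congr_deriv ?_
  have := Complex.cosh_sq_sub_sinh_sq ((y : ℂ) - x)
  congr 1
  linear_combination this

lemma hasDerivAt_diagW_update {n : ℕ} (lam : ℂ) {s : Fin n → ℝ} (hs : Function.Injective s)
    {j l : Fin n} (hjl : l ≠ j) :
    HasDerivAt (fun x : ℝ => diagW lam (toC (Function.update s j x)) l)
      (-Complex.I * lam * (1 / Complex.sinh (toC s l - toC s j) ^ 2)) (s j) := by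
  have hmem : j ∈ Finset.univ.erase l := Finset.mem_erase.2 ⟨hjl.symm, Finset.mem_univ j⟩
  have h1 : ∀ x : ℝ, diagW lam (toC (Function.update s j x)) l =
      -Complex.I * lam * (coth ((s l : ℂ) - x) +
        ∑ k ∈ (Finset.univ.erase l).erase j, coth (toC s l - toC s k)) := by
    intro x
    rw [diagW, ← Finset.add_sum_erase _ _ hmem]
    congr 2
    · simp [Function.update_of_ne hjl]
    · refine Finset.sum_congr rfl fun k hk => ?_
      simp [Function.update_of_ne hjl, Function.update_of_ne (Finset.ne_of_mem_erase hk)]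
  simp only [h1]
  exact ((hasDerivAt_coth_const_sub (hs.ne hjl)).add_const _).const_mul _

section step

variable {n : ℕ} (lam : ℂ) (φ ψ : Finset (Fin n) → (Fin n → ℝ) → ℂ)

/-- The integrand after integration by parts in the variables in `P`. -/
def transposed (U P : Finset (Fin n)) (s : Fin n → ℝ) : ℂ :=
  ∑ B ∈ U.powerset, pairSum (pairWP lam P s) (diagWP lam P s) (U \ B) *
    (φ (B ∩ P) s * ψ (B \ P) s)

/-- The function whose partial derivative is the difference of two consecutive integrands. -/
def potential (P V A B : Finset (Fin n)) (s : Fin n → ℝ) : ℂ :=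
  weightW lam (toC s) * (pairSum (pairWP lam P s) (diagWP lam P s) V * (φ A s * ψ B s))

/-- The derivative of the coefficient of `potential`. -/
def coeffDeriv (j : Fin n) (P V : Finset (Fin n)) (s : Fin n → ℝ) : ℂ :=
  ∑ l ∈ V, ((if l ∈ P then -1 else 1) *
    (-Complex.I * lam * (1 / Complex.sinh (toC s l - toC s j) ^ 2))) *
      pairSum (pairWP lam P s) (diagWP lam P s) (V.erase l)

/-- The partial derivative of `potential`. -/
def potentialDeriv (j : Fin n) (P V A B : Finset (Fin n)) (s : Fin n → ℝ) : ℂ :=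
  weightW lam (toC s) * ((2 * Complex.I * diagW lam (toC s) j *
      pairSum (pairWP lam P s) (diagWP lam P s) V) * (φ A s * ψ B s)) +
  weightW lam (toC s) * (coeffDeriv lam j P V s * (φ A s * ψ B s)) +
  weightW lam (toC s) * (pairSum (pairWP lam P s) (diagWP lam P s) V *
    (-Complex.I * φ (insert j A) s * ψ B s + Complex.I * φ A s * ψ (insert j B) s))

variable {φ ψ}

lemma hasDerivAt_pairSum_pairWP {j : Fin n} {P V : Finset (Fin n)} (hjV : j ∉ V) {s : Fin n → ℝ}
    (hs : Function.Injective s) :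
    HasDerivAt (fun x : ℝ => pairSum (pairWP lam P (Function.update s j x))
      (diagWP lam P (Function.update s j x)) V) (coeffDeriv lam j P V s) (s j) := by
  have h1 : ∀ x : ℝ, pairSum (pairWP lam P (Function.update s j x))
      (diagWP lam P (Function.update s j x)) V =
      pairSum (pairWP lam P s) (diagWP lam P (Function.update s j x)) V := by
    intro x
    refine pairSum_congr (fun a ha b hb _ => ?_) (fun _ _ => rfl) (pairWP_symm lam P _)
      (pairWP_symm lam P _)
    have ha' : a ≠ j := fun h => hjV (h ▸ ha)
    have hb' : b ≠ j := fun h => hjV (h ▸ hb)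
    simp [pairWP, pairW, Function.update_of_ne ha', Function.update_of_ne hb']
  simp only [h1]
  have h2 : ∀ l ∈ V, HasDerivAt (fun x : ℝ => diagWP lam P (Function.update s j x) l)
      ((if l ∈ P then -1 else 1) *
        (-Complex.I * lam * (1 / Complex.sinh (toC s l - toC s j) ^ 2))) (s j) := by
    intro l hl
    have h := hasDerivAt_diagW_update lam hs (fun h => hjV (h ▸ hl) : l ≠ j)
    by_cases hlP : l ∈ P
    · simp only [diagWP, if_pos hlP]
      exact h.fun_neg.congr_deriv (by ring)
    · simp only [diagWP, if_neg hlP]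
      exact h.congr_deriv (by ring)
  have h3 := hasDerivAt_pairSum (pairWP_symm lam P s) h2
  rw [Function.update_eq_self] at h3
  exact h3

lemma hasDerivAt_potential (hφ : DerivFamily Set.univ (-Complex.I) φ)
    (hψ : DerivFamily Set.univ Complex.I ψ) {j : Fin n} {P V A B : Finset (Fin n)} (hV : j ∉ V)
    (hA : j ∉ A) (hB : j ∉ B) {s : Fin n → ℝ} (hs : Function.Injective s) :
    HasDerivAt (fun x : ℝ => potential lam φ ψ P V A B (Function.update s j x))
      (potentialDeriv lam φ ψ j P V A B s) (s j) := by
  have h1 := hasDerivAt_weightW lam hs j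
  have h2 := hasDerivAt_pairSum_pairWP lam (P := P) hV hs
  have h3 := hφ A j hA s (Set.mem_univ s)
  have h4 := hψ B j hB s (Set.mem_univ s)
  refine (h1.fun_mul (h2.fun_mul (h3.fun_mul h4))).congr_deriv ?_
  simp only [Function.update_eq_self, potentialDeriv]
  ring

/-- Subsets of U are grouped in pairs B, insert j B with j ∉ B, and the coefficient for B is
expanded along j. The difference then has three parts: 2w_j from the change of sign of w_j, the
change of the pair weights at j, and one derivative moved between ψ and φ. They are the derivatives
in s_j of the weight, of the coefficient, and of φψ. -/
lemma weight_transposed_sub {j : Fin n} {P U : Finset (Fin n)} (hjU : j ∈ U) (hjP : j ∉ P)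
    (s : Fin n → ℝ) :
    weightW lam (toC s) * transposed lam φ ψ U P s -
      weightW lam (toC s) * transposed lam φ ψ U (insert j P) s =
      ∑ B ∈ (U.erase j).powerset, -Complex.I *
        potentialDeriv lam φ ψ j P (U.erase j \ B) (B ∩ P) (B \ P) s := by
  rw [transposed, transposed, sum_powerset_of_mem hjU, sum_powerset_of_mem hjU,
    ← Finset.sum_add_distrib, ← Finset.sum_add_distrib, ← mul_sub, ← Finset.sum_sub_distrib,
    Finset.mul_sum]
  refine Finset.sum_congr rfl fun B hB => ?_
  have hBU := Finset.mem_powerset.1 hB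
  have hjB : j ∉ B := fun h => Finset.notMem_erase j U (hBU h)
  set V := U.erase j \ B with hV
  have hjV : j ∉ V := fun h => Finset.notMem_erase j U (Finset.mem_sdiff.1 h).1
  have hmem : j ∈ U \ B := Finset.mem_sdiff.2 ⟨hjU, hjB⟩
  have hVe : (U \ B).erase j = V := by rw [hV, Finset.erase_sdiff_comm]
  have hVi : U \ insert j B = V := by rw [hV, Finset.erase_sdiff_comm, ← Finset.sdiff_insert]
  have s1 : B ∩ insert j P = B ∩ P := Finset.inter_insert_of_notMem hjB
  have s2 : B \ insert j P = B \ P := by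
    rw [Finset.sdiff_insert, Finset.erase_eq_of_notMem]
    exact fun h => hjB (Finset.mem_sdiff.1 h).1
  have s3 : insert j B ∩ insert j P = insert j (B ∩ P) := Finset.insert_inter_distrib _ _ _ |>.symm
  have s4 : insert j B \ insert j P = B \ P := by
    rw [Finset.insert_sdiff_of_mem _ (Finset.mem_insert_self j P), s2]
  have s5 : insert j B ∩ P = B ∩ P := Finset.insert_inter_of_notMem hjP
  have s6 : insert j B \ P = insert j (B \ P) := Finset.insert_sdiff_of_notMem _ hjP
  have hcongr : ∀ V' ⊆ V, pairSum (pairWP lam (insert j P) s) (diagWP lam (insert j P) s) V' =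
      pairSum (pairWP lam P s) (diagWP lam P s) V' := by
    intro V' hV'
    refine pairSum_congr (fun a ha b hb _ => ?_) (fun a ha => ?_) (pairWP_symm lam _ _)
      (pairWP_symm lam _ _)
    · have ha' : a ≠ j := fun h => hjV (h ▸ hV' ha)
      have hb' : b ≠ j := fun h => hjV (h ▸ hV' hb)
      simp [pairWP, ha', hb']
    · have ha' : a ≠ j := fun h => hjV (h ▸ hV' ha)
      simp [diagWP, ha']
  -- Moving j into P changes whether j and l lie on the same side. The correction λ/sinh² appears or
  -- disappears accordingly, matching the derivative of ±w_l in s_j.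
  have hw : ∀ l ∈ V, pairWP lam P s j l = pairWP lam (insert j P) s j l -
      (if l ∈ P then -1 else 1) * (lam * (1 / Complex.sinh (toC s l - toC s j) ^ 2)) := by
    intro l hl
    have hl' : l ≠ j := fun h => hjV (h ▸ hl)
    rw [sinh_sub_sq_comm]
    by_cases hlP : l ∈ P
    · simp [pairWP, hjP, hlP]; ring
    · simp [pairWP, hjP, hlP, hl']; ring
  have e1 : ∑ l ∈ V, pairWP lam P s j l * pairSum (pairWP lam P s) (diagWP lam P s) (V.erase l) =
      ∑ l ∈ V, pairWP lam (insert j P) s j l *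
        pairSum (pairWP lam P s) (diagWP lam P s) (V.erase l) -
      ∑ l ∈ V, (if l ∈ P then -1 else 1) * (lam * (1 / Complex.sinh (toC s l - toC s j) ^ 2)) *
        pairSum (pairWP lam P s) (diagWP lam P s) (V.erase l) := by
    rw [← Finset.sum_sub_distrib]
    exact Finset.sum_congr rfl fun l hl => by rw [hw l hl, sub_mul]
  have e2 : ∑ l ∈ V, pairWP lam (insert j P) s j l *
        pairSum (pairWP lam (insert j P) s) (diagWP lam (insert j P) s) (V.erase l) =
      ∑ l ∈ V, pairWP lam (insert j P) s j l *
        pairSum (pairWP lam P s) (diagWP lam P s) (V.erase l) :=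
    Finset.sum_congr rfl fun l _ => by rw [hcongr _ (Finset.erase_subset l V)]
  rw [pairSum_eq (pairWP_symm lam P s) _ hmem, pairSum_eq (pairWP_symm lam (insert j P) s) _ hmem,
    hVe, hVi, s1, s2, s3, s4, s5, s6, hcongr V (Finset.Subset.refl V), e1, e2]
  have hcd : coeffDeriv lam j P V s = -Complex.I * ∑ l ∈ V, (if l ∈ P then -1 else 1) *
      (lam * (1 / Complex.sinh (toC s l - toC s j) ^ 2)) *
        pairSum (pairWP lam P s) (diagWP lam P s) (V.erase l) := by
    rw [coeffDeriv, Finset.mul_sum]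
    exact Finset.sum_congr rfl fun l _ => by ring
  rw [potentialDeriv, hcd]
  have hd1 : diagWP lam P s j = diagW lam (toC s) j := if_neg hjP
  have hd2 : diagWP lam (insert j P) s j = -diagW lam (toC s) j :=
    if_pos (Finset.mem_insert_self j P)
  rw [hd1, hd2]
  set w := weightW lam (toC s)
  set Q := pairSum (pairWP lam P s) (diagWP lam P s) V
  set S := ∑ l ∈ V, (if l ∈ P then -1 else 1) *
      (lam * (1 / Complex.sinh (toC s l - toC s j) ^ 2)) *
        pairSum (pairWP lam P s) (diagWP lam P s) (V.erase l)
  linear_combination (2 * w * diagW lam (toC s) j * Q * (φ (B ∩ P) s * ψ (B \ P) s) -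
    w * S * (φ (B ∩ P) s * ψ (B \ P) s) - w * Q * φ (insert j (B ∩ P)) s * ψ (B \ P) s +
    w * Q * φ (B ∩ P) s * ψ (insert j (B \ P)) s) * Complex.I_sq

end step

/-! ### Integrability and continuity of the functions entering the integrations by parts. -/

lemma norm_coeffDeriv_le {n : ℕ} (lam : ℂ) {j : Fin n} {P V : Finset (Fin n)} (hjV : j ∉ V)
    {s : Fin n → ℝ} (hs : Function.Injective s) :
    ‖coeffDeriv lam j P V s‖ ≤ (n * ‖lam‖ * coeffConst n lam ^ n) * ∏ i, rprod s i := by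
  have hr : ∀ i, 0 ≤ rprod s i := fun i => le_trans zero_le_one (one_le_rprod hs i)
  have hK : 0 ≤ coeffConst n lam ^ n := pow_nonneg (zero_le_one.trans (one_le_coeffConst n lam)) _
  have hR : 0 ≤ ∏ i, rprod s i := Finset.prod_nonneg fun i _ => hr i
  have h1 : ∀ l ∈ V, ‖((if l ∈ P then -1 else 1) *
      (-Complex.I * lam * (1 / Complex.sinh (toC s l - toC s j) ^ 2))) *
      pairSum (pairWP lam P s) (diagWP lam P s) (V.erase l)‖ ≤
      ‖lam‖ * coeffConst n lam ^ n * ∏ i, rprod s i := by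
    intro l hl
    have hlj : l ≠ j := fun h => hjV (h ▸ hl)
    have e1 : ‖(if l ∈ P then (-1 : ℂ) else 1)‖ = 1 := by split_ifs <;> simp
    have e2 : -Complex.I * lam * (1 / Complex.sinh (toC s l - toC s j) ^ 2) =
        -Complex.I * (lam / Complex.sinh (toC s l - toC s j) ^ 2) := by ring
    rw [norm_mul, norm_mul, e1, one_mul, e2, norm_mul, norm_neg, Complex.norm_I, one_mul]
    have hjVl : j ∉ V.erase l := fun h => hjV (Finset.mem_of_mem_erase h)
    -- The double pole at s_l = s_j costs one factor for j and one for l. Since j ∉ V and l has been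
    -- deleted from V, no factor is used twice.
    have hprod : rprod s j * (rprod s l * ∏ i ∈ V.erase l, rprod s i) =
        ∏ i ∈ insert j V, rprod s i := by
      rw [Finset.prod_insert hjV, Finset.mul_prod_erase V (rprod s) hl]
    calc _ ≤ (‖lam‖ * (rprod s l * rprod s j)) *
          (coeffConst n lam ^ n * ∏ i ∈ V.erase l, rprod s i) :=
          mul_le_mul (norm_div_sinh_sq_le lam hs hlj) (norm_pairSum_pairWP_le P _ hs)
            (norm_nonneg _) (mul_nonneg (norm_nonneg _) (mul_nonneg (hr l) (hr j)))
      _ = ‖lam‖ * coeffConst n lam ^ n * ∏ i ∈ insert j V, rprod s i := by rw [← hprod]; ring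
      _ ≤ _ := mul_le_mul_of_nonneg_left (prod_rprod_le_univ hs _) (mul_nonneg (norm_nonneg _) hK)
  rw [coeffDeriv]
  refine (norm_sum_le_of_le _ h1).trans ?_
  rw [Finset.sum_const, nsmul_eq_mul, mul_assoc, mul_assoc (n : ℝ) (‖lam‖) _, mul_assoc]
  rw [mul_assoc]
  refine mul_le_mul_of_nonneg_right ?_ (mul_nonneg (norm_nonneg _) (mul_nonneg hK hR))
  exact_mod_cast (Finset.card_le_univ V).trans (by simp)

lemma norm_diagW_mul_pairSum_le {n : ℕ} (lam : ℂ) {j : Fin n} {P V : Finset (Fin n)} (hjV : j ∉ V)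
    {s : Fin n → ℝ} (hs : Function.Injective s) :
    ‖2 * Complex.I * diagW lam (toC s) j * pairSum (pairWP lam P s) (diagWP lam P s) V‖ ≤
      (2 * (‖lam‖ * n) * coeffConst n lam ^ n) * ∏ i, rprod s i := by
  have hr : ∀ i, 0 ≤ rprod s i := fun i => le_trans zero_le_one (one_le_rprod hs i)
  have hK : 0 ≤ coeffConst n lam ^ n := pow_nonneg (zero_le_one.trans (one_le_coeffConst n lam)) _
  rw [norm_mul, norm_mul, norm_mul, Complex.norm_I, mul_one, Complex.norm_two]
  calc _ ≤ 2 * (‖lam‖ * n * rprod s j) * (coeffConst n lam ^ n * ∏ i ∈ V, rprod s i) := by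
        refine mul_le_mul (mul_le_mul_of_nonneg_left (norm_diagW_le hs j) zero_le_two)
          (norm_pairSum_pairWP_le P V hs) (norm_nonneg _) ?_
        exact mul_nonneg zero_le_two (mul_nonneg (by positivity) (hr j))
    _ = (2 * (‖lam‖ * n) * coeffConst n lam ^ n) * ∏ i ∈ insert j V, rprod s i := by
        rw [Finset.prod_insert hjV]; ring
    _ ≤ _ := mul_le_mul_of_nonneg_left (prod_rprod_le_univ hs _) (by positivity)

lemma measurable_coeffDeriv {n : ℕ} (lam : ℂ) (j : Fin n) (P V : Finset (Fin n)) :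
    Measurable fun s : Fin n → ℝ => coeffDeriv lam j P V s := by
  unfold coeffDeriv
  refine Finset.measurable_sum _ fun l _ => Measurable.mul ?_ (measurable_pairSum_pairWP lam P _)
  exact ((((measurable_sinh_sub l j).pow_const 2).const_div 1).const_mul _).const_mul _

/-- An upper bound for the weight along a line, including simple poles at its zeros. -/
def lineBound {n : ℕ} (a : ℝ) (s : Fin n → ℝ) (j : Fin n) (x : ℝ) : ℝ :=
  ∏ k ∈ Finset.univ.erase j, rs (x - s k) ^ (2 * a - 1) * (2 * Real.cosh (x - s k))

lemma continuous_lineBound {n : ℕ} {a : ℝ} (ha : 1 ≤ a) (s : Fin n → ℝ) (j : Fin n) :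
    Continuous (lineBound a s j) := by
  refine continuous_finsetProd _ fun k _ => Continuous.mul ?_ ?_
  · exact (continuous_rs.comp (continuous_id.sub continuous_const)).rpow_const
      fun x => Or.inr (by linarith)
  · exact continuous_const.mul (Real.continuous_cosh.comp (continuous_id.sub continuous_const))

lemma lineBound_eq_zero {n : ℕ} {a : ℝ} (ha : 1 ≤ a) (s : Fin n → ℝ) {j k : Fin n} (hk : k ≠ j) :
    lineBound a s j (s k) = 0 := by
  refine Finset.prod_eq_zero (Finset.mem_erase.2 ⟨hk, Finset.mem_univ k⟩) ?_
  simp [rs, Real.zero_rpow (by linarith : 2 * a - 1 ≠ 0)]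

lemma lineBound_nonneg {n : ℕ} (a : ℝ) (s : Fin n → ℝ) (j : Fin n) (x : ℝ) :
    0 ≤ lineBound a s j x :=
  Finset.prod_nonneg fun _ _ => mul_nonneg (Real.rpow_nonneg (rs_nonneg _) _)
    (mul_nonneg zero_le_two (Real.cosh_pos _).le)

/-- As s_j varies, the weight contributes 2|sinh(x - s_k)| to the power 2 Re λ for each k ≠ j.
Because j ∉ V, the coefficients have at most a simple pole there, which lowers the exponent to 2 Re
λ - 1. This is still positive, so the majorant vanishes at collisions. -/
lemma norm_weightW_mul_prod_rprod_le_lineBound {n : ℕ} {lam : ℂ} (hlam : 1 ≤ lam.re) (j : Fin n)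
    (s : Fin n → ℝ) : ∃ K : ℝ, 0 ≤ K ∧ ∀ x : ℝ, Function.Injective (Function.update s j x) →
      ∀ V : Finset (Fin n), j ∉ V → ‖weightW lam (toC (Function.update s j x))‖ *
        ∏ l ∈ V, rprod (Function.update s j x) l ≤ K * lineBound lam.re s j x := by
  set a := lam.re with ha
  -- The factors of pairs not involving j do not depend on x and form the constant.
  refine ⟨∏ l ∈ Finset.univ.erase j, ∏ k ∈ (Finset.univ.erase l).erase j,
    rs (s l - s k) ^ a * rc (s l - s k), Finset.prod_nonneg fun _ _ => Finset.prod_nonneg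
      fun _ _ => mul_nonneg (Real.rpow_nonneg (rs_nonneg _) _) (rc_nonneg _), ?_⟩
  intro x hx V hV
  set s' := Function.update s j x with hs'
  have hsub : V ⊆ Finset.univ.erase j := fun l hl =>
    Finset.mem_erase.2 ⟨fun h => hV (h ▸ hl), Finset.mem_univ l⟩
  have h1 : ∏ l ∈ V, rprod s' l ≤ ∏ l ∈ Finset.univ.erase j, rprod s' l :=
    Finset.prod_le_prod_of_subset_of_one_le hsub
      (fun i _ => le_trans zero_le_one (one_le_rprod hx i)) fun i _ _ => one_le_rprod hx i
  refine (mul_le_mul_of_nonneg_left h1 (norm_nonneg _)).trans (le_of_eq ?_)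
  have hsj : s' j = x := Function.update_self ..
  have hsk : ∀ k, k ≠ j → s' k = s k := fun k hk => Function.update_of_ne hk ..
  rw [norm_weightW (by linarith), ← Finset.mul_prod_erase _ _ (Finset.mem_univ j), mul_assoc,
    ← Finset.prod_mul_distrib]
  have h2 : ∀ l ∈ Finset.univ.erase j, (∏ k ∈ Finset.univ.erase l, rs (s' l - s' k) ^ a) *
      rprod s' l = (rs (x - s l) ^ a * rc (x - s l)) *
      ∏ k ∈ (Finset.univ.erase l).erase j, rs (s l - s k) ^ a * rc (s l - s k) := by
    intro l hl
    have hlj := Finset.ne_of_mem_erase hl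
    rw [rprod, ← Finset.prod_mul_distrib, ← Finset.mul_prod_erase _ _
      (Finset.mem_erase.2 ⟨hlj.symm, Finset.mem_univ j⟩)]
    congr 1
    · rw [hsj, hsk l hlj, ← neg_sub x, rs_neg, rc_neg]
    · refine Finset.prod_congr rfl fun k hk => ?_
      rw [hsk l hlj, hsk k (Finset.ne_of_mem_erase hk)]
  rw [Finset.prod_congr rfl h2, Finset.prod_mul_distrib, ← mul_assoc, ← Finset.prod_mul_distrib,
    mul_comm]
  congr 1
  refine Finset.prod_congr rfl fun k hk => ?_
  have hkj := Finset.ne_of_mem_erase hk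
  have hne : x - s k ≠ 0 := by
    rw [← hsj, ← hsk k hkj]
    exact sub_ne_zero.2 (hx.ne hkj.symm)
  have hpos : 0 < rs (x - s k) :=
    abs_pos.2 (mul_ne_zero two_ne_zero (by rwa [Ne, Real.sinh_eq_zero]))
  rw [hsj, hsk k hkj, ← rs_mul_rc hne, ← mul_assoc, ← mul_assoc, ← Real.rpow_add hpos,
    ← Real.rpow_add_one hpos.ne']
  congr 2
  ring

section main

variable {n : ℕ} {lam : ℂ} {φ ψ : Finset (Fin n) → (Fin n → ℝ) → ℂ}

/-- Away from collisions the function is differentiable. At a collision the vanishing weight makes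
its value zero, whatever values the singular coefficients are assigned, and `lineBound` squeezes it
to zero nearby. -/
lemma continuous_potential_update (hlam : 1 ≤ lam.re)
    (hφ : DerivFamily Set.univ (-Complex.I) φ) (hψ : DerivFamily Set.univ Complex.I ψ)
    (hφc : ∀ T, Continuous (φ T)) (hψc : ∀ S, Continuous (ψ S)) {j : Fin n}
    {P V A B : Finset (Fin n)} (hV : j ∉ V) (hA : j ∉ A) (hB : j ∉ B) {s : Fin n → ℝ}
    (hs : ∀ k l, k ≠ j → l ≠ j → k ≠ l → s k ≠ s l) :
    Continuous fun x : ℝ => potential lam φ ψ P V A B (Function.update s j x) := by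
  have hlam0 : lam ≠ 0 := by rintro rfl; norm_num at hlam
  have hinj : ∀ x, (∀ k, k ≠ j → x ≠ s k) → Function.Injective (Function.update s j x) := by
    intro x hx k l hkl
    by_contra hne
    by_cases hk : k = j
    · subst hk
      rw [Function.update_self, Function.update_of_ne (Ne.symm hne)] at hkl
      exact hx l (Ne.symm hne) hkl
    · by_cases hl : l = j
      · subst hl
        rw [Function.update_self, Function.update_of_ne hk] at hkl
        exact hx k hk hkl.symm
      · rw [Function.update_of_ne hk, Function.update_of_ne hl] at hkl
        exact hs k l hk hl hne hkl
  have hzero : ∀ k, k ≠ j → potential lam φ ψ P V A B (Function.update s j (s k)) = 0 := by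
    intro k hk
    rw [potential, weightW_eq_zero hlam0 hk, zero_mul]
    simp [Function.update_of_ne hk]
  obtain ⟨K, hK0, hK⟩ := norm_weightW_mul_prod_rprod_le_lineBound hlam j s
  have hupd : Continuous fun x : ℝ => Function.update s j x :=
    continuous_const.update j continuous_id
  set b : ℝ → ℝ := fun x => K * lineBound lam.re s j x * (coeffConst n lam ^ n *
    ‖φ A (Function.update s j x) * ψ B (Function.update s j x)‖) with hb
  have hbc : Continuous b :=
    (continuous_const.mul (continuous_lineBound hlam s j)).mul (continuous_const.mul
      (((hφc A).comp hupd).mul ((hψc B).comp hupd)).norm)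
  have hCn : 0 ≤ coeffConst n lam ^ n := pow_nonneg (zero_le_one.trans (one_le_coeffConst n lam)) _
  have hbound : ∀ x, ‖potential lam φ ψ P V A B (Function.update s j x)‖ ≤ b x := by
    intro x
    by_cases hx : ∀ k, k ≠ j → x ≠ s k
    · have hi := hinj x hx
      have hr : ∀ i, 0 ≤ rprod (Function.update s j x) i :=
        fun i => le_trans zero_le_one (one_le_rprod hi i)
      have h1 := hK x hi V hV
      have h2 := norm_pairSum_pairWP_le (lam := lam) P V hi
      rw [potential, norm_mul, norm_mul]
      calc _ ≤ ‖weightW lam (toC (Function.update s j x))‖ *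
            ((coeffConst n lam ^ n * ∏ i ∈ V, rprod (Function.update s j x) i) *
            ‖φ A (Function.update s j x) * ψ B (Function.update s j x)‖) := by gcongr
        _ = (‖weightW lam (toC (Function.update s j x))‖ *
            ∏ i ∈ V, rprod (Function.update s j x) i) * (coeffConst n lam ^ n *
            ‖φ A (Function.update s j x) * ψ B (Function.update s j x)‖) := by ring
        _ ≤ _ := mul_le_mul_of_nonneg_right h1 (mul_nonneg hCn (norm_nonneg _))
    · push Not at hx
      obtain ⟨k, hk, rfl⟩ := hx
      rw [hzero k hk, norm_zero]
      exact mul_nonneg (mul_nonneg hK0 (lineBound_nonneg _ _ _ _))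
        (mul_nonneg hCn (norm_nonneg _))
  rw [continuous_iff_continuousAt]
  intro x
  by_cases hx : ∀ k, k ≠ j → x ≠ s k
  · have h := hasDerivAt_potential lam hφ hψ (P := P) hV hA hB (hinj x hx)
    rw [Function.update_self] at h
    simp only [Function.update_idem] at h
    exact h.continuousAt
  · push Not at hx
    obtain ⟨k, hk, rfl⟩ := hx
    rw [ContinuousAt, hzero k hk]
    refine squeeze_zero_norm hbound ?_
    have hb0 : b (s k) = 0 := by
      simp [hb, lineBound_eq_zero hlam s hk]
    rw [← hb0]
    exact hbc.continuousAt

variable {C c : ℝ}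

lemma integral_potentialDeriv (hlam : 1 ≤ lam.re) (hc : 0 < c)
    (hφ : DerivFamily Set.univ (-Complex.I) φ) (hψ : DerivFamily Set.univ Complex.I ψ)
    (hφc : ∀ T, Continuous (φ T)) (hψc : ∀ S, Continuous (ψ S))
    (hb : ∀ T S s, ‖φ T s * ψ S s‖ ≤
      C * (Real.exp (-lam.re * spread s) * Real.exp (-c * ∑ k, |s k|)))
    {j : Fin n} {P V A B : Finset (Fin n)} (hV : j ∉ V) (hA : j ∉ A) (hB : j ∉ B) :
    Integrable (potentialDeriv lam φ ψ j P V A B) ∧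
      ∫ s, potentialDeriv lam φ ψ j P V A B s = 0 := by
  have hCn : 0 ≤ coeffConst n lam ^ n := pow_nonneg (zero_le_one.trans (one_le_coeffConst n lam)) _
  have hm := measurable_pairSum_pairWP lam P V
  have hmb : ∀ s, Function.Injective s → ‖pairSum (pairWP lam P s) (diagWP lam P s) V‖ ≤
      coeffConst n lam ^ n * ∏ j, rprod s j := fun s hs =>
    (norm_pairSum_pairWP_le P V hs).trans (mul_le_mul_of_nonneg_left (prod_rprod_le_univ hs V) hCn)
  have hint : Integrable (potential lam φ ψ P V A B) :=
    integrable_weight_mul hlam hc hm hmb ((hφc A).mul (hψc B)) (hb A B)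
  have hint' : Integrable (potentialDeriv lam φ ψ j P V A B) := by
    refine Integrable.add (Integrable.add ?_ ?_) ?_
    · exact integrable_weight_mul hlam hc (((measurable_diagW lam j).const_mul _).mul hm)
        (fun s hs => norm_diagW_mul_pairSum_le lam hV hs) ((hφc A).mul (hψc B)) (hb A B)
    · exact integrable_weight_mul hlam hc (measurable_coeffDeriv lam j P V)
        (fun s hs => norm_coeffDeriv_le lam hV hs) ((hφc A).mul (hψc B)) (hb A B)
    · refine integrable_weight_mul (C := 2 * C) hlam hc hm hmb
        (((continuous_const.mul (hφc _)).mul (hψc B)).add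
          ((continuous_const.mul (hφc A)).mul (hψc _))) fun s => ?_
      refine (norm_add_le _ _).trans ?_
      rw [mul_assoc, mul_assoc Complex.I, norm_mul, norm_mul Complex.I, norm_neg, Complex.norm_I,
        one_mul, one_mul, two_mul, add_mul]
      exact add_le_add (hb _ _ s) (hb _ _ s)
  exact ⟨hint', integral_partial_eq_zero j hint hint'
    (fun s hs => continuous_potential_update hlam hφ hψ hφc hψc hV hA hB hs)
    fun s hs => hasDerivAt_potential lam hφ hψ hV hA hB hs⟩

lemma integrable_weight_transposed (hlam : 1 ≤ lam.re) (hc : 0 < c)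
    (hφc : ∀ T, Continuous (φ T)) (hψc : ∀ S, Continuous (ψ S))
    (hb : ∀ T S s, ‖φ T s * ψ S s‖ ≤
      C * (Real.exp (-lam.re * spread s) * Real.exp (-c * ∑ k, |s k|)))
    (U P : Finset (Fin n)) :
    Integrable fun s => weightW lam (toC s) * transposed lam φ ψ U P s := by
  have hCn : 0 ≤ coeffConst n lam ^ n := pow_nonneg (zero_le_one.trans (one_le_coeffConst n lam)) _
  simp only [transposed, Finset.mul_sum]
  refine integrable_finsetSum _ fun B _ => ?_
  exact integrable_weight_mul hlam hc (measurable_pairSum_pairWP lam P _)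
    (fun s hs => (norm_pairSum_pairWP_le P _ hs).trans
      (mul_le_mul_of_nonneg_left (prod_rprod_le_univ hs _) hCn)) ((hφc _).mul (hψc _)) (hb _ _)

lemma integral_transposed_insert (hlam : 1 ≤ lam.re) (hc : 0 < c)
    (hφ : DerivFamily Set.univ (-Complex.I) φ) (hψ : DerivFamily Set.univ Complex.I ψ)
    (hφc : ∀ T, Continuous (φ T)) (hψc : ∀ S, Continuous (ψ S))
    (hb : ∀ T S s, ‖φ T s * ψ S s‖ ≤
      C * (Real.exp (-lam.re * spread s) * Real.exp (-c * ∑ k, |s k|)))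
    {j : Fin n} {U P : Finset (Fin n)} (hjU : j ∈ U) (hjP : j ∉ P) :
    ∫ s, weightW lam (toC s) * transposed lam φ ψ U P s =
      ∫ s, weightW lam (toC s) * transposed lam φ ψ U (insert j P) s := by
  rw [← sub_eq_zero, ← integral_sub (integrable_weight_transposed hlam hc hφc hψc hb U P)
    (integrable_weight_transposed hlam hc hφc hψc hb U _)]
  simp only [weight_transposed_sub lam hjU hjP]
  have key : ∀ B ∈ (U.erase j).powerset, Integrable (potentialDeriv lam φ ψ j P (U.erase j \ B)
      (B ∩ P) (B \ P)) ∧ ∫ s, potentialDeriv lam φ ψ j P (U.erase j \ B) (B ∩ P) (B \ P) s = 0 := by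
    intro B hB
    have hjB : j ∉ B := fun h => Finset.notMem_erase j U (Finset.mem_powerset.1 hB h)
    exact integral_potentialDeriv hlam hc hφ hψ hφc hψc hb
      (fun h => Finset.notMem_erase j U (Finset.mem_sdiff.1 h).1)
      (fun h => hjB (Finset.mem_inter.1 h).1) (fun h => hjB (Finset.mem_sdiff.1 h).1)
  rw [integral_finsetSum _ fun B hB => (key B hB).1.const_mul _]
  refine Finset.sum_eq_zero fun B hB => ?_
  rw [integral_const_mul, (key B hB).2, mul_zero]

/-- The formal self-adjointness of the operators with respect to the weight function. -/
lemma integral_weight_opValue (hlam : 1 ≤ lam.re) (hc : 0 < c)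
    (hφ : DerivFamily Set.univ (-Complex.I) φ) (hψ : DerivFamily Set.univ Complex.I ψ)
    (hφc : ∀ T, Continuous (φ T)) (hψc : ∀ S, Continuous (ψ S))
    (hb : ∀ T S s, ‖φ T s * ψ S s‖ ≤
      C * (Real.exp (-lam.re * spread s) * Real.exp (-c * ∑ k, |s k|))) (k : ℕ) :
    Integrable (fun s => weightW lam (toC s) *
      (opValue k (pairW lam (toC s)) (fun j => -diagW lam (toC s) j) (fun B => φ B s) * ψ ∅ s)) ∧
    ∫ s, weightW lam (toC s) *
      (opValue k (pairW lam (toC s)) (fun j => -diagW lam (toC s) j) (fun B => φ B s) * ψ ∅ s) =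
    ∫ s, weightW lam (toC s) *
      (φ ∅ s * opValue k (pairW lam (toC s)) (diagW lam (toC s)) (fun B => ψ B s)) := by
  -- The variables of U are transposed one at a time: P = ∅ puts all derivatives on ψ, and P = U
  -- puts them all on φ.
  have hP : ∀ U : Finset (Fin n), ∀ P ⊆ U,
      ∫ s, weightW lam (toC s) * transposed lam φ ψ U ∅ s =
      ∫ s, weightW lam (toC s) * transposed lam φ ψ U P s := by
    intro U P
    induction P using Finset.induction_on with
    | empty => intro _; rfl
    | insert j P hj ih =>
      intro h
      rw [ih ((Finset.subset_insert j P).trans h)]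
      exact integral_transposed_insert hlam hc hφ hψ hφc hψc hb (h (Finset.mem_insert_self j P)) hj
  have h0 : ∀ s, φ ∅ s * opValue k (pairW lam (toC s)) (diagW lam (toC s)) (fun B => ψ B s) =
      ∑ U ∈ Finset.powersetCard k (Finset.univ : Finset (Fin n)), transposed lam φ ψ U ∅ s := by
    intro s
    rw [opValue, Finset.mul_sum]
    refine Finset.sum_congr rfl fun U _ => ?_
    rw [transposed, Finset.mul_sum]
    refine Finset.sum_congr rfl fun B _ => ?_
    have e1 : pairWP lam ∅ s = pairW lam (toC s) := by ext a b; simp [pairWP]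
    have e2 : diagWP lam ∅ s = diagW lam (toC s) := by ext a; simp [diagWP]
    rw [e1, e2, Finset.inter_empty, Finset.sdiff_empty]; ring
  have h1 : ∀ s, opValue k (pairW lam (toC s)) (fun j => -diagW lam (toC s) j) (fun B => φ B s) *
      ψ ∅ s =
      ∑ U ∈ Finset.powersetCard k (Finset.univ : Finset (Fin n)), transposed lam φ ψ U U s := by
    intro s
    rw [opValue, Finset.sum_mul]
    refine Finset.sum_congr rfl fun U _ => ?_
    rw [transposed, Finset.sum_mul]
    refine Finset.sum_congr rfl fun B hB => ?_
    have hBU := Finset.mem_powerset.1 hB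
    rw [Finset.inter_eq_left.2 hBU, Finset.sdiff_eq_empty_iff_subset.2 hBU, mul_assoc]
    congr 1
    refine pairSum_congr (fun a ha b hb _ => ?_) (fun a ha => ?_) (pairW_symm lam _)
      (pairWP_symm lam _ _)
    · simp [pairWP, (Finset.mem_sdiff.1 ha).1, (Finset.mem_sdiff.1 hb).1]
    · simp [diagWP, (Finset.mem_sdiff.1 ha).1]
  simp only [h0, h1, Finset.mul_sum]
  have hI := integrable_weight_transposed hlam hc hφc hψc hb
  refine ⟨integrable_finsetSum _ fun U _ => hI U U, ?_⟩
  rw [integral_finsetSum _ fun U _ => hI U U, integral_finsetSum _ fun U _ => hI U ∅]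
  exact Finset.sum_congr rfl fun U _ => (hP U U (Finset.Subset.refl U)).symm

end main

/-! ### An inequality between mutual distances -/

/-- Writing distances as integrals over a threshold z reduces inequalities between sums of distances
to counting the points to the left of z. -/
lemma integral_sq_indicator_sub (x y : ℝ) :
    Integrable (fun z : ℝ => ((if x < z then (1 : ℝ) else 0) - if y < z then 1 else 0) ^ 2) ∧
    ∫ z : ℝ, ((if x < z then (1 : ℝ) else 0) - if y < z then 1 else 0) ^ 2 = |x - y| := by
  have h : (fun z : ℝ => ((if x < z then (1 : ℝ) else 0) - if y < z then 1 else 0) ^ 2) =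
      (Set.uIoc x y).indicator (fun _ => (1 : ℝ)) := by
    ext z
    classical
    rw [Set.indicator_apply]
    simp only [Set.mem_uIoc]
    by_cases h1 : x < z <;> by_cases h2 : y < z <;>
      simp [h1, h2, not_le.2, not_lt.1]
  have hm : MeasurableSet (Set.uIoc x y) := measurableSet_uIoc
  rw [h]
  constructor
  · rw [integrable_indicator_iff hm]
    exact integrableOn_const (by rw [Real.volume_uIoc]; exact ENNReal.ofReal_ne_top)
  · rw [integral_indicator hm, setIntegral_const, Measure.real, Real.volume_uIoc,
      ENNReal.toReal_ofReal (abs_nonneg _), smul_eq_mul, mul_one, abs_sub_comm]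

lemma sum_sq_sub_of_sq_eq {ι κ : Type*} [Fintype ι] [Fintype κ] {p : ι → ℝ} {q : κ → ℝ}
    (hp : ∀ i, p i ^ 2 = p i) (hq : ∀ i, q i ^ 2 = q i) :
    ∑ i, ∑ k, (p i - q k) ^ 2 =
      Fintype.card κ * ∑ i, p i + Fintype.card ι * ∑ k, q k - 2 * (∑ i, p i) * ∑ k, q k := by
  have h : ∀ i k, (p i - q k) ^ 2 = p i + q k - 2 * (p i * q k) := by
    intro i k; linear_combination hp i + hq k
  simp only [h, Finset.sum_sub_distrib, Finset.sum_add_distrib, Finset.sum_const, nsmul_eq_mul,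
    Finset.card_univ, ← Finset.mul_sum, ← Finset.sum_mul]
  ring

/-- The total distance between `n + 1` and `n` points of the line is at least the sum of the
distances within the two groups. -/
lemma spread_add_spread_le {n : ℕ} (t : Fin (n + 1) → ℝ) (s : Fin n → ℝ) :
    spread t + spread s ≤ 2 * ∑ j, ∑ k, |t j - s k| := by
  set χ : ℝ → ℝ → ℝ := fun x z => if x < z then (1 : ℝ) else 0 with hχ
  have hI : ∀ x y, Integrable fun z => (χ x z - χ y z) ^ 2 :=
    fun x y => (integral_sq_indicator_sub x y).1
  have hE : ∀ x y, |x - y| = ∫ z, (χ x z - χ y z) ^ 2 :=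
    fun x y => (integral_sq_indicator_sub x y).2.symm
  have hsum : ∀ {p q : ℕ} (x : Fin p → ℝ) (y : Fin q → ℝ),
      Integrable (fun z => ∑ j, ∑ k, (χ (x j) z - χ (y k) z) ^ 2) ∧
      ∑ j, ∑ k, |x j - y k| = ∫ z, ∑ j, ∑ k, (χ (x j) z - χ (y k) z) ^ 2 := by
    intro p q x y
    have h1 : ∀ j, Integrable fun z => ∑ k, (χ (x j) z - χ (y k) z) ^ 2 :=
      fun j => integrable_finsetSum _ fun k _ => hI _ _
    refine ⟨integrable_finsetSum _ fun j _ => h1 j, ?_⟩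
    rw [integral_finsetSum _ fun j _ => h1 j]
    refine Finset.sum_congr rfl fun j _ => ?_
    rw [integral_finsetSum _ fun k _ => hI _ _]
    exact Finset.sum_congr rfl fun k _ => hE _ _
  rw [spread, spread, (hsum t t).2, (hsum s s).2, (hsum t s).2, ← integral_const_mul,
    ← integral_add (hsum t t).1 (hsum s s).1]
  refine integral_mono ((hsum t t).1.add (hsum s s).1) ((hsum t s).1.const_mul 2) fun z => ?_
  have hsq : ∀ x, χ x z ^ 2 = χ x z := by
    intro x; simp only [hχ]; split_ifs <;> norm_num
  simp only
  rw [sum_sq_sub_of_sq_eq (fun i => hsq (t i)) (fun i => hsq (t i)),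
    sum_sq_sub_of_sq_eq (fun i => hsq (s i)) (fun i => hsq (s i)),
    sum_sq_sub_of_sq_eq (fun i => hsq (t i)) (fun i => hsq (s i))]
  obtain ⟨A, hA⟩ : ∃ A : ℤ, ∑ i, χ (t i) z = A :=
    ⟨∑ i, if t i < z then 1 else 0, by simp [hχ]⟩
  obtain ⟨B, hB⟩ : ∃ B : ℤ, ∑ i, χ (s i) z = B :=
    ⟨∑ i, if s i < z then 1 else 0, by simp [hχ]⟩
  -- With A of the n + 1 points and B of the n points to the left of z, the difference of the two
  -- integrands is twice this product; it is nonnegative because A - B is an integer.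
  have hint : 0 ≤ (A - B) * (A - B - 1) := by
    rcases le_or_gt (A - B) 0 with h | h
    · nlinarith
    · have : 1 ≤ A - B := h
      nlinarith
  have hreal : (0 : ℝ) ≤ ((A : ℝ) - B) * ((A : ℝ) - B - 1) := by exact_mod_cast hint
  rw [hA, hB, Fintype.card_fin, Fintype.card_fin]
  push_cast
  nlinarith

/-- The previous inequality with a gain if `s` is far away from the origin. -/
lemma spread_add_spread_add_le {n : ℕ} {t : Fin (n + 1) → ℝ} {T : ℝ} (hT : ∀ j, |t j| ≤ T)
    (s : Fin n → ℝ) :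
    spread t + spread s + 2 * ∑ k, (|s k| - T) ≤ 2 * ∑ j, ∑ k, |t j - s k| ∧
    spread t + spread s ≤ 2 * ∑ j, ∑ k, |t j - s k| := by
  refine ⟨?_, spread_add_spread_le t s⟩
  have hT0 : 0 ≤ T := (abs_nonneg _).trans (hT 0)
  -- The points s are truncated to [-T, T]. Undoing the truncation by d_k raises the right side by
  -- 2(n + 1)∑ d_k and the left side by at most 2n ∑ d_k; the surplus 2 ∑ d_k is the gain.
  set s' : Fin n → ℝ := fun k => max (-T) (min (s k) T) with hs'
  have h1 := spread_add_spread_le t s'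
  have h2 : ∀ j k, |t j - s k| = |t j - s' k| + |s k - s' k| := by
    intro j k
    have htj := abs_le.1 (hT j)
    simp only [hs']
    rcases le_total (s k) T with h | h
    · rw [min_eq_left h]
      rcases le_total (-T) (s k) with h' | h'
      · rw [max_eq_right h']; simp
      · rw [max_eq_left h', abs_of_nonneg (by linarith), abs_of_nonneg (by linarith),
          abs_of_nonpos (by linarith)]; ring
    · rw [min_eq_right h, max_eq_right (by linarith), abs_of_nonpos (by linarith),
        abs_of_nonpos (by linarith), abs_of_nonneg (by linarith)]; ring
  have h3 : ∀ k, |s k| - T ≤ |s k - s' k| := by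
    intro k
    have h4 : |s' k| ≤ T := abs_le.2 ⟨le_max_left _ _, max_le (by linarith) (min_le_right _ _)⟩
    have := abs_sub_abs_le_abs_sub (s k) (s' k)
    linarith
  have h5 : spread s ≤ spread s' + 2 * n * ∑ k, |s k - s' k| := by
    have h : spread s ≤ ∑ j, ∑ k, (|s' j - s' k| + (|s j - s' j| + |s k - s' k|)) := by
      refine Finset.sum_le_sum fun j _ => Finset.sum_le_sum fun k _ => ?_
      have e : s j - s k = (s' j - s' k) + ((s j - s' j) - (s k - s' k)) := by ring
      rw [e]
      exact (abs_add_le _ _).trans (add_le_add le_rfl (abs_sub _ _))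
    refine h.trans (le_of_eq ?_)
    simp only [spread, Finset.sum_add_distrib, Finset.sum_const, Finset.card_univ, Fintype.card_fin,
      nsmul_eq_mul, ← Finset.mul_sum]
    ring
  have h6 : ∑ j, ∑ k, |t j - s k| = ∑ j, ∑ k, |t j - s' k| + (n + 1) * ∑ k, |s k - s' k| := by
    simp only [h2, Finset.sum_add_distrib, Finset.sum_const, Finset.card_univ, Fintype.card_fin,
      nsmul_eq_mul]
    push_cast; ring
  have h7 : ∑ k, (|s k| - T) ≤ ∑ k, |s k - s' k| := Finset.sum_le_sum fun k _ => h3 k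
  rw [h6]
  linarith

/-! ### The factors of the kernel function -/

/-- A factor of the kernel function. -/
def kerFactor (lam z : ℂ) : ℂ := (2 * Complex.cosh z) ^ (-lam)

lemma re_two_mul_cosh (z : ℂ) : (2 * Complex.cosh z).re = 2 * (Real.cosh z.re * Real.cos z.im) := by
  rw [← Complex.re_add_im z, Complex.cosh_add, Complex.cosh_mul_I, Complex.sinh_mul_I,
    ← Complex.ofReal_cosh, ← Complex.ofReal_cos, ← Complex.ofReal_sinh, ← Complex.ofReal_sin]
  simp [-Complex.ofReal_cos, -Complex.ofReal_sin, -Complex.ofReal_cosh, -Complex.ofReal_sinh]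

lemma two_mul_cosh_mem_slitPlane {z : ℂ} (hz : 0 < Real.cos z.im) :
    2 * Complex.cosh z ∈ Complex.slitPlane := by
  refine Or.inl ?_
  rw [re_two_mul_cosh]
  have := Real.cosh_pos z.re
  positivity

lemma cosh_ne_zero_of_cos_pos {z : ℂ} (hz : 0 < Real.cos z.im) : Complex.cosh z ≠ 0 := by
  intro h
  have := two_mul_cosh_mem_slitPlane hz
  rw [h, mul_zero] at this
  exact Complex.zero_notMem_slitPlane this

lemma hasDerivAt_kerFactor (lam : ℂ) {z : ℂ} (hz : 0 < Real.cos z.im) :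
    HasDerivAt (kerFactor lam) (-lam * Complex.tanh z * kerFactor lam z) z := by
  have h := ((Complex.hasDerivAt_cosh z).const_mul 2).cpow_const (c := -lam)
    (two_mul_cosh_mem_slitPlane hz)
  have h0 := cosh_ne_zero_of_cos_pos hz
  refine h.congr_deriv ?_
  rw [kerFactor, Complex.cpow_sub _ _ (mul_ne_zero two_ne_zero h0), Complex.cpow_one,
    Complex.tanh_eq_sinh_div_cosh]
  field_simp

lemma exp_abs_mul_le_norm_two_mul_cosh {z : ℂ} {κ : ℝ} (hκ : 0 ≤ κ) (hz : κ ≤ Real.cos z.im) :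
    κ * Real.exp |z.re| ≤ ‖2 * Complex.cosh z‖ := by
  refine le_trans ?_ (Complex.re_le_norm _)
  rw [re_two_mul_cosh]
  have h1 : Real.exp |z.re| ≤ 2 * Real.cosh z.re := by
    rw [← Real.cosh_abs, Real.cosh_eq]
    have := Real.exp_pos (-|z.re|)
    linarith
  have h2 : 0 < Real.exp |z.re| := Real.exp_pos _
  calc κ * Real.exp |z.re| ≤ Real.cos z.im * (2 * Real.cosh z.re) :=
        mul_le_mul hz h1 h2.le (hκ.trans hz)
    _ = _ := by ring

/-- The constant in the bound on the factors of the kernel function. -/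
def kerConst (lam : ℂ) (κ : ℝ) : ℝ := κ ^ (-lam.re) * Real.exp (Real.pi * |lam.im|)

lemma kerConst_nonneg (lam : ℂ) {κ : ℝ} (hκ : 0 < κ) : 0 ≤ kerConst lam κ :=
  mul_nonneg (Real.rpow_nonneg hκ.le _) (Real.exp_pos _).le

/-- The modulus of the complex power is a real power of |2 cosh z| times an exponential of arg · Im
λ. The crude bound |arg| ≤ π suffices for the latter. -/
lemma norm_kerFactor_le {lam : ℂ} (hlam : 0 ≤ lam.re) {z : ℂ} {κ : ℝ} (hκ : 0 < κ)
    (hz : κ ≤ Real.cos z.im) :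
    ‖kerFactor lam z‖ ≤ kerConst lam κ * Real.exp (-lam.re * |z.re|) := by
  have h0 : 2 * Complex.cosh z ≠ 0 :=
    mul_ne_zero two_ne_zero (cosh_ne_zero_of_cos_pos (hκ.trans_le hz))
  rw [kerFactor, Complex.norm_cpow_of_ne_zero h0, Complex.neg_re, Complex.neg_im, div_eq_mul_inv,
    ← Real.exp_neg]
  have h1 : ‖2 * Complex.cosh z‖ ^ (-lam.re) ≤ (κ * Real.exp |z.re|) ^ (-lam.re) :=
    Real.rpow_le_rpow_of_nonpos (mul_pos hκ (Real.exp_pos _))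
      (exp_abs_mul_le_norm_two_mul_cosh hκ.le hz) (by linarith)
  have h2 : (κ * Real.exp |z.re|) ^ (-lam.re) = κ ^ (-lam.re) * Real.exp (-lam.re * |z.re|) := by
    rw [Real.mul_rpow hκ.le (Real.exp_pos _).le, ← Real.exp_mul, mul_comm |z.re|]
  have h3 : Real.exp (-(Complex.arg (2 * Complex.cosh z) * -lam.im)) ≤
      Real.exp (Real.pi * |lam.im|) := by
    rw [Real.exp_le_exp, mul_neg, neg_neg]
    refine (le_abs_self _).trans ?_
    rw [abs_mul]
    exact mul_le_mul_of_nonneg_right (Complex.abs_arg_le_pi _) (abs_nonneg _)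
  calc _ ≤ (κ ^ (-lam.re) * Real.exp (-lam.re * |z.re|)) * Real.exp (Real.pi * |lam.im|) :=
        mul_le_mul (h1.trans h2.le) h3 (Real.exp_pos _).le
          (mul_nonneg (Real.rpow_nonneg hκ.le _) (Real.exp_pos _).le)
    _ = _ := by rw [kerConst]; ring

lemma norm_tanh_le {z : ℂ} {κ : ℝ} (hκ : 0 < κ) (hz : κ ≤ Real.cos z.im) :
    ‖Complex.tanh z‖ ≤ κ⁻¹ := by
  have h1 : ‖Complex.sinh z‖ ≤ Real.cosh z.re := by
    rw [Complex.sinh, norm_div, Complex.norm_two, Real.cosh_eq]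
    refine div_le_div_of_nonneg_right ((norm_sub_le _ _).trans ?_) zero_le_two
    rw [Complex.norm_exp, Complex.norm_exp, Complex.neg_re]
  have hc := Real.cosh_pos z.re
  have h2 : κ * Real.cosh z.re ≤ ‖Complex.cosh z‖ := by
    have h := Complex.re_le_norm (2 * Complex.cosh z)
    rw [re_two_mul_cosh, norm_mul, Complex.norm_two] at h
    nlinarith
  rw [Complex.tanh_eq_sinh_div_cosh, norm_div, div_le_iff₀ (lt_of_lt_of_le (by positivity) h2)]
  calc ‖Complex.sinh z‖ ≤ Real.cosh z.re := h1
    _ = κ⁻¹ * (κ * Real.cosh z.re) := by field_simp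
    _ ≤ _ := mul_le_mul_of_nonneg_left h2 (inv_nonneg.2 hκ.le)

/-! ### Products of functions of one variable -/

section prodFam

variable {𝕜 : Type} [NontriviallyNormedField 𝕜] [NormedAlgebra 𝕜 ℂ] {N : ℕ}

/-- The derivative family of a product of functions of one variable. -/
def prodFam (g m : Fin N → 𝕜 → ℂ) (S : Finset (Fin N)) (t : Fin N → 𝕜) : ℂ :=
  (∏ j, g j (t j)) * ∏ j ∈ S, m j (t j)

lemma hasDerivAt_prodFam {g m : Fin N → 𝕜 → ℂ} {c : ℂ} {S : Finset (Fin N)} {j : Fin N}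
    (hj : j ∉ S) {t : Fin N → 𝕜} (h : HasDerivAt (g j) (c * m j (t j) * g j (t j)) (t j)) :
    HasDerivAt (fun z => prodFam g m S (Function.update t j z)) (c * prodFam g m (insert j S) t)
      (t j) := by
  have h1 : ∀ z, prodFam g m S (Function.update t j z) =
      g j z * ((∏ k ∈ Finset.univ.erase j, g k (t k)) * ∏ k ∈ S, m k (t k)) := by
    intro z
    rw [prodFam, ← Finset.mul_prod_erase _ _ (Finset.mem_univ j), Function.update_self, mul_assoc]
    congr 2
    · exact Finset.prod_congr rfl fun k hk => by
        rw [Function.update_of_ne (Finset.ne_of_mem_erase hk)]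
    · exact Finset.prod_congr rfl fun k hk => by
        rw [Function.update_of_ne (fun h => hj (h ▸ hk) : k ≠ j)]
  simp only [h1]
  refine (h.mul_const _).congr_deriv ?_
  rw [prodFam, ← Finset.mul_prod_erase _ _ (Finset.mem_univ j), Finset.prod_insert hj]
  ring

lemma hasFDerivAt_prodFam_empty {g m : Fin N → 𝕜 → ℂ} {c : ℂ} {t : Fin N → 𝕜}
    (h : ∀ j, HasDerivAt (g j) (c * m j (t j) * g j (t j)) (t j)) :
    HasFDerivAt (fun t => prodFam g m ∅ t)
      (∑ j, (ContinuousLinearMap.proj j : (Fin N → 𝕜) →L[𝕜] 𝕜).smulRight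
        (c * prodFam g m {j} t)) t := by
  have key : ∀ A : Finset (Fin N), HasFDerivAt (fun t : Fin N → 𝕜 => ∏ j ∈ A, g j (t j))
      (∑ j ∈ A, (ContinuousLinearMap.proj j : (Fin N → 𝕜) →L[𝕜] 𝕜).smulRight
        (c * m j (t j) * ∏ j ∈ A, g j (t j))) t := by
    intro A
    induction A using Finset.induction_on with
    | empty => simpa using hasFDerivAt_const (1 : ℂ) t
    | insert j A hj ih =>
      simp only [Finset.prod_insert hj, Finset.sum_insert hj]
      have h1 : HasFDerivAt (fun t : Fin N → 𝕜 => g j (t j))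
          ((ContinuousLinearMap.proj j : (Fin N → 𝕜) →L[𝕜] 𝕜).smulRight
            (c * m j (t j) * g j (t j))) t :=
        (HasFDerivAt.comp (g := g j) t (h j).hasFDerivAt
          (ContinuousLinearMap.proj j : (Fin N → 𝕜) →L[𝕜] 𝕜).hasFDerivAt).congr_fderiv
          (by ext v; simp)
      refine (h1.mul ih).congr_fderiv ?_
      ext v
      simp only [add_apply, smul_apply,
        sum_apply, ContinuousLinearMap.smulRight_apply, smul_eq_mul,
        Finset.mul_sum, ContinuousLinearMap.proj_apply, mul_smul_comm]
      rw [add_comm]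
      congr 1
      · congr 1; ring
      · refine Finset.sum_congr rfl fun i _ => ?_
        congr 1; ring
  have h2 := key Finset.univ
  simp only [prodFam, Finset.prod_empty, mul_one, Finset.prod_singleton]
  refine h2.congr_fderiv (Finset.sum_congr rfl fun j _ => ?_)
  congr 1; ring

end prodFam

/-- Normal ordering and multi-affinity together: on a product of functions of one variable, the
operator multiplies by its symbol with the momenta replaced by m_j. Identities between operators
applied to the kernel thereby become matrix identities. -/
lemma opValue_prodFam {𝕜 : Type} {N : ℕ} {g m : Fin N → 𝕜 → ℂ} (k : ℕ) {v : Fin N → Fin N → ℂ}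
    (hv : ∀ i j, v i j = v j i) (x : Fin N → ℂ) (t : Fin N → 𝕜) :
    opValue k v x (fun B => prodFam g m B t) = prodFam g m ∅ t *
      ∑ U ∈ Finset.powersetCard k (Finset.univ : Finset (Fin N)),
        pairSum v (fun j => m j (t j) + x j) U := by
  rw [opValue, Finset.mul_sum]
  refine Finset.sum_congr rfl fun U _ => ?_
  rw [pairSum_add hv (fun j => m j (t j)) x, Finset.mul_sum]
  refine Finset.sum_congr rfl fun B _ => ?_
  simp only [prodFam, Finset.prod_empty]
  ring

/-! ### The derivative families of the kernel function -/

section kernelFamilies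

variable {n : ℕ}

/-- The kernel function times a plane wave, as a function of one variable `t_j`. -/
def tKer (lam u : ℂ) (r : Fin n → ℝ) (z : ℂ) : ℂ :=
  Complex.exp (Complex.I * u * z) * ∏ k, kerFactor lam (z - r k)

/-- The logarithmic derivative of `tKer`, divided by `I`. -/
def tMul (lam u : ℂ) (r : Fin n → ℝ) (z : ℂ) : ℂ :=
  u + Complex.I * lam * ∑ k, Complex.tanh (z - r k)

/-- The kernel function times a plane wave, as a function of one variable `s_k`. -/
def sKer (lam u : ℂ) (t : Fin n → ℂ) (x : ℝ) : ℂ :=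
  Complex.exp (-(Complex.I * u * x)) * ∏ j, kerFactor lam (t j - x)

/-- The logarithmic derivative of `sKer`, divided by `-I`. -/
def sMul (lam u : ℂ) (t : Fin n → ℂ) (x : ℝ) : ℂ :=
  u + Complex.I * lam * ∑ j, Complex.tanh (t j - x)

lemma hasDerivAt_tKer (lam u : ℂ) (r : Fin n → ℝ) {z : ℂ} (hz : 0 < Real.cos z.im) :
    HasDerivAt (tKer lam u r) (Complex.I * tMul lam u r z * tKer lam u r z) z := by
  have h1 : HasDerivAt (fun z => Complex.exp (Complex.I * u * z))
      (Complex.exp (Complex.I * u * z) * (Complex.I * u)) z := by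
    simpa using ((hasDerivAt_id z).const_mul (Complex.I * u)).cexp
  have h2 : HasDerivAt (fun z => ∏ k, kerFactor lam (z - r k))
      ((∑ k, -lam * Complex.tanh (z - r k)) * ∏ k, kerFactor lam (z - r k)) z := by
    refine hasDerivAt_prod_of_mul Finset.univ fun k _ => ?_
    have h : 0 < Real.cos (z - (r k : ℂ)).im := by simpa using hz
    exact (hasDerivAt_kerFactor lam h).comp_sub_const z (r k : ℂ)
  refine (h1.mul h2).congr_deriv ?_
  rw [tKer, tMul, ← Finset.mul_sum]
  linear_combination (-(lam * ∑ k, Complex.tanh (z - r k)) * (Complex.exp (Complex.I * u * z) *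
    ∏ k, kerFactor lam (z - r k))) * Complex.I_sq

lemma hasDerivAt_sKer (lam u : ℂ) {t : Fin n → ℂ} (ht : ∀ j, 0 < Real.cos (t j).im) (x : ℝ) :
    HasDerivAt (sKer lam u t) (-Complex.I * sMul lam u t x * sKer lam u t x) x := by
  have h1 : HasDerivAt (fun z : ℂ => Complex.exp (-(Complex.I * u * z)))
      (Complex.exp (-(Complex.I * u * x)) * -(Complex.I * u)) (x : ℂ) := by
    simpa using ((hasDerivAt_id (x : ℂ)).const_mul (Complex.I * u)).neg.cexp
  have h2 : HasDerivAt (fun z : ℂ => ∏ j, kerFactor lam (t j - z))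
      ((∑ j, lam * Complex.tanh (t j - x)) * ∏ j, kerFactor lam (t j - x)) (x : ℂ) := by
    refine hasDerivAt_prod_of_mul Finset.univ fun j _ => ?_
    have h : 0 < Real.cos (t j - (x : ℂ)).im := by simpa using ht j
    refine ((hasDerivAt_kerFactor lam h).comp_const_sub (t j) (x : ℂ)).congr_deriv ?_
    ring
  refine (h1.mul h2).comp_ofReal.congr_deriv ?_
  rw [sKer, sMul, ← Finset.mul_sum]
  linear_combination ((lam * ∑ j, Complex.tanh (t j - x)) * (Complex.exp (-(Complex.I * u * x)) *
    ∏ j, kerFactor lam (t j - x))) * Complex.I_sq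

/-- The open strip on which the kernel function is holomorphic for real integration variables. -/
def strip (N : ℕ) : Set (Fin N → ℂ) := {t | ∀ j, |(t j).im| < Real.pi / 2}

lemma isOpen_strip (N : ℕ) : IsOpen (strip N) := by
  simp only [strip, Set.ofPred_forall]
  refine isOpen_iInter_of_finite fun j => ?_
  exact isOpen_lt (Complex.continuous_im.comp (continuous_apply j)).abs continuous_const

lemma toC_mem_strip {N : ℕ} (s : Fin N → ℝ) : toC s ∈ strip N := by
  intro j
  simp [Real.pi_pos]

lemma cos_pos_of_mem_strip {N : ℕ} {t : Fin N → ℂ} (ht : t ∈ strip N) (j : Fin N) :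
    0 < Real.cos (t j).im :=
  Real.cos_pos_of_mem_Ioo (abs_lt.1 (ht j))

lemma continuousAt_kerFactor (lam : ℂ) {z : ℂ} (hz : 0 < Real.cos z.im) :
    ContinuousAt (kerFactor lam) z := (hasDerivAt_kerFactor lam hz).continuousAt

lemma continuousAt_tanh {z : ℂ} (hz : 0 < Real.cos z.im) : ContinuousAt Complex.tanh z := by
  have h : Complex.tanh = fun z => Complex.sinh z / Complex.cosh z := by
    ext z; exact Complex.tanh_eq_sinh_div_cosh z
  rw [h]
  exact Complex.continuous_sinh.continuousAt.div Complex.continuous_cosh.continuousAt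
    (cosh_ne_zero_of_cos_pos hz)

lemma continuousAt_comp_sub {X : Type*} [TopologicalSpace X] {f : ℂ → ℂ} {a : X → ℂ} {b : X → ℝ}
    {x : X} (hf : ∀ z : ℂ, 0 < Real.cos z.im → ContinuousAt f z) (ha : ContinuousAt a x)
    (hb : ContinuousAt b x) (hx : 0 < Real.cos (a x).im) :
    ContinuousAt (fun y => f (a y - b y)) x := by
  have h : 0 < Real.cos (a x - (b x : ℂ)).im := by simpa using hx
  exact ContinuousAt.comp (f := fun y => a y - (b y : ℂ)) (hf _ h)
    (ha.sub (Complex.continuous_ofReal.continuousAt.comp hb))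

/-- The derivative family of the kernel function times a plane wave, in the variables `t`. -/
def tFam {m : ℕ} (lam u : ℂ) (r : Fin n → ℝ) (S : Finset (Fin m)) (t : Fin m → ℂ) : ℂ :=
  prodFam (fun _ => tKer lam u r) (fun _ => tMul lam u r) S t

/-- The derivative family of the kernel function times a plane wave, in the variables `s`. -/
def sFam {m : ℕ} (lam u : ℂ) (t : Fin n → ℂ) (S : Finset (Fin m)) (s : Fin m → ℝ) : ℂ :=
  prodFam (fun _ => sKer lam u t) (fun _ => sMul lam u t) S s

lemma continuousAt_tFam {m : ℕ} (lam u : ℂ) (S : Finset (Fin m)) {t : Fin m → ℂ}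
    (ht : t ∈ strip m) (r : Fin n → ℝ) :
    ContinuousAt (fun p : (Fin m → ℂ) × (Fin n → ℝ) => tFam lam u p.2 S p.1) (t, r) := by
  have ha : ∀ j, ContinuousAt (fun p : (Fin m → ℂ) × (Fin n → ℝ) => p.1 j) (t, r) :=
    fun j => ((continuous_apply j).comp continuous_fst).continuousAt
  have hb : ∀ k, ContinuousAt (fun p : (Fin m → ℂ) × (Fin n → ℝ) => p.2 k) (t, r) :=
    fun k => ((continuous_apply k).comp continuous_snd).continuousAt
  unfold tFam prodFam tKer tMul
  refine ContinuousAt.mul ?_ ?_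
  · refine tendsto_finsetProd _ fun j _ => ContinuousAt.mul ?_ ?_
    · exact (continuousAt_const.mul (ha j)).cexp
    · exact tendsto_finsetProd _ fun k _ => continuousAt_comp_sub
        (fun z hz => continuousAt_kerFactor lam hz) (ha j) (hb k) (cos_pos_of_mem_strip ht j)
  · refine tendsto_finsetProd _ fun j _ => continuousAt_const.add (continuousAt_const.mul ?_)
    exact tendsto_finsetSum _ fun k _ => continuousAt_comp_sub
      (fun z hz => continuousAt_tanh hz) (ha j) (hb k) (cos_pos_of_mem_strip ht j)

lemma continuous_sFam {m : ℕ} (lam u : ℂ) {t : Fin n → ℂ} (ht : t ∈ strip n)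
    (S : Finset (Fin m)) : Continuous (sFam lam u t S) := by
  unfold sFam prodFam
  refine (continuous_finsetProd _ fun j _ => ?_).mul (continuous_finsetProd _ fun j _ => ?_)
  · have h : Continuous (sKer lam u t) := continuous_iff_continuousAt.2 fun x =>
      (hasDerivAt_sKer lam u (cos_pos_of_mem_strip ht) x).continuousAt
    exact h.comp (continuous_apply j)
  · unfold sMul
    refine continuous_const.add (continuous_const.mul (continuous_finsetSum _ fun k _ => ?_))
    refine continuous_iff_continuousAt.2 fun s => continuousAt_comp_sub
      (fun z hz => continuousAt_tanh hz) continuousAt_const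
      (continuous_apply j).continuousAt (cos_pos_of_mem_strip ht k)

lemma hasDerivAt_tFam {m : ℕ} (lam u : ℂ) (r : Fin n → ℝ) {S : Finset (Fin m)} {j : Fin m}
    (hj : j ∉ S) {t : Fin m → ℂ} (ht : 0 < Real.cos (t j).im) :
    HasDerivAt (fun z => tFam lam u r S (Function.update t j z))
      (Complex.I * tFam lam u r (insert j S) t) (t j) :=
  hasDerivAt_prodFam hj (hasDerivAt_tKer lam u r ht)

lemma derivFamily_sFam {m : ℕ} (lam u : ℂ) {t : Fin n → ℂ} (ht : t ∈ strip n) :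
    DerivFamily Set.univ (-Complex.I) (sFam lam u t : Finset (Fin m) → (Fin m → ℝ) → ℂ) :=
  fun _ _ hj _ _ => hasDerivAt_prodFam hj (hasDerivAt_sKer lam u (cos_pos_of_mem_strip ht) _)

lemma tFam_empty_eq {m : ℕ} (lam u : ℂ) (t : Fin m → ℂ) (r : Fin n → ℝ) :
    tFam lam u r ∅ t = Complex.exp (Complex.I * u * ∑ j, t j) *
      ∏ j, ∏ k, kerFactor lam (t j - r k) := by
  simp only [tFam, prodFam, tKer, Finset.prod_empty, mul_one, Finset.prod_mul_distrib,
    ← Complex.exp_sum, Finset.mul_sum]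

/-- The same kernel seen from the two sides: the plane wave in t accompanies the t-family and the
inverse plane wave in s the s-family. -/
lemma tFam_empty_mul {m : ℕ} (lam u : ℂ) (t : Fin m → ℂ) (r : Fin n → ℝ) :
    tFam lam u r ∅ t * Complex.exp (-(Complex.I * u * ∑ k, (r k : ℂ))) =
      Complex.exp (Complex.I * u * ∑ j, t j) * sFam lam u t ∅ r := by
  rw [tFam_empty_eq]
  simp only [sFam, prodFam, sKer, Finset.prod_empty, mul_one, Finset.prod_mul_distrib,
    ← Complex.exp_sum, Finset.mul_sum, Finset.sum_neg_distrib]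
  rw [Finset.prod_comm]
  ring

/-! ### Bounds on the families -/

lemma norm_prod_le_pow {ι : Type*} {N : ℕ} (S : Finset ι) (hS : S.card ≤ N) {f : ι → ℂ} {M : ℝ}
    (hM : 1 ≤ M) (h : ∀ i ∈ S, ‖f i‖ ≤ M) : ‖∏ i ∈ S, f i‖ ≤ M ^ N := by
  rw [norm_prod]
  calc ∏ i ∈ S, ‖f i‖ ≤ ∏ _i ∈ S, M := Finset.prod_le_prod (fun _ _ => norm_nonneg _) h
    _ = M ^ S.card := Finset.prod_const M
    _ ≤ M ^ N := pow_le_pow_right₀ hM hS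

lemma norm_kerProd_le {m : ℕ} {lam : ℂ} (hlam : 0 ≤ lam.re) {κ : ℝ} (hκ : 0 < κ) {t : Fin m → ℂ}
    (ht : ∀ j, κ ≤ Real.cos (t j).im) (r : Fin n → ℝ) :
    ‖∏ j, ∏ k, kerFactor lam (t j - r k)‖ ≤
      kerConst lam κ ^ (m * n) * Real.exp (-lam.re * ∑ j, ∑ k, |(t j).re - r k|) := by
  simp only [norm_prod]
  calc ∏ j, ∏ k, ‖kerFactor lam (t j - r k)‖ ≤
      ∏ j : Fin m, ∏ k : Fin n, kerConst lam κ * Real.exp (-lam.re * |(t j).re - r k|) := by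
        refine Finset.prod_le_prod (fun _ _ => Finset.prod_nonneg fun _ _ => norm_nonneg _)
          fun j _ => Finset.prod_le_prod (fun _ _ => norm_nonneg _) fun k _ => ?_
        have h : κ ≤ Real.cos (t j - (r k : ℂ)).im := by simpa using ht j
        simpa using norm_kerFactor_le hlam hκ h
    _ = _ := by
        simp only [Finset.prod_mul_distrib, Finset.prod_const, Finset.card_univ, Fintype.card_fin,
          ← Real.exp_sum, ← Finset.mul_sum]
        rw [← pow_mul, mul_comm n m]

/-- A bound on the factors `tMul` and `sMul`. -/
def mulConst (lam : ℂ) (u : ℝ) (n : ℕ) (κ : ℝ) : ℝ := 1 + |u| + ‖lam‖ * (n * κ⁻¹)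

lemma one_le_mulConst (lam : ℂ) (u : ℝ) (n : ℕ) {κ : ℝ} (hκ : 0 < κ) :
    1 ≤ mulConst lam u n κ := by
  have : 0 ≤ ‖lam‖ * (n * κ⁻¹) := by positivity
  have := abs_nonneg u
  unfold mulConst; linarith

lemma norm_add_I_mul_sum_tanh_le {lam : ℂ} (u : ℝ) {κ : ℝ} (hκ : 0 < κ) {z : Fin n → ℂ}
    (hz : ∀ k, κ ≤ Real.cos (z k).im) :
    ‖(u : ℂ) + Complex.I * lam * ∑ k, Complex.tanh (z k)‖ ≤ mulConst lam u n κ := by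
  refine (norm_add_le _ _).trans ?_
  have h : ‖∑ k, Complex.tanh (z k)‖ ≤ n * κ⁻¹ := by
    refine (norm_sum_le _ _).trans ?_
    calc ∑ k, ‖Complex.tanh (z k)‖ ≤ ∑ _k : Fin n, κ⁻¹ :=
          Finset.sum_le_sum fun k _ => norm_tanh_le hκ (hz k)
      _ = _ := by simp
  rw [norm_mul, norm_mul, Complex.norm_I, one_mul, Complex.norm_real, Real.norm_eq_abs, mulConst]
  have := mul_le_mul_of_nonneg_left h (norm_nonneg lam)
  linarith

lemma norm_tFam_le {m : ℕ} {lam : ℂ} (hlam : 0 ≤ lam.re) (u : ℝ) {κ : ℝ} (hκ : 0 < κ)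
    {t : Fin m → ℂ} (ht : ∀ j, κ ≤ Real.cos (t j).im) (hπ : ∀ j, |(t j).im| ≤ Real.pi)
    (S : Finset (Fin m)) (r : Fin n → ℝ) :
    ‖tFam lam u r S t‖ ≤ Real.exp (|u| * (m * Real.pi)) * kerConst lam κ ^ (m * n) *
      mulConst lam u n κ ^ m * Real.exp (-lam.re * ∑ j, ∑ k, |(t j).re - r k|) := by
  have h0 : tFam lam u r S t = Complex.exp (Complex.I * u * ∑ j, t j) *
      (∏ j, ∏ k, kerFactor lam (t j - r k)) * ∏ j ∈ S, tMul lam u r (t j) := by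
    rw [← tFam_empty_eq]; simp [tFam, prodFam]
  have h1 : ‖Complex.exp (Complex.I * u * ∑ j, t j)‖ ≤ Real.exp (|u| * (m * Real.pi)) := by
    rw [Complex.norm_exp, Real.exp_le_exp]
    have e : (Complex.I * u * ∑ j, t j).re = -(u * ∑ j, (t j).im) := by
      rw [mul_assoc, Complex.I_mul_re, Complex.im_ofReal_mul, Complex.im_sum]
    rw [e]
    refine (neg_le_abs _).trans ?_
    rw [abs_mul]
    refine mul_le_mul_of_nonneg_left ((Finset.abs_sum_le_sum_abs _ _).trans ?_) (abs_nonneg _)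
    calc ∑ j, |(t j).im| ≤ ∑ _j : Fin m, Real.pi := Finset.sum_le_sum fun j _ => hπ j
      _ = _ := by simp
  have h2 := norm_kerProd_le hlam hκ ht r
  have h3 : ‖∏ j ∈ S, tMul lam u r (t j)‖ ≤ mulConst lam u n κ ^ m := by
    refine norm_prod_le_pow S (by simpa using Finset.card_le_univ S) (one_le_mulConst lam u n hκ)
      fun j _ => norm_add_I_mul_sum_tanh_le u hκ fun k => ?_
    simpa using ht j
  rw [h0, norm_mul, norm_mul]
  have hk := pow_nonneg (kerConst_nonneg lam hκ) (m * n)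
  calc _ ≤ Real.exp (|u| * (m * Real.pi)) * (kerConst lam κ ^ (m * n) *
        Real.exp (-lam.re * ∑ j, ∑ k, |(t j).re - r k|)) * mulConst lam u n κ ^ m := by gcongr
    _ = _ := by ring

lemma norm_sFam_le {m : ℕ} {lam : ℂ} (hlam : 0 ≤ lam.re) (u : ℝ) {κ : ℝ} (hκ : 0 < κ)
    {t : Fin m → ℂ} (ht : ∀ j, κ ≤ Real.cos (t j).im) (S : Finset (Fin n)) (r : Fin n → ℝ) :
    ‖sFam lam u t S r‖ ≤ kerConst lam κ ^ (m * n) * mulConst lam u m κ ^ n *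
      Real.exp (-lam.re * ∑ j, ∑ k, |(t j).re - r k|) := by
  have h0 : sFam lam u t S r = Complex.exp (-(Complex.I * u * ∑ k, (r k : ℂ))) *
      (∏ j, ∏ k, kerFactor lam (t j - r k)) * ∏ k ∈ S, sMul lam u t (r k) := by
    simp only [sFam, prodFam, sKer, Finset.prod_mul_distrib,
      ← Complex.exp_sum, Finset.mul_sum, Finset.sum_neg_distrib]
    rw [Finset.prod_comm]
  have h1 : ‖Complex.exp (-(Complex.I * u * ∑ k, (r k : ℂ)))‖ = 1 := by
    rw [Complex.norm_exp, ← Complex.ofReal_sum, mul_assoc, ← Complex.ofReal_mul]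
    simp
  have h2 := norm_kerProd_le hlam hκ ht r
  have h3 : ‖∏ k ∈ S, sMul lam u t (r k)‖ ≤ mulConst lam u m κ ^ n := by
    refine norm_prod_le_pow S (by simpa using Finset.card_le_univ S) (one_le_mulConst lam u m hκ)
      fun k _ => norm_add_I_mul_sum_tanh_le u hκ fun j => ?_
    simpa using ht j
  rw [h0, norm_mul, norm_mul, h1, one_mul]
  have hk := pow_nonneg (kerConst_nonneg lam hκ) (m * n)
  calc _ ≤ (kerConst lam κ ^ (m * n) *
        Real.exp (-lam.re * ∑ j, ∑ k, |(t j).re - r k|)) * mulConst lam u m κ ^ n := by gcongr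
    _ = _ := by ring

end kernelFamilies

/-! ### The integral transform -/

section transform

variable {n : ℕ} {lam : ℂ} {f : (Fin n → ℝ) → ℂ}

/-- The bound on the eigenfunctions and their derivatives at real points. -/
def HasGrowth (lam : ℂ) (f : (Fin n → ℝ) → ℂ) : Prop :=
  ∀ δ : ℝ, 0 < δ → ∃ C, ∀ s, ‖f s‖ ≤
    C * (Real.exp (-(lam.re / 2) * spread s) * Real.exp (δ * ∑ k, |s k|))

/-- The integrand of the integral transform that raises the number of variables. -/
def kerIntegrand (lam u : ℂ) (f : (Fin n → ℝ) → ℂ) (S : Finset (Fin (n + 1))) (t : Fin (n + 1) → ℂ)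
    (r : Fin n → ℝ) : ℂ :=
  weightW lam (toC r) * (Complex.exp (-(Complex.I * u * ∑ k, (r k : ℂ))) * f r) * tFam lam u r S t

/-- The integral transform that raises the number of variables. -/
def kerInt (lam u : ℂ) (f : (Fin n → ℝ) → ℂ) (S : Finset (Fin (n + 1))) (t : Fin (n + 1) → ℂ) : ℂ :=
  (n.factorial : ℂ)⁻¹ * ∫ r, kerIntegrand lam u f S t r

/-- The constant in the bound on `tFam`. -/
def famConst (n : ℕ) (lam : ℂ) (u κ : ℝ) : ℝ :=
  Real.exp (|u| * ((n + 1 : ℕ) * Real.pi)) * kerConst lam κ ^ ((n + 1) * n) *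
    mulConst lam u n κ ^ (n + 1)

lemma famConst_nonneg (n : ℕ) (lam : ℂ) (u : ℝ) {κ : ℝ} (hκ : 0 < κ) : 0 ≤ famConst n lam u κ :=
  mul_nonneg (mul_nonneg (Real.exp_pos _).le (pow_nonneg (kerConst_nonneg lam hκ) _))
    (pow_nonneg (zero_le_one.trans (one_le_mulConst lam u n hκ)) _)

/-- Adding the exponents of weight, kernel and function leaves -(a/2) spread x - (a/2)E + δ ∑|r_k|,
where E is the excess in the distance inequality. As E ≥ 2(∑|r_k| - nT) and 2δ ≤ 1 ≤ a, the excess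
turns the growth δ ∑|r_k| into decay at the same rate, at the cost 2δnT. -/
lemma kernel_exponent_le {a δ T : ℝ} (ha : 1 ≤ a) (hδ : 0 < δ) (hδ' : δ ≤ 1 / 2)
    {x : Fin (n + 1) → ℝ} (hT : ∀ j, |x j| ≤ T) (r : Fin n → ℝ) :
    a * spread r + -a * (∑ j, ∑ k, |x j - r k|) + -(a / 2) * spread r + δ * ∑ k, |r k| ≤
      -(a / 2) * spread x + 2 * δ * (n * T) + -δ * ∑ k, |r k| := by
  obtain ⟨h1, h2⟩ := spread_add_spread_add_le hT r
  have h3 : ∑ k, (|r k| - T) = ∑ k, |r k| - n * T := by simp [Finset.sum_sub_distrib]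
  rw [h3] at h1
  set E := 2 * ∑ j, ∑ k, |x j - r k| - spread x - spread r with hE
  have h4 : 0 ≤ E := by linarith
  have h5 : 2 * (∑ k, |r k| - n * T) ≤ E := by linarith
  have h6 : 2 * δ * (∑ k, |r k| - n * T) ≤ a / 2 * E := by
    rcases le_total 0 (∑ k, |r k| - n * T) with h | h
    · nlinarith
    · have : 2 * δ * (∑ k, |r k| - n * T) ≤ 0 := mul_nonpos_of_nonneg_of_nonpos (by linarith) h
      have : 0 ≤ a / 2 * E := mul_nonneg (by linarith) h4
      linarith
  have h7 : a / 2 * E = a * ∑ j, ∑ k, |x j - r k| - a / 2 * spread x - a / 2 * spread r := by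
    rw [hE]; ring
  linarith

lemma norm_kerIntegrand_le (hlam : 1 ≤ lam.re) (u : ℝ) {δ C : ℝ} (hδ : 0 < δ) (hδ' : δ ≤ 1 / 2)
    (hf : ∀ s, ‖f s‖ ≤ C * (Real.exp (-(lam.re / 2) * spread s) * Real.exp (δ * ∑ k, |s k|)))
    {κ T : ℝ} (hκ : 0 < κ) {t : Fin (n + 1) → ℂ}
    (ht : ∀ j, κ ≤ Real.cos (t j).im) (hπ : ∀ j, |(t j).im| ≤ Real.pi)
    (hT : ∀ j, |(t j).re| ≤ T) (S : Finset (Fin (n + 1))) (r : Fin n → ℝ) :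
    ‖kerIntegrand lam u f S t r‖ ≤ (weightConst n lam.re * C * famConst n lam u κ *
      Real.exp (2 * δ * (n * T))) * Real.exp (-(lam.re / 2) * spread fun j => (t j).re) *
      Real.exp (-δ * ∑ k, |r k|) := by
  have h1 : ‖Complex.exp (-(Complex.I * u * ∑ k, (r k : ℂ)))‖ = 1 := by
    rw [Complex.norm_exp, ← Complex.ofReal_sum, mul_assoc, ← Complex.ofReal_mul]
    simp
  have h2 := norm_weightW_le hlam r
  have h3 := hf r
  have h4 : ‖tFam lam u r S t‖ ≤ famConst n lam u κ * _ :=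
    norm_tFam_le (by linarith) u hκ ht hπ S r
  have hw := weightConst_nonneg n lam.re
  have hC : 0 ≤ C := by
    by_contra hC
    have := (norm_nonneg _).trans h3
    have h5 : 0 < Real.exp (-(lam.re / 2) * spread r) * Real.exp (δ * ∑ k, |r k|) := by positivity
    nlinarith
  have hF := famConst_nonneg n lam u hκ
  have h5 := Real.exp_le_exp.2 (kernel_exponent_le hlam hδ hδ' hT r)
  rw [kerIntegrand, norm_mul, norm_mul, norm_mul, h1, one_mul]
  calc _ ≤ (weightConst n lam.re * Real.exp (lam.re * spread r)) *
        (C * (Real.exp (-(lam.re / 2) * spread r) * Real.exp (δ * ∑ k, |r k|))) *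
        (famConst n lam u κ * Real.exp (-lam.re * ∑ j, ∑ k, |(t j).re - r k|)) := by gcongr
    _ = weightConst n lam.re * C * famConst n lam u κ *
        Real.exp (lam.re * spread r + -lam.re * (∑ j, ∑ k, |(t j).re - r k|) +
          -(lam.re / 2) * spread r + δ * ∑ k, |r k|) := by
      simp only [Real.exp_add]; ring
    _ ≤ weightConst n lam.re * C * famConst n lam u κ * _ :=
      mul_le_mul_of_nonneg_left h5 (mul_nonneg (mul_nonneg hw hC) hF)
    _ = _ := by simp only [Real.exp_add]; ring

lemma continuous_kerIntegrand (hlam : 1 ≤ lam.re) (u : ℂ) (hf : Continuous f)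
    (S : Finset (Fin (n + 1))) {t : Fin (n + 1) → ℂ} (ht : t ∈ strip (n + 1)) :
    Continuous (kerIntegrand lam u f S t) := by
  have h : Continuous fun r : Fin n → ℝ => tFam lam u r S t :=
    continuous_iff_continuousAt.2 fun r =>
      ContinuousAt.comp (f := fun r => (t, r)) (continuousAt_tFam lam u S ht r)
        (continuous_const.prodMk continuous_id).continuousAt
  have h2 : Continuous fun r : Fin n → ℝ => Complex.exp (-(Complex.I * u * ∑ k, (r k : ℂ))) := by
    fun_prop
  exact ((continuous_weightW (by linarith)).mul (h2.mul hf)).mul h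

lemma continuousAt_kerIntegrand (u : ℂ) (S : Finset (Fin (n + 1))) {t : Fin (n + 1) → ℂ}
    (ht : t ∈ strip (n + 1)) (r : Fin n → ℝ) :
    ContinuousAt (fun t => kerIntegrand lam u f S t r) t :=
  continuousAt_const.mul (ContinuousAt.comp (f := fun t => (t, r)) (continuousAt_tFam lam u S ht r)
    (continuous_id.prodMk continuous_const).continuousAt)

/-- Locally uniform domination of the integrands. -/
lemma exists_dominating (hlam : 1 ≤ lam.re) (u : ℝ) (hf : HasGrowth lam f)
    {t₀ : Fin (n + 1) → ℂ} (ht₀ : t₀ ∈ strip (n + 1)) :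
    ∃ V : Set (Fin (n + 1) → ℂ), IsOpen V ∧ t₀ ∈ V ∧ V ⊆ strip (n + 1) ∧
      ∃ b : (Fin n → ℝ) → ℝ, Integrable b ∧
        ∀ t ∈ V, ∀ S r, ‖kerIntegrand lam u f S t r‖ ≤ b r := by
  -- The largest rate admitted by `kernel_exponent_le`; any smaller positive one would also do.
  obtain ⟨C, hC⟩ := hf (1 / 2) (by norm_num)
  obtain ⟨j₀, hj₀⟩ := Finite.exists_min fun j => Real.cos (t₀ j).im
  set κ := Real.cos (t₀ j₀).im / 2 with hκ
  have hκ0 : 0 < κ := half_pos (cos_pos_of_mem_strip ht₀ j₀)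
  set T := 1 + ∑ j, |(t₀ j).re| with hT
  refine ⟨strip (n + 1) ∩ {t | ∀ j, κ < Real.cos (t j).im ∧ |(t j).re| < T}, ?_, ⟨ht₀, ?_⟩,
    Set.inter_subset_left, fun r => (weightConst n lam.re * C * famConst n lam u κ *
      Real.exp (2 * (1 / 2) * (n * T))) * 1 * Real.exp (-(1 / 2) * ∑ k, |r k|), ?_, ?_⟩
  · refine (isOpen_strip _).inter ?_
    simp only [Set.ofPred_forall]
    refine isOpen_iInter_of_finite fun j => ?_
    exact (isOpen_lt continuous_const (Real.continuous_cos.comp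
      (Complex.continuous_im.comp (continuous_apply j)))).inter
      (isOpen_lt (Complex.continuous_re.comp (continuous_apply j)).abs continuous_const)
  · intro j
    have h1 := hj₀ j
    have h2 : |(t₀ j).re| ≤ ∑ j, |(t₀ j).re| :=
      Finset.single_le_sum (f := fun j => |(t₀ j).re|) (fun _ _ => abs_nonneg _) (Finset.mem_univ j)
    have h3 := cos_pos_of_mem_strip ht₀ j₀
    constructor
    · linarith
    · linarith
  · exact (integrable_exp_neg_mul_sum_abs n (by norm_num)).const_mul _
  · rintro t ⟨ht, ht'⟩ S r
    have hpi := Real.pi_pos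
    have h := norm_kerIntegrand_le hlam u (by norm_num) le_rfl hC hκ0 (fun j => (ht' j).1.le)
      (fun j => (ht j).le.trans (by linarith)) (fun j => (ht' j).2.le) S r
    refine h.trans ?_
    have hC0 : 0 ≤ C := by
      have h1 := (norm_nonneg _).trans (hC 0)
      by_contra hC
      have h5 : 0 < Real.exp (-(lam.re / 2) * spread (0 : Fin n → ℝ)) *
        Real.exp (1 / 2 * ∑ k, |(0 : Fin n → ℝ) k|) := by positivity
      nlinarith
    have hw := weightConst_nonneg n lam.re
    have hF := famConst_nonneg n lam u hκ0
    have h1 : Real.exp (-(lam.re / 2) * spread fun j => (t j).re) ≤ 1 := by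
      rw [Real.exp_le_one_iff]
      have := spread_nonneg fun j => (t j).re
      nlinarith
    have hA : 0 ≤ weightConst n lam.re * C * famConst n lam u κ *
        Real.exp (2 * (1 / 2) * (n * T)) := by positivity
    exact mul_le_mul_of_nonneg_right (mul_le_mul_of_nonneg_left h1 hA) (Real.exp_pos _).le

lemma integrable_kerIntegrand (hlam : 1 ≤ lam.re) (u : ℝ) (hfc : Continuous f)
    (hf : HasGrowth lam f) (S : Finset (Fin (n + 1))) {t : Fin (n + 1) → ℂ}
    (ht : t ∈ strip (n + 1)) : Integrable (kerIntegrand lam u f S t) := by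
  obtain ⟨V, -, htV, -, b, hb, hVb⟩ := exists_dominating hlam u hf ht
  exact hb.mono' (continuous_kerIntegrand hlam u hfc S ht).aestronglyMeasurable
    (Eventually.of_forall fun r => hVb t htV S r)

lemma continuousOn_kerInt (hlam : 1 ≤ lam.re) (u : ℝ) (hfc : Continuous f) (hf : HasGrowth lam f)
    (S : Finset (Fin (n + 1))) :
    ContinuousOn (kerInt lam u f S) (strip (n + 1)) := by
  intro t ht
  obtain ⟨V, hV, htV, hVs, b, hb, hVb⟩ := exists_dominating hlam u hf ht
  refine ContinuousAt.continuousWithinAt (continuousAt_const.mul ?_)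
  refine continuousAt_of_dominated ?_ ?_ hb
    (Eventually.of_forall fun r => continuousAt_kerIntegrand _ S ht r)
  · filter_upwards [hV.mem_nhds htV] with t ht
    exact (continuous_kerIntegrand hlam u hfc S (hVs ht)).aestronglyMeasurable
  · filter_upwards [hV.mem_nhds htV] with t ht
    exact Eventually.of_forall fun r => hVb t ht S r

lemma derivFamily_kerInt (hlam : 1 ≤ lam.re) (u : ℝ) (hfc : Continuous f) (hf : HasGrowth lam f) :
    DerivFamily (strip (n + 1)) Complex.I (kerInt lam u f) := by
  intro S j hj t ht
  obtain ⟨V, hV, htV, hVs, b, hb, hVb⟩ := exists_dominating hlam u hf ht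
  have hmem := eventually_update_mem hV htV j
  have h := (hasDerivAt_integral_of_dominated_loc_of_deriv_le (μ := (volume : Measure (Fin n → ℝ)))
    (F := fun z r => kerIntegrand lam u f S (Function.update t j z) r)
    (F' := fun z r => Complex.I * kerIntegrand lam u f (insert j S) (Function.update t j z) r)
    (bound := b) (x₀ := t j) hmem ?_ ?_ ?_ ?_ hb ?_).2
  · refine (h.const_mul _).congr_deriv ?_
    rw [Function.update_eq_self, integral_const_mul, kerInt]
    ring
  · filter_upwards [hmem] with z hz
    exact (continuous_kerIntegrand hlam u hfc S (hVs hz)).aestronglyMeasurable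
  · rw [Function.update_eq_self]
    exact integrable_kerIntegrand hlam u hfc hf S ht
  · rw [Function.update_eq_self]
    exact (continuous_const.mul
      (continuous_kerIntegrand hlam u hfc _ ht)).aestronglyMeasurable
  · refine Eventually.of_forall fun r z hz => ?_
    rw [norm_mul, Complex.norm_I, one_mul]
    exact hVb _ hz _ r
  · refine Eventually.of_forall fun r z hz => ?_
    have h1 := (hasDerivAt_tFam lam u r hj (cos_pos_of_mem_strip (hVs hz) j)).const_mul
      (weightW lam (toC r) * (Complex.exp (-(Complex.I * u * ∑ k, (r k : ℂ))) * f r))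
    simp only [Function.update_self, Function.update_idem] at h1
    refine h1.congr_deriv ?_
    rw [kerIntegrand]
    ring

lemma differentiableOn_kerInt (hlam : 1 ≤ lam.re) (u : ℝ) (hfc : Continuous f)
    (hf : HasGrowth lam f) : DifferentiableOn ℂ (kerInt lam u f ∅) (strip (n + 1)) := by
  intro t ht
  obtain ⟨V, hV, htV, hVs, b, hb, hVb⟩ := exists_dominating hlam u hf ht
  refine DifferentiableAt.differentiableWithinAt (DifferentiableAt.const_mul ?_ _)
  refine (hasFDerivAt_integral_of_dominated_of_fderiv_le
    (μ := (volume : Measure (Fin n → ℝ))) (𝕜 := ℂ)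
    (F := fun t r => kerIntegrand lam u f ∅ t r)
    (F' := fun t r => ∑ j, (ContinuousLinearMap.proj j : (Fin (n + 1) → ℂ) →L[ℂ] ℂ).smulRight
      (Complex.I * kerIntegrand lam u f {j} t r))
    (bound := fun r => ∑ j, ‖(ContinuousLinearMap.proj j : (Fin (n + 1) → ℂ) →L[ℂ] ℂ)‖ * b r)
    (hV.mem_nhds htV) ?_ ?_ ?_ ?_ ?_ ?_).differentiableAt
  · filter_upwards [hV.mem_nhds htV] with t ht
    exact (continuous_kerIntegrand hlam u hfc _ (hVs ht)).aestronglyMeasurable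
  · exact integrable_kerIntegrand hlam u hfc hf _ ht
  · refine Continuous.aestronglyMeasurable (continuous_finsetSum _ fun j _ => ?_)
    exact (ContinuousLinearMap.smulRightL ℂ (Fin (n + 1) → ℂ) ℂ
      (ContinuousLinearMap.proj j)).continuous.comp
      (continuous_const.mul (continuous_kerIntegrand hlam u hfc {j} ht))
  · refine Eventually.of_forall fun r t ht => (norm_sum_le _ _).trans
      (Finset.sum_le_sum fun j _ => ?_)
    rw [ContinuousLinearMap.norm_smulRight_apply, norm_mul, Complex.norm_I, one_mul]
    exact mul_le_mul_of_nonneg_left (hVb t ht _ r) (norm_nonneg _)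
  · exact integrable_finsetSum _ fun j _ => hb.const_mul _
  · refine Eventually.of_forall fun r t ht => ?_
    have h1 := (hasFDerivAt_prodFam_empty (c := Complex.I) (t := t)
      fun j => hasDerivAt_tKer lam u r (cos_pos_of_mem_strip (hVs ht) j)).const_mul
      (weightW lam (toC r) * (Complex.exp (-(Complex.I * u * ∑ k, (r k : ℂ))) * f r))
    refine h1.congr_fderiv ?_
    ext v
    simp only [smul_apply, sum_apply, ContinuousLinearMap.smulRight_apply, smul_eq_mul,
      Finset.mul_sum, kerIntegrand, tFam]
    refine Finset.sum_congr rfl fun j _ => ?_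
    ring

/-- The exponent -(Re λ/2) spread reproduces itself, and the only loss is exp(2δnT) with T = ∑|s_j|.
It can be made smaller than any prescribed exponential because the bound on f is available for every
δ > 0. -/
lemma hasGrowth_kerInt (hlam : 1 ≤ lam.re) (u : ℝ) (hf : HasGrowth lam f)
    (S : Finset (Fin (n + 1))) :
    HasGrowth lam fun s : Fin (n + 1) → ℝ => kerInt lam u f S (toC s) := by
  intro ε hε
  -- This gives 2δn ≤ ε; the summand 1 keeps the denominator positive for n = 0.
  set δ := min (1 / 2) (ε / (2 * n + 1)) with hδ
  have hn : (0 : ℝ) < 2 * n + 1 := by positivity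
  have hδ0 : 0 < δ := lt_min (by norm_num) (div_pos hε hn)
  have hδε : 2 * δ * n ≤ ε := by
    have h1 : δ * (2 * n + 1) ≤ ε := (le_div_iff₀ hn).1 (min_le_right _ _)
    nlinarith
  obtain ⟨C, hC⟩ := hf δ hδ0
  have hC0 : 0 ≤ C := by
    have h1 := (norm_nonneg _).trans (hC 0)
    by_contra hC
    have h5 : 0 < Real.exp (-(lam.re / 2) * spread (0 : Fin n → ℝ)) *
      Real.exp (δ * ∑ k, |(0 : Fin n → ℝ) k|) := by positivity
    nlinarith
  set J := ∫ r : Fin n → ℝ, Real.exp (-δ * ∑ k, |r k|) with hJ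
  have hJ0 : 0 ≤ J := integral_nonneg fun r => (Real.exp_pos _).le
  have hw := weightConst_nonneg n lam.re
  have hF := famConst_nonneg n lam u one_pos
  refine ⟨‖(n.factorial : ℂ)⁻¹‖ * (weightConst n lam.re * C * famConst n lam u 1 * J), fun s => ?_⟩
  simp only [kerInt]
  rw [norm_mul, mul_assoc]
  refine mul_le_mul_of_nonneg_left ?_ (norm_nonneg _)
  set T := ∑ j, |s j| with hT
  have hTj : ∀ j, |s j| ≤ T := fun j =>
    Finset.single_le_sum (f := fun j => |s j|) (fun _ _ => abs_nonneg _) (Finset.mem_univ j)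
  have hT0 : 0 ≤ T := Finset.sum_nonneg fun _ _ => abs_nonneg _
  have hb : ∀ r, ‖kerIntegrand lam u f S (toC s) r‖ ≤ _ := fun r =>
    norm_kerIntegrand_le hlam u hδ0 (min_le_left _ _) hC one_pos (t := toC s) (T := T)
      (fun j => by simp) (fun j => by simp [Real.pi_pos.le]) (fun j => by simpa using hTj j) S r
  refine (norm_integral_le_of_norm_le
    ((integrable_exp_neg_mul_sum_abs n hδ0).const_mul _) (Eventually.of_forall hb)).trans ?_
  rw [integral_const_mul]
  simp only [toC_apply, Complex.ofReal_re]
  have h1 : Real.exp (2 * δ * (n * T)) ≤ Real.exp (ε * T) := by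
    rw [Real.exp_le_exp]; nlinarith
  calc _ ≤ weightConst n lam.re * C * famConst n lam u 1 * Real.exp (ε * T) *
        Real.exp (-(lam.re / 2) * spread s) * J := by gcongr
    _ = _ := by ring

end transform

/-! ### Elementary symmetric functions -/

lemma elemSymm_zero {N : ℕ} (u : Fin N → ℝ) : elemSymm 0 u = 1 := by
  simp [elemSymm, Multiset.esymm]

lemma elemSymm_succ {n : ℕ} (k : ℕ) (u : Fin (n + 1) → ℝ) :
    elemSymm (k + 1) u = elemSymm (k + 1) (fun j : Fin n => u j.castSucc) +
      u (Fin.last n) * elemSymm k (fun j : Fin n => u j.castSucc) := by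
  have h : (Finset.univ : Finset (Fin (n + 1))).val.map u =
      u (Fin.last n) ::ₘ (Finset.univ : Finset (Fin n)).val.map fun j => u j.castSucc := by
    rw [Fin.univ_castSuccEmb, Finset.cons_val, Finset.map_val, Multiset.map_cons, Multiset.map_map]
    rfl
  rw [elemSymm, h, Multiset.esymm, Multiset.powersetCard_cons, Multiset.map_add, Multiset.sum_add,
    Multiset.map_map]
  simp only [Function.comp_def, Multiset.prod_cons, Multiset.sum_map_mul_left]
  rfl

lemma opValue_zero {N : ℕ} (v : Fin N → Fin N → ℂ) (x : Fin N → ℂ) (g : Finset (Fin N) → ℂ) :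
    opValue 0 v x g = g ∅ := by
  simp [opValue, pairSum_empty]

lemma mul_opValue {N : ℕ} (k : ℕ) (v : Fin N → Fin N → ℂ) (x : Fin N → ℂ) (c : ℂ)
    (g : Finset (Fin N) → ℂ) : opValue k v x (fun B => c * g B) = c * opValue k v x g := by
  simp only [opValue, Finset.mul_sum]
  exact Finset.sum_congr rfl fun U _ => Finset.sum_congr rfl fun B _ => by ring

lemma opValue_integral {α : Type*} [MeasurableSpace α] {μ : Measure α} {N : ℕ} (k : ℕ)
    (v : Fin N → Fin N → ℂ) (x : Fin N → ℂ) {g : Finset (Fin N) → α → ℂ}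
    (hg : ∀ B, Integrable (g B) μ) :
    opValue k v x (fun B => ∫ a, g B a ∂μ) = ∫ a, opValue k v x (fun B => g B a) ∂μ := by
  simp only [opValue]
  rw [integral_finsetSum _ fun U _ => integrable_finsetSum _ fun B _ => (hg B).const_mul _]
  refine Finset.sum_congr rfl fun U _ => ?_
  rw [integral_finsetSum _ fun B _ => (hg B).const_mul _]
  exact Finset.sum_congr rfl fun B _ => (integral_const_mul _ _).symm

/-! ### Families of joint eigenfunctions -/

lemma sinh_ne_zero_of_abs_im_lt {z : ℂ} (hz : z ≠ 0) (him : |z.im| < Real.pi) :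
    Complex.sinh z ≠ 0 := by
  intro h
  have h1 : Complex.sin (z * Complex.I) = 0 := by rw [Complex.sin_mul_I, h, zero_mul]
  obtain ⟨k, hk⟩ := Complex.sin_eq_zero_iff.1 h1
  have h2 : z = -(k * Real.pi * Complex.I) := by
    linear_combination -Complex.I * hk + z * Complex.I_sq
  have h3 : z.im = -(k * Real.pi) := by rw [h2]; simp
  rw [h3, abs_neg, abs_mul, abs_of_pos Real.pi_pos] at him
  have h4 : |(k : ℝ)| < 1 := by
    by_contra h
    have := Real.pi_pos
    nlinarith [not_lt.1 h]
  have h5 : k = 0 := by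
    have : |k| < 1 := by exact_mod_cast h4
    exact Int.abs_lt_one_iff.1 this
  exact hz (by rw [h2, h5]; simp)

lemma sinh_sub_ne_zero_of_mem_strip {N : ℕ} {t : Fin N → ℂ} (ht : t ∈ strip N)
    (hinj : Function.Injective t) (j k : Fin N) (hjk : j ≠ k) : Complex.sinh (t j - t k) ≠ 0 := by
  refine sinh_ne_zero_of_abs_im_lt (sub_ne_zero.2 (hinj.ne hjk)) ?_
  rw [Complex.sub_im]
  refine (abs_sub _ _).trans_lt ?_
  have h1 := ht j
  have h2 := ht k
  linarith

/-- A derivative family on the strip whose function is a joint eigenfunction of the operators, with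
the growth needed in the integral transform. -/
structure IsEigenFamily {N : ℕ} (lam : ℂ) (u : Fin N → ℝ)
    (g : Finset (Fin N) → (Fin N → ℂ) → ℂ) : Prop where
  derivFamily : DerivFamily (strip N) Complex.I g
  continuousOn : ∀ S, ContinuousOn (g S) (strip N)
  differentiableOn : DifferentiableOn ℂ (g ∅) (strip N)
  hasGrowth : ∀ S, HasGrowth lam fun s => g S (toC s)
  eigen : ∀ k, ∀ t ∈ strip N, Function.Injective t →
    opValue k (pairW lam t) (diagW lam t) (fun B => g B t) = elemSymm k u * g ∅ t

section IsEigenFamily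

variable {n : ℕ} {lam : ℂ}

/-- The induction starts with no variables and the constant 1; the plane wave in one variable is
then the first instance of the transform. -/
lemma isEigenFamily_one (lam : ℂ) (u : Fin 0 → ℝ) : IsEigenFamily lam u fun _ _ => 1 where
  derivFamily := fun _ j => j.elim0
  continuousOn := fun _ => continuousOn_const
  differentiableOn := differentiableOn_const _
  hasGrowth := fun _ δ _ => ⟨1, fun s => by simp [spread]⟩
  eigen := by
    intro k t _ _
    cases k with
    | zero => simp [opValue_zero, elemSymm_zero]
    | succ k =>
      have h : Finset.powersetCard (k + 1) (∅ : Finset (Fin 0)) = ∅ :=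
        Finset.powersetCard_eq_empty.2 (by simp)
      simp [opValue, elemSymm, Multiset.esymm, Multiset.powersetCard_zero_right, h]

lemma IsEigenFamily.continuous_toC {u : Fin n → ℝ} {g : Finset (Fin n) → (Fin n → ℂ) → ℂ}
    (hg : IsEigenFamily lam u g) (S : Finset (Fin n)) : Continuous fun s => g S (toC s) :=
  (hg.continuousOn S).comp_continuous CalogeroMoser.continuous_toC toC_mem_strip

lemma IsEigenFamily.derivFamily_toC {u : Fin n → ℝ} {g : Finset (Fin n) → (Fin n → ℂ) → ℂ}
    (hg : IsEigenFamily lam u g) :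
    DerivFamily Set.univ Complex.I fun S (s : Fin n → ℝ) => g S (toC s) := by
  intro S j hj s _
  have h := (hg.derivFamily S j hj (toC s) (toC_mem_strip s)).comp_ofReal
  simpa only [toC_update] using h

lemma opValue_tFam (k : ℕ) (lam u : ℂ) (r : Fin n → ℝ) {t : Fin (n + 1) → ℂ}
    (ht : ∀ j k, j ≠ k → Complex.sinh (t j - t k) ≠ 0) :
    opValue k (pairW lam t) (diagW lam t) (fun B => tFam lam u r B t) =
      tFam lam u r ∅ t * symMat k (kernelLaxT lam u t (toC r)) := by
  unfold tFam
  rw [opValue_prodFam k (pairW_symm lam t), kernelLaxT, symMat_diagOff_laxOff lam ht]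
  rfl

lemma opValue_sFam (k : ℕ) (lam u : ℂ) {r : Fin n → ℝ} (hr : Function.Injective r)
    (t : Fin (n + 1) → ℂ) :
    opValue k (pairW lam (toC r)) (fun j => -diagW lam (toC r) j) (fun B => sFam lam u t B r) =
      sFam lam u t ∅ r * symMat k (kernelLaxS lam u t (toC r)) := by
  unfold sFam
  rw [opValue_prodFam k (pairW_symm lam _), kernelLaxS,
    symMat_diagOff_laxOff lam (t := toC r) fun j k hjk => sinh_sub_ofReal_ne (hr.ne hjk)]
  rfl

/-- The bound that allows integrations by parts. -/
lemma exists_norm_sFam_mul_le (hlam : 1 ≤ lam.re) (u : ℝ) {ψ : Finset (Fin n) → (Fin n → ℝ) → ℂ}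
    (hψ : ∀ S, HasGrowth lam (ψ S)) {t : Fin (n + 1) → ℂ} (ht : t ∈ strip (n + 1)) :
    ∃ C, ∀ T S s, ‖sFam lam u t T s * ψ S s‖ ≤
      C * (Real.exp (-lam.re * spread s) * Real.exp (-(1 / 2) * ∑ k, |s k|)) := by
  obtain ⟨j₀, hj₀⟩ := Finite.exists_min fun j => Real.cos (t j).im
  set κ := Real.cos (t j₀).im
  have hκ : 0 < κ := cos_pos_of_mem_strip ht j₀
  set R := ∑ j, |(t j).re|
  have hR : ∀ j, |(t j).re| ≤ R := fun j =>
    Finset.single_le_sum (f := fun j => |(t j).re|) (fun _ _ => abs_nonneg _) (Finset.mem_univ j)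
  choose C hC using fun S => hψ S (1 / 2) (by norm_num)
  set A := kerConst lam κ ^ ((n + 1) * n) * mulConst lam u (n + 1) κ ^ n
  have hA : 0 ≤ A := mul_nonneg (pow_nonneg (kerConst_nonneg lam hκ) _)
    (pow_nonneg (zero_le_one.trans (one_le_mulConst lam u _ hκ)) _)
  refine ⟨A * (∑ S, |C S|) * Real.exp (lam.re * (n * R)), fun T S s => ?_⟩
  have h1 : ‖sFam lam u t T s‖ ≤ A * _ := norm_sFam_le (by linarith) u hκ hj₀ T s
  have h2 : ‖ψ S s‖ ≤ (∑ S, |C S|) * (Real.exp (-(lam.re / 2) * spread s) *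
      Real.exp (1 / 2 * ∑ k, |s k|)) := by
    refine (hC S s).trans (mul_le_mul_of_nonneg_right ?_ (by positivity))
    exact (le_abs_self _).trans (Finset.single_le_sum (f := fun S => |C S|)
      (fun _ _ => abs_nonneg _) (Finset.mem_univ S))
  have h3 := (spread_add_spread_add_le (t := fun j => (t j).re) hR s).1
  have h4 : ∑ k, (|s k| - R) = ∑ k, |s k| - n * R := by simp [Finset.sum_sub_distrib]
  have h5 := spread_nonneg fun j => (t j).re
  have h6 : 0 ≤ ∑ k, |s k| := Finset.sum_nonneg fun _ _ => abs_nonneg _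
  have h7 : 0 ≤ ∑ S, |C S| := Finset.sum_nonneg fun _ _ => abs_nonneg _
  have h8 : -lam.re * (∑ j, ∑ k, |(t j).re - s k|) + -(lam.re / 2) * spread s +
      1 / 2 * ∑ k, |s k| ≤
      lam.re * (n * R) + -lam.re * spread s + -(1 / 2) * ∑ k, |s k| := by
    rw [h4] at h3
    have h9 : lam.re / 2 * (spread s + 2 * (∑ k, |s k| - n * R)) ≤
        lam.re / 2 * (2 * ∑ j, ∑ k, |(t j).re - s k|) :=
      mul_le_mul_of_nonneg_left (by linarith) (by linarith)
    nlinarith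
  rw [norm_mul]
  calc _ ≤ (A * Real.exp (-lam.re * ∑ j, ∑ k, |(t j).re - s k|)) * ((∑ S, |C S|) *
        (Real.exp (-(lam.re / 2) * spread s) * Real.exp (1 / 2 * ∑ k, |s k|))) := by gcongr
    _ = A * (∑ S, |C S|) * Real.exp (-lam.re * (∑ j, ∑ k, |(t j).re - s k|) +
        -(lam.re / 2) * spread s + 1 / 2 * ∑ k, |s k|) := by simp only [Real.exp_add]; ring
    _ ≤ A * (∑ S, |C S|) * Real.exp (lam.re * (n * R) + -lam.re * spread s +
        -(1 / 2) * ∑ k, |s k|) :=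
      mul_le_mul_of_nonneg_left (Real.exp_le_exp.2 h8) (mul_nonneg hA h7)
    _ = _ := by simp only [Real.exp_add]; ring

/-- The integral transform maps families of joint eigenfunctions to such families. -/
lemma IsEigenFamily.kerInt (hlam : 1 ≤ lam.re) {u : Fin (n + 1) → ℝ}
    {g : Finset (Fin n) → (Fin n → ℂ) → ℂ} (hg : IsEigenFamily lam (fun j => u j.castSucc) g) :
    IsEigenFamily lam u (kerInt lam (u (Fin.last n)) fun r => g ∅ (toC r)) where
  derivFamily := derivFamily_kerInt hlam _ (hg.continuous_toC ∅) (hg.hasGrowth ∅)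
  continuousOn := continuousOn_kerInt hlam _ (hg.continuous_toC ∅) (hg.hasGrowth ∅)
  differentiableOn := differentiableOn_kerInt hlam _ (hg.continuous_toC ∅) (hg.hasGrowth ∅)
  hasGrowth := hasGrowth_kerInt hlam _ (hg.hasGrowth ∅)
  eigen := by
    intro k t ht hinj
    set a := u (Fin.last n) with ha
    set f : (Fin n → ℝ) → ℂ := fun r => g ∅ (toC r) with hf
    cases k with
    | zero => rw [opValue_zero, elemSymm_zero, Complex.ofReal_one, one_mul]
    | succ k =>
    have hsinh := sinh_sub_ne_zero_of_mem_strip ht hinj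
    have hInt : ∀ B, Integrable (kerIntegrand lam a f B t) := fun B =>
      integrable_kerIntegrand hlam a (hg.continuous_toC ∅) (hg.hasGrowth ∅) B ht
    obtain ⟨C, hC⟩ := exists_norm_sFam_mul_le hlam a hg.hasGrowth ht
    have ibp : ∀ k, _ := fun k => integral_weight_opValue hlam (c := 1 / 2) (by norm_num)
      (derivFamily_sFam lam a ht) hg.derivFamily_toC (continuous_sFam lam a ht)
      hg.continuous_toC hC k
    set E := Complex.exp (Complex.I * a * ∑ j, t j) with hE
    have hker : ∀ r, kerIntegrand lam a f ∅ t r =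
        E * (weightW lam (toC r) * (sFam lam a t ∅ r * f r)) := by
      intro r
      rw [kerIntegrand]
      linear_combination weightW lam (toC r) * f r * tFam_empty_mul lam a t r
    -- Transposition moves the operator from the kernel to the function of fewer variables, where
    -- the induction hypothesis replaces it by its eigenvalue.
    have hS : ∀ k, ∫ r, weightW lam (toC r) * (opValue k (pairW lam (toC r))
        (fun j => -diagW lam (toC r) j) (fun B => sFam lam a t B r) * f r) =
        (elemSymm k (fun j => u j.castSucc) : ℂ) *
          ∫ r, weightW lam (toC r) * (sFam lam a t ∅ r * f r) := by
      intro k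
      rw [(ibp k).2, ← integral_const_mul]
      refine integral_congr_ae ?_
      filter_upwards [ae_injective n] with r hr
      rw [hg.eigen k (toC r) (toC_mem_strip r) (Complex.ofReal_injective.comp hr)]
      ring
    -- Under the integral the operator in t becomes its symbol, and the kernel identity splits it
    -- into the symbols of orders k + 1 and k in s, which are read back as operators acting on the
    -- s-family.
    have hae : (fun r => opValue (k + 1) (pairW lam t) (diagW lam t)
        (fun B => kerIntegrand lam a f B t r)) =ᵐ[volume] fun r =>
        E * (weightW lam (toC r) * (opValue (k + 1) (pairW lam (toC r))
          (fun j => -diagW lam (toC r) j) (fun B => sFam lam a t B r) * f r)) +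
        E * a * (weightW lam (toC r) * (opValue k (pairW lam (toC r))
          (fun j => -diagW lam (toC r) j) (fun B => sFam lam a t B r) * f r)) := by
      filter_upwards [ae_injective n] with r hr
      simp only [kerIntegrand]
      rw [mul_opValue, opValue_tFam _ _ _ _ hsinh, opValue_sFam _ _ _ hr, opValue_sFam _ _ _ hr,
        symMat_kernelLax lam a (s := toC r) hsinh (fun j k hjk => sinh_sub_ofReal_ne (hr.ne hjk))
          fun j k => cosh_ne_zero_of_cos_pos
            (by simpa using cos_pos_of_mem_strip ht j)]
      linear_combination weightW lam (toC r) * f r *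
        (symMat (k + 1) (kernelLaxS lam a t (toC r)) + a * symMat k (kernelLaxS lam a t (toC r))) *
        tFam_empty_mul lam a t r
    simp only [CalogeroMoser.kerInt]
    rw [mul_opValue, opValue_integral _ _ _ hInt, integral_congr_ae hae,
      integral_add ((ibp (k + 1)).1.const_mul _) ((ibp k).1.const_mul _),
      integral_const_mul, integral_const_mul, hS, hS]
    simp only [hker]
    rw [integral_const_mul, elemSymm_succ]
    push_cast
    ring

end IsEigenFamily

/-! ### The recursion for real variables -/

lemma phi_toC {n : ℕ} (s : Fin (n + 1) → ℝ) : phi (toC s) = 0 := by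
  simp [phi]

/-- Treats N = 1 on the same footing as larger N: the integral over ℝ⁰ is evaluation at a point and
equals 1. -/
lemma eigenF_succ {n : ℕ} (lam : ℂ) (t : Fin (n + 1) → ℂ) (u : Fin (n + 1) → ℝ) :
    eigenF lam (n + 1) t u =
      Complex.exp (Complex.I * u (Fin.last n) * ∑ j, t j) / (n.factorial : ℂ) *
        ∫ r : Fin n → ℝ, integrandI lam (eigenF lam n) t u r := by
  cases n with
  | zero =>
    have h : ∀ r : Fin 0 → ℝ, integrandI lam (eigenF lam 0) t u r = 1 := by
      intro r; simp [integrandI, weightW, kernelK, eigenF]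
    simp only [h]
    rw [Measure.volume_pi_eq_dirac, integral_dirac]
    have h2 : ∑ j, t j = t 0 := Fin.sum_univ_one t
    simp only [eigenF, Fin.last_zero, Nat.factorial_zero, Nat.cast_one, div_one, mul_one, h2]
    congr 1; ring
  | succ n => rfl

/-- The integrand involves only differences of the u_j. The shift by u_N in the recursion can
therefore be traded for a plane wave, so that the induction uses (u_1, …, u_{N-1}) unshifted. -/
lemma eigenF_add_const {N : ℕ} (lam : ℂ) (t : Fin N → ℂ) (u : Fin N → ℝ) (c : ℝ) :
    eigenF lam N t (fun j => u j + c) =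
      Complex.exp (Complex.I * c * ∑ j, t j) * eigenF lam N t u := by
  cases N with
  | zero => simp [eigenF]
  | succ n =>
    have h : integrandI lam (eigenF lam n) t (fun j => u j + c) =
        integrandI lam (eigenF lam n) t u := by
      ext r; simp [integrandI]
    rw [eigenF_succ, eigenF_succ, h]
    push_cast
    rw [show Complex.I * (u (Fin.last n) + c) * ∑ j, t j =
      Complex.I * c * ∑ j, t j + Complex.I * u (Fin.last n) * ∑ j, t j by ring, Complex.exp_add]
    ring

lemma integrandI_eq_kerIntegrand {n : ℕ} (lam : ℂ) {t : Fin (n + 1) → ℂ} (ht : phi t = 0)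
    (u : Fin (n + 1) → ℝ) (r : Fin n → ℝ) :
    Complex.exp (Complex.I * u (Fin.last n) * ∑ j, t j) * integrandI lam (eigenF lam n) t u r =
      kerIntegrand lam (u (Fin.last n)) (fun r => eigenF lam n (toC r) fun j => u j.castSucc) ∅ t
        r := by
  have h : (fun j => (r j : ℂ) + (phi t : ℂ) * Complex.I) = toC r := by
    ext j; simp [ht]
  have h2 := eigenF_add_const lam (toC r) (fun j => u j.castSucc) (-u (Fin.last n))
  simp only [← sub_eq_add_neg] at h2
  simp only [integrandI]
  rw [h, h2, kerIntegrand, tFam_empty_eq, kernelK]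
  simp only [toC_apply, kerFactor, Complex.ofReal_neg]
  rw [show Complex.I * -(u (Fin.last n) : ℂ) * ∑ x, (r x : ℂ) =
    -(Complex.I * u (Fin.last n) * ∑ x, (r x : ℂ)) by ring]
  ring

lemma eigenF_eq_kerInt {n : ℕ} (lam : ℂ) {t : Fin (n + 1) → ℂ} (ht : phi t = 0)
    (u : Fin (n + 1) → ℝ) :
    eigenF lam (n + 1) t u = kerInt lam (u (Fin.last n))
      (fun r => eigenF lam n (toC r) fun j => u j.castSucc) ∅ t := by
  rw [eigenF_succ, kerInt, ← funext (integrandI_eq_kerIntegrand lam ht u), integral_const_mul]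
  ring

/-- The function `F_N` is, at real points, part of a family of joint eigenfunctions. -/
lemma exists_isEigenFamily {lam : ℂ} (hlam : 1 ≤ lam.re) (N : ℕ) (u : Fin N → ℝ) :
    ∃ g, IsEigenFamily lam u g ∧ ∀ s, g ∅ (toC s) = eigenF lam N (toC s) u := by
  induction N with
  | zero => exact ⟨_, isEigenFamily_one lam u, fun s => by simp [eigenF]⟩
  | succ n ih =>
    obtain ⟨g, hg, hgF⟩ := ih fun j => u j.castSucc
    refine ⟨_, hg.kerInt hlam, fun s => ?_⟩
    rw [eigenF_eq_kerInt lam (phi_toC s)]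
    simp only [hgF]

/-! ### Simultaneous translations of the variables -/

lemma phi_add_const {n : ℕ} (t : Fin (n + 1) → ℂ) (z : ℂ) :
    phi (fun j => t j + z) = phi t + z.im := by
  have h1 : ⨆ j, (t j + z).im = (⨆ j, (t j).im) + z.im := by
    simp only [Complex.add_im]
    exact (ciSup_add (Set.finite_range _).bddAbove _).symm
  have h2 : ⨅ j, (t j + z).im = (⨅ j, (t j).im) + z.im := by
    simp only [Complex.add_im]
    exact (ciInf_add (Set.finite_range _).bddBelow _).symm
  rw [phi, phi, h1, h2]
  ring

lemma integrandI_add_const {n : ℕ} {lam : ℂ} {z : ℂ} {F : (Fin n → ℂ) → (Fin n → ℝ) → ℂ}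
    (hF : ∀ s v, F (fun j => s j + z) v = Complex.exp (Complex.I * z * ∑ j, (v j : ℂ)) * F s v)
    (t : Fin (n + 1) → ℂ) (u : Fin (n + 1) → ℝ) (r : Fin n → ℝ) :
    integrandI lam F (fun j => t j + z) u (r + fun _ => z.re) =
      Complex.exp (Complex.I * z * ∑ j : Fin n, ((u j.castSucc - u (Fin.last n) : ℝ) : ℂ)) *
        integrandI lam F t u r := by
  have h : (fun j => (((r + fun _ : Fin n => z.re) j : ℝ) : ℂ) +
      (phi (fun j => t j + z) : ℂ) * Complex.I) =
      fun j => ((r j : ℂ) + (phi t : ℂ) * Complex.I) + z := by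
    ext j
    rw [phi_add_const, Pi.add_apply]
    push_cast
    linear_combination Complex.re_add_im z
  simp only [integrandI]
  rw [h, hF]
  simp only [weightW, kernelK, add_sub_add_right_eq_sub]
  ring

/-- The contour follows the translation: its height changes by Im z, and the shift by Re z is
absorbed by the invariance of Lebesgue measure. Weight and kernel depend only on differences, so
complex z needs no holomorphy. -/
lemma eigenF_add {N : ℕ} (lam : ℂ) (t : Fin N → ℂ) (z : ℂ) (u : Fin N → ℝ) :
    eigenF lam N (fun j => t j + z) u =
      Complex.exp (Complex.I * z * ∑ j, (u j : ℂ)) * eigenF lam N t u := by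
  induction N with
  | zero => simp [eigenF]
  | succ n ih =>
    rw [eigenF_succ, eigenF_succ, ← integral_add_right_eq_self _ (fun _ => z.re)]
    simp only [integrandI_add_const fun s v => ih s v]
    rw [integral_const_mul, Fin.sum_univ_castSucc (fun j => (u j : ℂ)), Finset.sum_add_distrib]
    simp only [Complex.ofReal_sub, Finset.sum_sub_distrib, Finset.sum_const, Finset.card_univ,
      Fintype.card_fin, nsmul_eq_mul]
    have h : Complex.exp (Complex.I * u (Fin.last n) * (∑ j, t j + ((n + 1 : ℕ) : ℂ) * z)) *
        Complex.exp (Complex.I * z * (∑ j : Fin n, (u j.castSucc : ℂ) - n * u (Fin.last n))) =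
        Complex.exp (Complex.I * z * (∑ j : Fin n, (u j.castSucc : ℂ) + u (Fin.last n))) *
        Complex.exp (Complex.I * u (Fin.last n) * ∑ j, t j) := by
      rw [← Complex.exp_add, ← Complex.exp_add]
      congr 1
      push_cast
      ring
    linear_combination ((n.factorial : ℂ)⁻¹ * ∫ r, integrandI lam (eigenF lam n) t u r) * h

lemma abs_im_sub_phi_lt {n : ℕ} {t : Fin (n + 1) → ℂ} (ht : t ∈ domainA (n + 1))
    (j : Fin (n + 1)) : |(t j).im - phi t| < Real.pi / 2 := by
  obtain ⟨a, ha⟩ := exists_eq_ciSup_of_finite (f := fun j => (t j).im)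
  obtain ⟨b, hb⟩ := exists_eq_ciInf_of_finite (f := fun j => (t j).im)
  have h1 : (t j).im ≤ (t a).im := by
    rw [ha]; exact le_ciSup (f := fun j => (t j).im) (Set.finite_range _).bddAbove j
  have h2 : (t b).im ≤ (t j).im := by
    rw [hb]; exact ciInf_le (f := fun j => (t j).im) (Set.finite_range _).bddBelow j
  have h3 := (abs_lt.1 (ht a b)).2
  rw [Complex.sub_im] at h3
  rw [phi, ← ha, ← hb, abs_lt]
  constructor <;> linarith

lemma strip_subset_domainA (N : ℕ) : strip N ⊆ domainA N := by
  intro t ht j k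
  rw [Complex.sub_im]
  have h1 := ht j
  have h2 := ht k
  exact (abs_sub _ _).trans_lt (by linarith)

/-- The translation of the variables that centers their imaginary parts. -/
def center {n : ℕ} (η : ℝ) (t : Fin n → ℂ) : Fin n → ℂ := fun j => t j + -(η * Complex.I)

lemma center_phi_mem_strip {n : ℕ} {t : Fin (n + 1) → ℂ} (ht : t ∈ domainA (n + 1)) :
    center (phi t) t ∈ strip (n + 1) := by
  intro j
  simpa [center, sub_eq_add_neg] using abs_im_sub_phi_lt ht j

lemma phi_center {n : ℕ} (t : Fin (n + 1) → ℂ) : phi (center (phi t) t) = 0 := by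
  unfold center
  rw [phi_add_const]
  simp

lemma eigenF_center {n : ℕ} (lam : ℂ) (η : ℝ) (t : Fin n → ℂ) (u : Fin n → ℝ) :
    eigenF lam n t u =
      Complex.exp (-η * ∑ j, (u j : ℂ)) * eigenF lam n (center η t) u := by
  unfold center
  rw [eigenF_add, ← mul_assoc, ← Complex.exp_add]
  rw [show -(η : ℂ) * ∑ j, (u j : ℂ) + Complex.I * -(η * Complex.I) * ∑ j, (u j : ℂ) = 0 by
    linear_combination (-(η : ℂ) * ∑ j, (u j : ℂ)) * Complex.I_sq, Complex.exp_zero, one_mul]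

/-! ### The function `F_N` on the strip -/

/-- When the contour is real, the integrand sees the function of n variables only at real points.
Agreement there thus gives agreement in n + 1 variables at every centred t, real or not. -/
lemma exists_isEigenFamily_succ {lam : ℂ} (hlam : 1 ≤ lam.re) {n : ℕ} (u : Fin (n + 1) → ℝ) :
    ∃ g, IsEigenFamily lam u g ∧ ∀ t, phi t = 0 → eigenF lam (n + 1) t u = g ∅ t := by
  obtain ⟨g, hg, hgF⟩ := exists_isEigenFamily hlam n fun j => u j.castSucc
  refine ⟨_, hg.kerInt hlam, fun t ht => ?_⟩
  rw [eigenF_eq_kerInt lam ht]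
  simp only [hgF]

lemma frequently_ofReal {p : ℂ → Prop} (h : ∀ x : ℝ, p x) : ∃ᶠ z in 𝓝[≠] (0 : ℂ), p z := by
  have h1 : Tendsto (fun x : ℝ => (x : ℂ)) (𝓝[≠] 0) (𝓝[≠] 0) := by
    refine tendsto_nhdsWithin_iff.2 ⟨?_, ?_⟩
    · refine (Complex.continuous_ofReal.tendsto' 0 0 Complex.ofReal_zero).mono_left
        nhdsWithin_le_nhds
    · filter_upwards [self_mem_nhdsWithin] with x hx
      simpa using hx
  exact h1.frequently (Eventually.of_forall h).frequently

/-- A holomorphic function with the covariance of `F_N` under real translations has it under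
complex translations. -/
lemma covariant_of_differentiableOn {N : ℕ} {G : (Fin N → ℂ) → ℂ}
    (hG : DifferentiableOn ℂ G (strip N)) {c : ℂ} {t : Fin N → ℂ} (ht : t ∈ strip N)
    (hreal : ∀ x : ℝ, G (fun j => t j + x) = Complex.exp (Complex.I * x * c) * G t) {z : ℂ}
    (hz : (fun j => t j + z) ∈ strip N) :
    G (fun j => t j + z) = Complex.exp (Complex.I * z * c) * G t := by
  set U : Set ℂ := {z | (fun j => t j + z) ∈ strip N} with hU
  have hcont : Continuous fun z : ℂ => (fun j => t j + z : Fin N → ℂ) := by fun_prop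
  have hUo : IsOpen U := (isOpen_strip N).preimage hcont
  have hUc : Convex ℝ U := by
    have : U = ⋂ j, {z : ℂ | |(t j).im + z.im| < Real.pi / 2} := by
      ext z; simp [hU, strip]
    rw [this]
    refine convex_iInter fun j => ?_
    have h2 : {z : ℂ | |(t j).im + z.im| < Real.pi / 2} =
        Complex.imCLM ⁻¹' Set.Ioo (-(Real.pi / 2) - (t j).im) (Real.pi / 2 - (t j).im) := by
      ext z
      simp only [Set.mem_ofPred_eq, abs_lt, Set.mem_preimage, Set.mem_Ioo, Complex.imCLM_apply]
      constructor
      · rintro ⟨h1, h2⟩; constructor <;> linarith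
      · rintro ⟨h1, h2⟩; constructor <;> linarith
    rw [h2]
    exact (convex_Ioo _ _).linear_preimage Complex.imCLM.toLinearMap
  have h0 : (0 : ℂ) ∈ U := by simpa [hU] using ht
  have hd1 : DifferentiableOn ℂ (fun z => G (fun j => t j + z)) U := by
    refine hG.comp (t := strip N) ?_ fun z hz => hz
    fun_prop
  have hd2 : DifferentiableOn ℂ (fun z => Complex.exp (Complex.I * z * c) * G t) U := by
    fun_prop
  -- Identity theorem on the convex set of admissible shifts, where the real shifts accumulate at 0.
  exact (hd1.analyticOnNhd hUo).eqOn_of_preconnected_of_frequently_eq (hd2.analyticOnNhd hUo)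
    hUc.isPreconnected h0 (frequently_ofReal hreal) hz

/-- The two functions agree at the centred point and have the same covariance along the imaginary
translation back to t. This takes the place of a deformation of the contour from height φ(t) to the
real axis. -/
lemma eigenF_eq_of_mem_strip {lam : ℂ} {n : ℕ} {u : Fin (n + 1) → ℝ}
    {g : Finset (Fin (n + 1)) → (Fin (n + 1) → ℂ) → ℂ} (hg : IsEigenFamily lam u g)
    (hgF : ∀ t, phi t = 0 → eigenF lam (n + 1) t u = g ∅ t) {t : Fin (n + 1) → ℂ}
    (ht : t ∈ strip (n + 1)) : eigenF lam (n + 1) t u = g ∅ t := by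
  have h0 := center_phi_mem_strip (strip_subset_domainA _ ht)
  have ht' : (fun j => center (phi t) t j + (phi t * Complex.I : ℂ)) = t := by
    ext j; simp [center]
  have h1 := covariant_of_differentiableOn hg.differentiableOn (c := ∑ j, (u j : ℂ)) h0
    (fun x => by
      rw [← hgF _ (phi_center t), ← hgF _ (by rw [phi_add_const, phi_center]; simp), eigenF_add])
    (z := phi t * Complex.I) (by rw [ht']; exact ht)
  have h2 := eigenF_add lam (center (phi t) t) (phi t * Complex.I) u
  rw [ht'] at h1 h2
  rw [h1, h2, hgF _ (phi_center t)]

/-! ### The joint eigenfunctions on `𝒜_N` -/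

lemma pairW_diagW_center {N : ℕ} (lam : ℂ) (η : ℝ) (t : Fin N → ℂ) :
    pairW lam (center η t) = pairW lam t ∧ diagW lam (center η t) = diagW lam t := by
  constructor
  · ext j k; simp [pairW, center]
  · ext j; simp [diagW, center]

lemma continuous_center {N : ℕ} (η : ℝ) : Continuous (center η : (Fin N → ℂ) → Fin N → ℂ) := by
  unfold center; fun_prop

/-- The family on a translated strip. -/
lemma derivFamily_center {N : ℕ} {g : Finset (Fin N) → (Fin N → ℂ) → ℂ}
    (hg : DerivFamily (strip N) Complex.I g) (η : ℝ) (c : ℂ) :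
    DerivFamily (center η ⁻¹' strip N) Complex.I fun S t => c * g S (center η t) := by
  intro S j hj t ht
  have h := hg S j hj (center η t) ht
  have h2 : ∀ z, center η (Function.update t j z) =
      Function.update (center η t) j (z + -(η * Complex.I)) := by
    intro z; ext k
    by_cases hk : k = j
    · subst hk; simp [center]
    · simp [center, hk]
  simp only [h2]
  refine ((HasDerivAt.comp_add_const (t j) (-(η * Complex.I)) h).const_mul c).congr_deriv ?_
  ring

section main

variable {lam : ℂ} {n : ℕ}

/-- At the centred point the integrand is, up to a nonzero constant, the integrand of the
real-contour transform. An imaginary translation multiplies it by a constant and leaves the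
parameter r unchanged. -/
lemma integrable_integrandI (hlam : 1 ≤ lam.re) (u : Fin (n + 1) → ℝ) {t : Fin (n + 1) → ℂ}
    (ht : t ∈ domainA (n + 1)) : Integrable (integrandI lam (eigenF lam n) t u) := by
  obtain ⟨g, hg, hgF⟩ := exists_isEigenFamily hlam n fun j => u j.castSucc
  have h1 := integrable_kerIntegrand hlam (u (Fin.last n)) (hg.continuous_toC ∅) (hg.hasGrowth ∅) ∅
    (center_phi_mem_strip ht)
  simp only [hgF] at h1
  rw [← funext (integrandI_eq_kerIntegrand lam (phi_center t) u)] at h1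
  have h2 : Integrable (integrandI lam (eigenF lam n) (center (phi t) t) u) := by
    refine (h1.const_mul (Complex.exp
      (Complex.I * u (Fin.last n) * ∑ j, center (phi t) t j))⁻¹).congr
      (Eventually.of_forall fun r => ?_)
    exact inv_mul_cancel_left₀ (Complex.exp_ne_zero _) _
  refine (h2.const_mul (Complex.exp (Complex.I * (phi t * Complex.I) *
    ∑ j : Fin n, ((u j.castSucc - u (Fin.last n) : ℝ) : ℂ)))).congr
    (Eventually.of_forall fun r => ?_)
  · have h := integrandI_add_const (lam := lam) (z := phi t * Complex.I)
      (fun s v => eigenF_add lam s _ v) (center (phi t) t) u r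
    have ht' : (fun j => center (phi t) t j + (phi t * Complex.I : ℂ)) = t := by
      ext j; simp [center]
    have hr : (r + fun _ => (phi t * Complex.I : ℂ).re) = r := by ext j; simp
    rw [ht', hr] at h
    exact h.symm

lemma eigenF_eq_on_translated_strip {g : Finset (Fin (n + 1)) → (Fin (n + 1) → ℂ) → ℂ}
    {u : Fin (n + 1) → ℝ} (hg : IsEigenFamily lam u g)
    (hgF : ∀ t, phi t = 0 → eigenF lam (n + 1) t u = g ∅ t) (η : ℝ) :
    ∀ t ∈ center η ⁻¹' strip (n + 1), eigenF lam (n + 1) t u =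
      Complex.exp (-η * ∑ j, (u j : ℂ)) * g ∅ (center η t) := by
  intro t ht
  rw [eigenF_center lam η, eigenF_eq_of_mem_strip hg hgF ht]

lemma differentiableOn_eigenF (hlam : 1 ≤ lam.re) (u : Fin (n + 1) → ℝ) :
    DifferentiableOn ℂ (fun t => eigenF lam (n + 1) t u) (domainA (n + 1)) := by
  obtain ⟨g, hg, hgF⟩ := exists_isEigenFamily_succ hlam u
  intro t ht
  -- The height is frozen at its value at t, since `phi` is not holomorphic; one and the same
  -- formula then holds on a whole neighbourhood.
  have hD := (isOpen_strip (n + 1)).preimage (continuous_center (phi t))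
  have hev := eigenF_eq_on_translated_strip hg hgF (phi t)
  have ht' : t ∈ center (phi t) ⁻¹' strip (n + 1) := center_phi_mem_strip ht
  refine DifferentiableAt.differentiableWithinAt ?_
  have h1 : DifferentiableAt ℂ (g ∅) (center (phi t) t) :=
    hg.differentiableOn.differentiableAt ((isOpen_strip _).mem_nhds ht')
  have h2 : DifferentiableAt ℂ (center (phi t)) t := by unfold center; fun_prop
  refine DifferentiableAt.congr_of_eventuallyEq ((h1.comp t h2).const_mul
    (Complex.exp (-(phi t) * ∑ j, (u j : ℂ)))) ?_
  filter_upwards [hD.mem_nhds ht'] with s hs using hev s hs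

/-- The coefficients depend only on differences of the variables, and the covariance factor for a
frozen height is constant, so the equation on the strip carries over to its translate. -/
lemma sigmaHat_eigenF (hlam : 1 ≤ lam.re) (u : Fin (n + 1) → ℝ) (k : ℕ) {t : Fin (n + 1) → ℂ}
    (ht : t ∈ domainA (n + 1)) (hinj : Function.Injective t) :
    sigmaHat lam k (fun t => eigenF lam (n + 1) t u) t =
      elemSymm k u * eigenF lam (n + 1) t u := by
  obtain ⟨g, hg, hgF⟩ := exists_isEigenFamily_succ hlam u
  have hD := (isOpen_strip (n + 1)).preimage (continuous_center (phi t))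
  have hev := eigenF_eq_on_translated_strip hg hgF (phi t)
  have ht' : t ∈ center (phi t) ⁻¹' strip (n + 1) := center_phi_mem_strip ht
  have hinj' : Function.Injective (center (phi t) t) :=
    fun j k h => hinj (add_right_cancel h)
  have hsinh : ∀ j k, j ≠ k → Complex.sinh (t j - t k) ≠ 0 := fun j k hjk =>
    sinh_ne_zero_of_abs_im_lt (sub_ne_zero.2 (hinj.ne hjk)) (ht j k)
  rw [sigmaHat_eq lam k hD (derivFamily_center hg.derivFamily (phi t) _) hev ht' hsinh, hev t ht',
    mul_opValue, ← (pairW_diagW_center lam (phi t) t).1,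
    ← (pairW_diagW_center lam (phi t) t).2, hg.eigen k _ ht' hinj']
  ring

lemma tendsto_sigmaHat_eigenF (hlam : 1 ≤ lam.re) (u : Fin (n + 1) → ℝ) (k : ℕ)
    {t₀ : Fin (n + 1) → ℂ} (ht₀ : t₀ ∈ domainA (n + 1)) :
    Tendsto (sigmaHat lam k fun t => eigenF lam (n + 1) t u)
      (𝓝[{t | t ∈ domainA (n + 1) ∧ Function.Injective t}] t₀)
      (𝓝 (elemSymm k u * eigenF lam (n + 1) t₀ u)) := by
  have h1 : Tendsto (fun t => (elemSymm k u : ℂ) * eigenF lam (n + 1) t u)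
      (𝓝[{t | t ∈ domainA (n + 1) ∧ Function.Injective t}] t₀)
      (𝓝 (elemSymm k u * eigenF lam (n + 1) t₀ u)) :=
    (((differentiableOn_eigenF hlam u).continuousOn t₀ ht₀).mono_left
      (nhdsWithin_mono _ fun t ht => ht.1)).const_mul _
  refine h1.congr' ?_
  filter_upwards [self_mem_nhdsWithin] with t ht
  exact (sigmaHat_eigenF hlam u k ht.1 ht.2).symm

end main

/-! ### The Hamiltonians -/

lemma elemSymm_mul {N : ℕ} (k : ℕ) (a : ℝ) (u : Fin N → ℝ) :
    elemSymm k (fun j => a * u j) = a ^ k * elemSymm k u := by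
  rw [elemSymm, elemSymm, Finset.esymm_map_val, Finset.esymm_map_val, Finset.mul_sum]
  refine Finset.sum_congr rfl fun S hS => ?_
  rw [Finset.prod_mul_distrib, Finset.prod_const, (Finset.mem_powersetCard.1 hS).2]

lemma isOpen_setOf_injective (N : ℕ) : IsOpen {x : Fin N → ℝ | Function.Injective x} := by
  have h : {x : Fin N → ℝ | Function.Injective x} =
      ⋂ j, ⋂ k, {x | j = k ∨ x j ≠ x k} := by
    ext x
    simp only [Set.mem_ofPred_eq, Set.mem_iInter, Function.Injective]
    refine forall_congr' fun j => forall_congr' fun k => ?_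
    tauto
  rw [h]
  refine isOpen_iInter_of_finite fun j => isOpen_iInter_of_finite fun k => ?_
  by_cases hjk : j = k
  · simp [hjk]
  · simpa [hjk] using isOpen_ne_fun (continuous_apply j) (continuous_apply k)

lemma opValue_smul {N : ℕ} (k : ℕ) {v : Fin N → Fin N → ℂ} (hv : ∀ i j, v i j = v j i) (z : ℂ)
    (x : Fin N → ℂ) (g : Finset (Fin N) → ℂ) :
    opValue k (fun i j => z ^ 2 * v i j) (fun i => z * x i) (fun B => z ^ B.card * g B) =
      z ^ k * opValue k v x g := by
  simp only [opValue, Finset.mul_sum]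
  refine Finset.sum_congr rfl fun U hU => Finset.sum_congr rfl fun B hB => ?_
  have hc := Finset.card_sdiff_add_card_eq_card (Finset.mem_powerset.1 hB)
  rw [pairSum_smul hv, ← (Finset.mem_powersetCard.1 hU).2, ← hc, pow_add]
  ring

lemma weightW_ne_zero {N : ℕ} (lam : ℂ) {t : Fin N → ℂ}
    (ht : ∀ j k, j ≠ k → Complex.sinh (t j - t k) ≠ 0) : weightW lam t ≠ 0 := by
  refine Finset.prod_ne_zero_iff.2 fun j _ => Finset.prod_ne_zero_iff.2 fun k hk => ?_
  rw [Complex.cpow_ne_zero_iff]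
  exact Or.inl (mul_ne_zero (by norm_num) (pow_ne_zero 2 (ht j k (Finset.mem_Ioi.1 hk).ne)))

lemma laxL_add_diagE {N : ℕ} (hbar mu : ℝ) (lam : ℂ) (x : Fin N → ℝ) :
    laxL mu (hbar * lam) x + diagE mu (hbar * lam) x =
      diagOff (fun j => MvPolynomial.X j +
        MvPolynomial.C (((hbar * mu / 2 : ℝ) : ℂ) * diagW lam (toC fun j => mu * x j / 2) j))
        fun i j => MvPolynomial.C
          (((hbar * mu / 2 : ℝ) : ℂ) * laxOff lam (toC fun j => mu * x j / 2) i j) := by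
  have h : ∀ i j, ((mu * (x i - x j) / 2 : ℝ) : ℂ) =
      toC (fun j => mu * x j / 2) i - toC (fun j => mu * x j / 2) j := by
    intro i j; simp only [toC_apply]; push_cast; ring
  ext1 i j
  simp only [laxL, diagE, diagOff, Matrix.add_apply, Matrix.of_apply, Matrix.diagonal_apply, h]
  by_cases hij : i = j
  · simp only [hij, if_true]
    rw [diagW]
    congr 2
    push_cast; ring
  · simp only [hij, if_false, add_zero]
    rw [laxOff]
    congr 1
    push_cast
    rw [← div_div]
    ring

/-- Conjugation removes the square root of the weight, and the substitution t = μx/2 multiplies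
momenta and matrix entries alike by A = ħμ/2. By homogeneity the operator of order k acquires A^k,
which converts S_k(2p/(ħμ)) into S_k(p). -/
lemma hamiltonian_eigenPsi {lam : ℂ} (hlam : 1 ≤ lam.re) {n : ℕ} {hbar mu : ℝ} (hh : 0 < hbar)
    (hmu : 0 < mu) (x p : Fin (n + 1) → ℝ) (hx : Function.Injective x) (k : ℕ) :
    hamiltonian hbar mu (hbar * lam) k (fun y => eigenPsi hbar mu (hbar * lam) y p) x =
      elemSymm k p * eigenPsi hbar mu (hbar * lam) x p := by
  have hh0 : (hbar : ℂ) ≠ 0 := Complex.ofReal_ne_zero.2 hh.ne'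
  set u : Fin (n + 1) → ℝ := fun j => 2 * p j / (hbar * mu) with hu
  set y : (Fin (n + 1) → ℝ) → Fin (n + 1) → ℝ := fun x j => mu * x j / 2 with hy
  set A : ℂ := ((hbar * mu / 2 : ℝ) : ℂ) with hA
  have hyinj : ∀ {x}, Function.Injective x → Function.Injective (y x) := by
    intro x hx j k h
    refine hx (mul_left_cancel₀ hmu.ne' ?_)
    simp only [hy] at h
    linarith
  have hsinh : ∀ {x}, Function.Injective x →
      ∀ j k, j ≠ k → Complex.sinh (toC (y x) j - toC (y x) k) ≠ 0 :=
    fun hx j k hjk => sinh_sub_ofReal_ne ((hyinj hx).ne hjk)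
  obtain ⟨g, hg, hgF⟩ := exists_isEigenFamily hlam (n + 1) u
  have hlam' : (hbar * lam : ℂ) / hbar = lam := mul_div_cancel_left₀ _ hh0
  have hΨ : ∀ x, eigenPsi hbar mu (hbar * lam) x p =
      sqrtWeight hbar mu (hbar * lam) x * g ∅ (toC (y x)) := by
    intro x
    rw [hgF, eigenPsi, hlam']
    rfl
  -- The factor A^|S| is built into the family so that -iħ∂_x acts as A times -i∂_t.
  have hfam : DerivFamily {x | Function.Injective x} (Complex.I / hbar)
      fun S (x : Fin (n + 1) → ℝ) => A ^ S.card * g S (toC (y x)) := by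
    intro S j hj x _
    have h1 := hg.derivFamily_toC S j hj (y x) (Set.mem_univ _)
    have h2 : ∀ z, y (Function.update x j z) = Function.update (y x) j (mu / 2 * z) := by
      intro z; ext k
      by_cases hk : k = j
      · subst hk; simp [hy]; ring
      · simp [hy, hk]
    have h3 : HasDerivAt (fun z : ℝ => mu / 2 * z) (mu / 2) (x j) := by
      simpa using (hasDerivAt_id (x j)).const_mul (mu / 2)
    have e : y x j = mu / 2 * x j := by simp only [hy]; ring
    simp only [h2]
    rw [e] at h1
    refine ((HasDerivAt.scomp (x j) h1 h3).const_mul (A ^ S.card)).congr_deriv ?_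
    rw [Finset.card_insert_of_notMem hj, pow_succ, Complex.real_smul, hA]
    push_cast
    field_simp
  -- The cancellation is needed on the open set of distinct coordinates, where the weight does not
  -- vanish, because it is differentiated afterwards.
  have hconj : ∀ z ∈ {x : Fin (n + 1) → ℝ | Function.Injective x},
      (sqrtWeight hbar mu (hbar * lam) z)⁻¹ * eigenPsi hbar mu (hbar * lam) z p =
        A ^ (∅ : Finset (Fin (n + 1))).card * g ∅ (toC (y z)) := by
    intro z hz
    have h0 : sqrtWeight hbar mu (hbar * lam) z ≠ 0 := weightW_ne_zero _ (hsinh hz)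
    rw [hΨ, inv_mul_cancel_left₀ h0, Finset.card_empty, pow_zero,
      one_mul]
  have hop := normalOrdered_symMat (c' := -Complex.I * hbar)
    (σ := fun z => symMat k (laxL mu (hbar * lam) z + diagE mu (hbar * lam) z))
    (a := fun i j => A * laxOff lam (toC (y x)) i j)
    (e := fun i j => A * (Complex.I * lam * coth (toC (y x) i - toC (y x) j)))
    (d := fun j => A * diagW lam (toC (y x)) j) hfam (isOpen_setOf_injective _) hconj
    (by field_simp; rw [Complex.I_sq]; ring)
    (fun i j l hij hjl hil => by
      linear_combination A ^ 2 * laxOff_mul_laxOff lam (hsinh hx) i j l hij hjl hil)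
    k (t := x) hx (congrArg (symMat k) (laxL_add_diagE hbar mu lam x))
  rw [hamiltonian, hop, hΨ]
  have hv : (fun i j => -(A * laxOff lam (toC (y x)) i j * (A * laxOff lam (toC (y x)) j i))) =
      fun i j => A ^ 2 * pairW lam (toC (y x)) i j := by
    ext i j
    rw [← neg_laxOff_mul]
    ring
  rw [hv]
  have h1 := opValue_smul k (pairW_symm lam (toC (y x))) A (diagW lam (toC (y x)))
    (fun B => g B (toC (y x)))
  rw [hg.eigen k _ (toC_mem_strip _) (Complex.ofReal_injective.comp (hyinj hx))] at h1
  have h2 : elemSymm k p = (hbar * mu / 2) ^ k * elemSymm k u := by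
    rw [← elemSymm_mul]
    congr 1
    ext j
    simp only [hu]
    field_simp
  unfold opValue at h1
  rw [h1, h2, hA]
  push_cast
  ring

end

end CalogeroMoser

/-- For `Re λ ≥ 1` the integrals defining `F_N` converge absolutely on `𝒜_N`, and `F_N` is a
holomorphic joint eigenfunction there. The coefficients of the operators are singular where
`t_j = t_k` for some `j ≠ k`; at such points the left-hand side is its limit. -/
theorem theorem6p2 (lam : ℂ) (hlam : 1 ≤ lam.re) :
    (∀ (n : ℕ) (u : Fin (n + 2) → ℝ), ∀ t ∈ CalogeroMoser.domainA (n + 2),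
      MeasureTheory.Integrable
        (CalogeroMoser.integrandI lam (CalogeroMoser.eigenF lam (n + 1)) t u)
        MeasureTheory.volume) ∧
    ∀ N : ℕ, 1 ≤ N →
      (∀ u : Fin N → ℝ,
        DifferentiableOn ℂ (fun t => CalogeroMoser.eigenF lam N t u)
          (CalogeroMoser.domainA N) ∧
        ∀ k : ℕ, 1 ≤ k → k ≤ N →
          (∀ t ∈ CalogeroMoser.domainA N, Function.Injective t →
            CalogeroMoser.sigmaHat lam k (fun t' => CalogeroMoser.eigenF lam N t' u) t =
              (CalogeroMoser.elemSymm k u : ℂ) * CalogeroMoser.eigenF lam N t u) ∧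
          (∀ t₀ ∈ CalogeroMoser.domainA N,
            Filter.Tendsto
              (CalogeroMoser.sigmaHat lam k (fun t' => CalogeroMoser.eigenF lam N t' u))
              (nhdsWithin t₀ {t | t ∈ CalogeroMoser.domainA N ∧ Function.Injective t})
              (nhds ((CalogeroMoser.elemSymm k u : ℂ) *
                CalogeroMoser.eigenF lam N t₀ u)))) ∧
      (∀ (hbar mu : ℝ), 0 < hbar → 0 < mu → ∀ (x p : Fin N → ℝ), Function.Injective x →
        ∀ k : ℕ, 1 ≤ k → k ≤ N →
          CalogeroMoser.hamiltonian hbar mu (hbar * lam) k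
              (fun y => CalogeroMoser.eigenPsi hbar mu (hbar * lam) y p) x =
            (CalogeroMoser.elemSymm k p : ℂ) *
              CalogeroMoser.eigenPsi hbar mu (hbar * lam) x p) := by
  refine ⟨fun n u t ht => CalogeroMoser.integrable_integrandI hlam u ht, fun N hN => ?_⟩
  obtain ⟨n, rfl⟩ := Nat.exists_eq_add_of_le' hN
  refine ⟨fun u => ⟨CalogeroMoser.differentiableOn_eigenF hlam u, fun k _ _ =>
    ⟨fun t ht hinj => CalogeroMoser.sigmaHat_eigenF hlam u k ht hinj,
      fun t ht => CalogeroMoser.tendsto_sigmaHat_eigenF hlam u k ht⟩⟩,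
    fun hbar mu hh hmu x p hx k _ _ => CalogeroMoser.hamiltonian_eigenPsi hlam hh hmu x p hx k⟩
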